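/- Let $\alpha>0$, $\Delta>0$, $\theta\in[0,1/2]$. For integers $N,M\ge1$ let $\mathcal D=\{(x_\mu,y_\mu^{\rm true},y_\mu)\}_{\mu=1}^M$ be i.i.d., where $y^{\rm true}\in\{0,1\}$ with $\Pr[y^{\rm true}=1]=\rho=1/2$, the observed label $y\in\{0,1\}$ satisfies $\Pr[y\ne y^{\rm true}\mid y^{\rm true}]=\theta$, and $x=(2y^{\rm true}-1)v/\sqrt N+\sqrt\Delta\,z\in\mathbb R^N$ with $v=(1,\dots,1)$ and $z\sim\mathcal N(0,I_N)$ independent of the labels. Let $\sigma(u)=(u+1)/2$. For regularization strengths $\lambda^0,\lambda^1>0$ and inverse temperature $\beta^1>0$, the linear self-distillation model is defined in stages $t=0,1$: $(\hat w^t,\hat B^t)$ is the minimizer over $(w,B)\in\mathbb R^N\times\mathbb R$ of $$\sum_{\mu=1}^M\Bigl(y_\mu^t-\sigma\Bigl(\tfrac{w\cdot x_\mu}{\sqrt N}+B\Bigr)\Bigr)^2+\frac{\lambda^t}{2}\|w\|^2,$$ where $y_\mu^0=y_\mu$ and $y_\mu^1=\sigma\bigl(\beta^1(\hat w^0\cdot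 x_\mu/\sqrt N+\hat B^0)\bigr)$. The generalization error of stage $t$ is $$\mathcal E^t_{N,M}=\mathbb E_{\mathcal D}\,\mathbb E_{x,y^{\rm true}}\Bigl[\mathbb I\bigl(\mathbb I[\sigma(\hat w^t\cdot x/\sqrt N+\hat B^t)>1/2]\neq y^{\rm true}\bigr)\Bigr],$$ with $(x,y^{\rm true})$ an independent test point of the same distribution. Let $H(x)=1-\int_{-\infty}^x e^{-t^2/2}\,dt/\sqrt{2\pi}$. For all fixed $\lambda^0,\lambda^1,\beta^1>0$, the limits $\mathcal E^0(\lambda^0)$ of $\mathcal E^0_{N,M}$ and $\mathcal E^1(\lambda^0,\lambda^1,\beta^1)$ of $\mathcal E^1_{N,M}$ exist as $N,M\to\infty$ with $M/N\to\alpha$, and they depend on the way in which $N,M\to\infty$ only through $\alpha$. Moreover $$\lim_{\lambda^0\to\infty}\mathcal E^0(\lambda^0)=\mathcal E^0:=H\left(\frac{\sqrt{\alpha}(1-2\theta)}{\sqrt{\Delta\left(\Delta+\alpha(1-2\theta)^2\right)}}\right),$$ and, for every $\beta^1>0$, as $\lambda^0,\lambda^1\to\infty$ jointly, $$\lim\mathcal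 E^1(\lambda^0,\lambda^1,\beta^1)=\mathcal E^1:=H\left(\frac{\alpha(\Delta+\alpha+\Delta\alpha)(1-2\theta)}{\sqrt{\Delta\left[(\alpha^2+3\alpha+1)\Delta^3\alpha+\alpha^2\left(\Delta^2(\alpha^2+5\alpha+3)+\Delta(2\alpha+3)\alpha+\alpha^2\right)(1-2\theta)^2\right]}}\right).$$ Finally, the optimal asymptotic errors $\mathcal E^{*0}=\inf_{\lambda^0>0}\mathcal E^0(\lambda^0)$ and $\mathcal E^{*1}=\inf_{\lambda^0,\lambda^1,\beta^1>0}\mathcal E^1(\lambda^0,\lambda^1,\beta^1)$ satisfy $\mathcal E^{*0}=\mathcal E^0$ and $\mathcal E^{*1}\le\mathcal E^1$. -/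

import Mathlib

open MeasureTheory ProbabilityTheory Filter Topology

noncomputable section

namespace SelfDistillation

/-- The Bernoulli distribution with success probability `p`. -/
def bernoulliLaw (p : ℝ) : Measure Bool :=
  ENNReal.ofReal p • Measure.dirac true + ENNReal.ofReal (1 - p) • Measure.dirac false

/-- The randomness behind one data point: the true class, whether the observed label is flipped,
and the standard Gaussian noise vector. -/
abbrev Sample (N : ℕ) : Type := (Bool × Bool) × (Fin N → ℝ)

/-- Class prior `ρ`, flip probability `θ`, i.i.d. standard normal noise, all independent. -/
def sampleLaw (ρ θ : ℝ) (N : ℕ) : Measure (Sample N) :=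
  ((bernoulliLaw ρ).prod (bernoulliLaw θ)).prod (Measure.pi fun _ : Fin N => gaussianReal 0 1)

/-- `M` i.i.d. data points. -/
def trainingLaw (ρ θ : ℝ) (N M : ℕ) : Measure (Fin M → Sample N) :=
  Measure.pi fun _ : Fin M => sampleLaw ρ θ N

/-- The true label, in `{0, 1}`. -/
def trueLabel {N : ℕ} (s : Sample N) : ℝ := if s.1.1 then 1 else 0

/-- The observed label, in `{0, 1}`. -/
def observedLabel {N : ℕ} (s : Sample N) : ℝ := if s.1.2 then 1 - trueLabel s else trueLabel s

/-- The class mean direction `(1, …, 1)`. -/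
def meanVector (N : ℕ) : Fin N → ℝ := fun _ => 1

/-- The feature vector `x = (2 y_true - 1) v / √N + √Δ z`. -/
def feature (Δ : ℝ) {N : ℕ} (s : Sample N) : Fin N → ℝ :=
  fun i => (2 * trueLabel s - 1) * (meanVector N i / √(N : ℝ)) + √Δ * s.2 i

/-- The linear activation function. -/
def activation (u : ℝ) : ℝ := (u + 1) / 2

/-- The pre-activation `w · x / √N + B` of the parameters `p = (w, B)`. -/
def preactivation {N : ℕ} (p : (Fin N → ℝ) × ℝ) (x : Fin N → ℝ) : ℝ :=
  (∑ i, p.1 i * x i) / √(N : ℝ) + p.2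

/-- The regularized squared loss of the parameters `p = (w, B)` on inputs `x` with targets `y`. -/
def trainLoss {N M : ℕ} (lam : ℝ) (x : Fin M → Fin N → ℝ) (y : Fin M → ℝ)
    (p : (Fin N → ℝ) × ℝ) : ℝ :=
  ∑ μ, (y μ - activation (preactivation p (x μ))) ^ 2 + lam / 2 * ∑ i, p.1 i ^ 2

/-- A minimizer `(w, B)` of the loss; it exists and is unique if `0 < lam` and `0 < M`. -/
def minimizer {N M : ℕ} (lam : ℝ) (x : Fin M → Fin N → ℝ) (y : Fin M → ℝ) : (Fin N → ℝ) × ℝ :=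
  Classical.epsilon fun p => ∀ q, trainLoss lam x y p ≤ trainLoss lam x y q

/-- The parameters learned at stage `t` of self-distillation: stage `0` is trained on the observed
labels, stage `t + 1` on the pseudo-labels that stage `t` produces at inverse temperature
`beta (t + 1)`. -/
def estimator (Δ : ℝ) {N M : ℕ} (lam beta : ℕ → ℝ) (D : Fin M → Sample N) :
    ℕ → (Fin N → ℝ) × ℝ
  | 0 => minimizer (lam 0) (fun μ => feature Δ (D μ)) (fun μ => observedLabel (D μ))
  | t + 1 => minimizer (lam (t + 1)) (fun μ => feature Δ (D μ))
      (fun μ => activation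
        (beta (t + 1) * preactivation (estimator Δ lam beta D t) (feature Δ (D μ))))

/-- The predicted label, in `{0, 1}`. -/
def prediction {N : ℕ} (p : (Fin N → ℝ) × ℝ) (x : Fin N → ℝ) : ℝ :=
  if 1 / 2 < activation (preactivation p x) then 1 else 0

/-- The generalization error of stage `t`, averaged over the training set `D` and an independent
test point `s`. -/
def genError (ρ θ Δ : ℝ) (lam beta : ℕ → ℝ) (t N M : ℕ) : ℝ :=
  ∫ D : Fin M → Sample N, ∫ s : Sample N,
    (if prediction (estimator Δ lam beta D t) (feature Δ s) ≠ trueLabel s then (1 : ℝ) else 0)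
    ∂(sampleLaw ρ θ N) ∂(trainingLaw ρ θ N M)

/-- `e` is the limit of the generalization error of stage `t` as `N → ∞` and `M / N → α`, the
hyperparameters being fixed. -/
def HasAsymptoticError (ρ θ Δ α : ℝ) (lam beta : ℕ → ℝ) (t : ℕ) (e : ℝ) : Prop :=
  ∀ N M : ℕ → ℕ, Tendsto N atTop atTop →
    Tendsto (fun k => (M k : ℝ) / (N k : ℝ)) atTop (𝓝 α) →
    Tendsto (fun k => genError ρ θ Δ lam beta t (N k) (M k)) atTop (𝓝 e)

/-- The Gaussian tail function. -/
def gaussTail (x : ℝ) : ℝ := 1 - ∫ t in Set.Iic x, Real.exp (-t ^ 2 / 2) / √(2 * Real.pi)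

/-- The closed form of the stage-`0` error at infinite regularization. -/
def errorZero (α Δ θ : ℝ) : ℝ :=
  gaussTail (√α * (1 - 2 * θ) / √(Δ * (Δ + α * (1 - 2 * θ) ^ 2)))

/-- The closed form of the stage-`1` error at infinite regularization. -/
def errorOne (α Δ θ : ℝ) : ℝ :=
  gaussTail (α * (Δ + α + Δ * α) * (1 - 2 * θ) /
    √(Δ * ((α ^ 2 + 3 * α + 1) * Δ ^ 3 * α +
      α ^ 2 * (Δ ^ 2 * (α ^ 2 + 5 * α + 3) + Δ * (2 * α + 3) * α + α ^ 2) * (1 - 2 * θ) ^ 2)))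

end SelfDistillation

end

open Matrix

namespace SelfDistillation

section ProbFilter

variable {ι : Type*} {Ω : ι → Type*} [∀ i, MeasurableSpace (Ω i)]

/-- The filter of the sets whose complement has probability tending to zero: convergence along it
is convergence in probability of random variables on varying probability spaces. -/
def probFilter (l : Filter ι) (μ : ∀ i, Measure (Ω i)) : Filter (Σ i, Ω i) where
  sets := {s | Tendsto (fun i => μ i {ω | (⟨i, ω⟩ : Σ i, Ω i) ∉ s}) l (𝓝 0)}
  univ_sets := by simpa using tendsto_const_nhds
  sets_of_superset := by
    intro s t hs hst
    refine tendsto_of_tendsto_of_tendsto_of_le_of_le tendsto_const_nhds hs (fun _ => zero_le) ?_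
    intro i
    exact measure_mono fun ω hω h => hω (hst h)
  inter_sets := by
    intro s t hs ht
    have h := Tendsto.add hs ht
    rw [add_zero] at h
    refine tendsto_of_tendsto_of_tendsto_of_le_of_le tendsto_const_nhds h (fun _ => zero_le) ?_
    intro i
    refine (measure_mono ?_).trans (measure_union_le _ _)
    intro ω hω
    by_contra hcon
    simp only [Set.mem_union, Set.mem_ofPred_eq, not_or, not_not] at hcon
    exact hω ⟨hcon.1, hcon.2⟩

variable {l : Filter ι} {μ : ∀ i, Measure (Ω i)}

lemma mem_probFilter {s : Set (Σ i, Ω i)} :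
    s ∈ probFilter l μ ↔ Tendsto (fun i => μ i {ω | (⟨i, ω⟩ : Σ i, Ω i) ∉ s}) l (𝓝 0) := Iff.rfl

instance probFilter_neBot [l.NeBot] [∀ i, IsProbabilityMeasure (μ i)] :
    (probFilter l μ).NeBot := by
  rw [neBot_iff, Ne, ← empty_mem_iff_bot, mem_probFilter]
  intro h
  simp only [Set.mem_empty_iff_false, not_false_eq_true, Set.ofPred_true, measure_univ] at h
  exact one_ne_zero (tendsto_nhds_unique tendsto_const_nhds h)

lemma tendsto_fst_probFilter : Tendsto Sigma.fst (probFilter l μ) l := by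
  intro s hs
  rw [mem_map, mem_probFilter]
  refine Tendsto.congr' ?_ tendsto_const_nhds
  filter_upwards [hs] with i hi
  simp [hi]

lemma tendsto_probFilter_of_lintegral {X : ∀ i, Ω i → ℝ} (hX : ∀ i, Measurable (X i))
    {c : ι → ℝ} (hc : Tendsto c l (𝓝 0))
    (h : ∀ᶠ i in l, ∫⁻ ω, ENNReal.ofReal |X i ω| ∂μ i ≤ ENNReal.ofReal (c i)) :
    Tendsto (fun p : Σ i, Ω i => X p.1 p.2) (probFilter l μ) (𝓝 0) := by
  rw [Metric.tendsto_nhds]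
  intro ε hε
  have key : Tendsto (fun i => ENNReal.ofReal (c i) / ENNReal.ofReal ε) l (𝓝 0) := by
    have h1 := (ENNReal.continuous_ofReal.tendsto 0).comp hc
    rw [ENNReal.ofReal_zero] at h1
    simpa using ENNReal.Tendsto.div_const h1 (b := ENNReal.ofReal ε) (Or.inr (by simpa using hε))
  refine tendsto_of_tendsto_of_tendsto_of_le_of_le' tendsto_const_nhds key
    (Eventually.of_forall fun _ => zero_le) ?_
  filter_upwards [h] with i hi
  have hm : AEMeasurable (fun ω => ENNReal.ofReal |X i ω|) (μ i) :=
    (ENNReal.measurable_ofReal.comp (hX i).norm).aemeasurable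
  refine le_trans ?_ ((meas_ge_le_lintegral_div hm (ε := ENNReal.ofReal ε) (by simpa using hε)
    ENNReal.ofReal_ne_top).trans (ENNReal.div_le_div_right hi _))
  refine measure_mono ?_
  intro ω hω
  simp only [Set.mem_ofPred_eq, dist_zero_right, Real.norm_eq_abs, not_lt] at hω ⊢
  exact ENNReal.ofReal_le_ofReal hω

lemma tendsto_integral_of_probFilter [∀ i, IsProbabilityMeasure (μ i)] {X : ∀ i, Ω i → ℝ}
    {C x : ℝ} (hX : ∀ᶠ i in l, AEStronglyMeasurable (X i) (μ i)) (hC : ∀ i ω, |X i ω| ≤ C)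
    (h : Tendsto (fun p : Σ i, Ω i => X p.1 p.2) (probFilter l μ) (𝓝 x)) :
    Tendsto (fun i => ∫ ω, X i ω ∂μ i) l (𝓝 x) := by
  rw [Metric.tendsto_nhds] at h ⊢
  intro ε hε
  have hset := mem_probFilter.1 (h (ε / 2) (half_pos hε))
  set B : ℝ := |C| + |x| + 1 with hB
  have hBpos : 0 < B := by positivity
  have hsmall := hset.eventually (gt_mem_nhds (a := ENNReal.ofReal (ε / (2 * B)))
    (ENNReal.ofReal_pos.2 (by positivity)))
  filter_upwards [hsmall, hX] with i hi hXi
  set s : Set (Ω i) := {ω | ¬ dist (X i ω) x < ε / 2} with hs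
  have hi' : μ i s < ENNReal.ofReal (ε / (2 * B)) := hi
  set t := toMeasurable (μ i) s with ht
  have htm : MeasurableSet t := measurableSet_toMeasurable _ _
  have hμt : (μ i).real t < ε / (2 * B) := by
    rw [measureReal_def, ht, measure_toMeasurable]
    exact (ENNReal.lt_ofReal_iff_toReal_lt (measure_ne_top _ _)).1 hi'
  have h_int : Integrable (X i) (μ i) :=
    Integrable.of_bound hXi C (Eventually.of_forall fun ω => by simpa using hC i ω)
  have hpt : ∀ ω, |X i ω - x| ≤ ε / 2 + t.indicator (fun _ => B) ω := by
    intro ω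
    by_cases hω : ω ∈ t
    · rw [Set.indicator_of_mem hω]
      have h1 := abs_sub (X i ω) x
      have h2 := (hC i ω).trans (le_abs_self C)
      linarith
    · rw [Set.indicator_of_notMem hω]
      have : ω ∉ s := fun h => hω (subset_toMeasurable _ _ h)
      simp only [hs, Set.mem_ofPred_eq, not_not, Real.dist_eq] at this
      linarith
  rw [Real.dist_eq]
  have h1 : ∫ ω, X i ω ∂μ i - x = ∫ ω, (X i ω - x) ∂μ i := by
    rw [integral_sub h_int (integrable_const _)]; simp
  have hind : Integrable (t.indicator fun _ => B) (μ i) := (integrable_const B).indicator htm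
  calc |∫ ω, X i ω ∂μ i - x| = |∫ ω, (X i ω - x) ∂μ i| := by rw [h1]
    _ ≤ ∫ ω, |X i ω - x| ∂μ i := abs_integral_le_integral_abs
    _ ≤ ∫ ω, (ε / 2 + t.indicator (fun _ => B) ω) ∂μ i :=
        integral_mono (h_int.sub (integrable_const _)).abs ((integrable_const _).add hind) hpt
    _ = ε / 2 + (μ i).real t * B := by
        rw [integral_add (integrable_const _) hind, integral_indicator htm]
        simp
    _ < ε / 2 + ε / (2 * B) * B := by gcongr
    _ = ε := by field_simp; norm_num

end ProbFilter

section LinearAlgebra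

variable {m : Type*} [Fintype m] [DecidableEq m]

lemma dotProduct_mulVec_orthogonal {U : Matrix m m ℝ} (hU : Uᵀ * U = 1) (x y : m → ℝ) :
    (U *ᵥ x) ⬝ᵥ (U *ᵥ y) = x ⬝ᵥ y := by
  rw [dotProduct_mulVec, ← mulVec_transpose, mulVec_mulVec, hU, one_mulVec]

/-- A reflection takes a vector to any other vector of the same length. -/
lemma exists_orthogonal_mulVec_eq {u v : m → ℝ} (h : u ⬝ᵥ u = v ⬝ᵥ v) :
    ∃ O : Matrix m m ℝ, O * Oᵀ = 1 ∧ O *ᵥ u = v := by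
  by_cases huv : u = v
  · exact ⟨1, by simp, by simp [huv]⟩
  set d := u - v with hd
  have hd0 : d ⬝ᵥ d ≠ 0 := by
    rw [Ne, dotProduct_self_eq_zero, hd, sub_eq_zero]
    exact huv
  have hdu : d ⬝ᵥ d = 2 * (d ⬝ᵥ u) := by
    simp only [hd, sub_dotProduct, dotProduct_sub]
    rw [h, dotProduct_comm v u]; ring
  refine ⟨1 - (2 / (d ⬝ᵥ d)) • vecMulVec d d, ?_, ?_⟩
  · rw [transpose_sub, transpose_one, transpose_smul, transpose_vecMulVec, sub_mul, mul_sub,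
      mul_sub, one_mul, one_mul, mul_one, smul_mul_smul_comm, vecMulVec_mul_vecMulVec,
      vecMulVec_smul, smul_smul]
    have : 2 / (d ⬝ᵥ d) * (2 / (d ⬝ᵥ d)) * (d ⬝ᵥ d) = 2 / (d ⬝ᵥ d) + 2 / (d ⬝ᵥ d) := by
      field_simp; norm_num
    rw [this, add_smul]
    abel
  · rw [sub_mulVec, one_mulVec, smul_mulVec, vecMulVec_mulVec, op_smul_eq_smul,
      smul_smul]
    have : 2 / (d ⬝ᵥ d) * (d ⬝ᵥ u) = 1 := by
      rw [div_mul_eq_mul_div, ← hdu, div_self hd0]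
    rw [this, one_smul, hd]; simp

lemma exists_spectral_decomposition {K : Matrix m m ℝ} (hK : K.PosSemidef) :
    ∃ (U : Matrix m m ℝ) (lam : m → ℝ), U * Uᵀ = 1 ∧ Uᵀ * U = 1 ∧ (∀ i, 0 ≤ lam i) ∧
      K = U * diagonal lam * Uᵀ := by
  refine ⟨hK.1.eigenvectorUnitary, hK.1.eigenvalues, ?_, ?_, hK.eigenvalues_nonneg, ?_⟩
  · exact Unitary.coe_mul_star_self hK.1.eigenvectorUnitary
  · exact Unitary.coe_star_mul_self hK.1.eigenvectorUnitary
  · have := hK.1.spectral_theorem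
    rw [Unitary.conjStarAlgAut_apply] at this
    exact this

open Classical in
/-- The functional calculus of a positive semidefinite matrix. -/
noncomputable def matFun (φ : ℝ → ℝ) (K : Matrix m m ℝ) : Matrix m m ℝ :=
  if hK : K.PosSemidef then
    (exists_spectral_decomposition hK).choose *
      diagonal (φ ∘ (exists_spectral_decomposition hK).choose_spec.choose) *
      ((exists_spectral_decomposition hK).choose)ᵀ
  else 0

lemma exists_matFun_eq {K : Matrix m m ℝ} (hK : K.PosSemidef) :
    ∃ (U : Matrix m m ℝ) (lam : m → ℝ), U * Uᵀ = 1 ∧ Uᵀ * U = 1 ∧ (∀ i, 0 ≤ lam i) ∧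
      K = U * diagonal lam * Uᵀ ∧ ∀ φ, matFun φ K = U * diagonal (φ ∘ lam) * Uᵀ := by
  obtain ⟨h1, h2, h3, h4⟩ := (exists_spectral_decomposition hK).choose_spec.choose_spec
  exact ⟨_, _, h1, h2, h3, h4, fun φ => by rw [matFun, dif_pos hK]⟩

lemma matFun_add (φ ψ : ℝ → ℝ) (K : Matrix m m ℝ) :
    matFun (fun x => φ x + ψ x) K = matFun φ K + matFun ψ K := by
  by_cases hK : K.PosSemidef
  · obtain ⟨U, lam, -, -, -, -, h⟩ := exists_matFun_eq hK
    rw [h, h, h, ← add_mul, ← mul_add, diagonal_add]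
    rfl
  · simp [matFun, hK]

lemma matFun_const_mul (c : ℝ) (φ : ℝ → ℝ) (K : Matrix m m ℝ) :
    matFun (fun x => c * φ x) K = c • matFun φ K := by
  by_cases hK : K.PosSemidef
  · obtain ⟨U, lam, -, -, -, -, h⟩ := exists_matFun_eq hK
    rw [h, h, ← smul_mul_assoc, ← mul_smul_comm, ← diagonal_smul]
    rfl
  · simp [matFun, hK]

lemma matFun_mul (φ ψ : ℝ → ℝ) {K : Matrix m m ℝ} (hK : K.PosSemidef) :
    matFun (fun x => φ x * ψ x) K = matFun φ K * matFun ψ K := by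
  obtain ⟨U, lam, -, h2, -, -, h⟩ := exists_matFun_eq hK
  rw [h, h, h]
  calc U * diagonal ((fun x => φ x * ψ x) ∘ lam) * Uᵀ
      = U * (diagonal (φ ∘ lam) * diagonal (ψ ∘ lam)) * Uᵀ := by
        rw [diagonal_mul_diagonal]; rfl
    _ = U * diagonal (φ ∘ lam) * (Uᵀ * U) * diagonal (ψ ∘ lam) * Uᵀ := by
        rw [h2]; simp [mul_assoc]
    _ = _ := by simp [mul_assoc]

lemma matFun_id {K : Matrix m m ℝ} (hK : K.PosSemidef) : matFun (fun x => x) K = K := by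
  obtain ⟨U, lam, -, -, -, hU, h⟩ := exists_matFun_eq hK
  rw [h]; exact hU.symm

lemma matFun_one {K : Matrix m m ℝ} (hK : K.PosSemidef) : matFun (fun _ => 1) K = 1 := by
  obtain ⟨U, lam, h1, -, -, -, h⟩ := exists_matFun_eq hK
  have : ((fun _ => 1) ∘ lam : m → ℝ) = fun _ => 1 := rfl
  rw [h, this, diagonal_one, mul_one, h1]

/-- The resolvent of `K` at `-z`. -/
noncomputable def resolvent (K : Matrix m m ℝ) (z : ℝ) : Matrix m m ℝ := (K + z • 1)⁻¹

/-- The function that defines the resolvent. -/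
noncomputable def cauchyKernel (z x : ℝ) : ℝ := (x + z)⁻¹

omit [Fintype m] in
lemma posDef_add_smul_one {K : Matrix m m ℝ} (hK : K.PosSemidef) {z : ℝ} (hz : 0 < z) :
    (K + z • (1 : Matrix m m ℝ)).PosDef :=
  PosDef.posSemidef_add hK (PosDef.one.smul hz)

lemma isUnit_det_add_smul_one {K : Matrix m m ℝ} (hK : K.PosSemidef) {z : ℝ} (hz : 0 < z) :
    IsUnit (K + z • (1 : Matrix m m ℝ)).det :=
  (isUnit_iff_isUnit_det _).1 (posDef_add_smul_one hK hz).isUnit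

lemma matFun_cauchyKernel {K : Matrix m m ℝ} (hK : K.PosSemidef) {z : ℝ} (hz : 0 < z) :
    matFun (cauchyKernel z) K = resolvent K z := by
  obtain ⟨U, lam, h1, h2, h3, h4, h⟩ := exists_matFun_eq hK
  symm
  apply inv_eq_left_inv
  have hK' : K + z • (1 : Matrix m m ℝ) = U * diagonal (fun i => lam i + z) * Uᵀ := by
    have : diagonal (fun i => lam i + z) = diagonal lam + z • (1 : Matrix m m ℝ) := by
      rw [smul_one_eq_diagonal, diagonal_add]
    rw [this, mul_add, add_mul, ← h4, mul_smul_comm, smul_mul_assoc, mul_one, h1]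
  rw [hK', h]
  calc U * diagonal (cauchyKernel z ∘ lam) * Uᵀ * (U * diagonal (fun i => lam i + z) * Uᵀ)
      = U * diagonal (cauchyKernel z ∘ lam) * (Uᵀ * U) * diagonal (fun i => lam i + z) * Uᵀ := by
        simp [mul_assoc]
    _ = U * (diagonal (cauchyKernel z ∘ lam) * diagonal (fun i => lam i + z)) * Uᵀ := by
        rw [h2]; simp [mul_assoc]
    _ = 1 := by
        rw [diagonal_mul_diagonal]
        have : (fun i => (cauchyKernel z ∘ lam) i * (lam i + z)) = fun _ => (1 : ℝ) := by
          funext i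
          have := h3 i
          exact inv_mul_cancel₀ (by positivity)
        rw [this, diagonal_one, mul_one, h1]

lemma matFun_transpose (φ : ℝ → ℝ) (K : Matrix m m ℝ) : (matFun φ K)ᵀ = matFun φ K := by
  by_cases hK : K.PosSemidef
  · obtain ⟨U, lam, -, -, -, -, h⟩ := exists_matFun_eq hK
    rw [h, transpose_mul, transpose_mul, transpose_transpose, diagonal_transpose, mul_assoc]
  · simp [matFun, hK]

/-- The form of a conjugated diagonal matrix. -/
lemma dotProduct_conj_diagonal (U : Matrix m m ℝ) (d u v : m → ℝ) :
    u ⬝ᵥ (U * diagonal d * Uᵀ) *ᵥ v = ∑ i, d i * ((Uᵀ *ᵥ u) i * (Uᵀ *ᵥ v) i) := by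
  rw [← mulVec_mulVec, ← mulVec_mulVec, dotProduct_mulVec, ← mulVec_transpose]
  simp only [dotProduct, mulVec_diagonal]
  exact Finset.sum_congr rfl fun i _ => by ring

lemma matFun_form_nonneg {φ : ℝ → ℝ} (hφ : ∀ x, 0 ≤ x → 0 ≤ φ x) (K : Matrix m m ℝ) (u : m → ℝ) :
    0 ≤ u ⬝ᵥ matFun φ K *ᵥ u := by
  by_cases hK : K.PosSemidef
  · obtain ⟨U, lam, -, -, h3, -, h⟩ := exists_matFun_eq hK
    rw [h, dotProduct_conj_diagonal]
    exact Finset.sum_nonneg fun i _ => mul_nonneg (hφ _ (h3 i)) (mul_self_nonneg _)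
  · simp [matFun, hK]

lemma abs_matFun_form_le {φ : ℝ → ℝ} {C : ℝ} (hC : 0 ≤ C) (hφ : ∀ x, 0 ≤ x → |φ x| ≤ C)
    (K : Matrix m m ℝ) (u v : m → ℝ) :
    |u ⬝ᵥ matFun φ K *ᵥ v| ≤ C * ((u ⬝ᵥ u + v ⬝ᵥ v) / 2) := by
  have huv : 0 ≤ u ⬝ᵥ u + v ⬝ᵥ v := add_nonneg
    (Finset.sum_nonneg fun i _ => mul_self_nonneg _) (Finset.sum_nonneg fun i _ => mul_self_nonneg _)
  by_cases hK : K.PosSemidef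
  · obtain ⟨U, lam, h1, -, h3, -, h⟩ := exists_matFun_eq hK
    rw [h, dotProduct_conj_diagonal]
    have hUU : Uᵀᵀ * Uᵀ = 1 := by rw [transpose_transpose, h1]
    rw [← dotProduct_mulVec_orthogonal hUU u u, ← dotProduct_mulVec_orthogonal hUU v v]
    simp only [dotProduct, ← Finset.sum_add_distrib, Finset.sum_div, Finset.mul_sum]
    refine (Finset.abs_sum_le_sum_abs _ _).trans (Finset.sum_le_sum fun i _ => ?_)
    set p := (Uᵀ *ᵥ u) i
    set q := (Uᵀ *ᵥ v) i
    rw [abs_mul]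
    refine mul_le_mul (hφ _ (h3 i)) ?_ (abs_nonneg _) hC
    rw [abs_le]
    constructor <;> nlinarith [sq_nonneg (p + q), sq_nonneg (p - q)]
  · simp only [matFun, hK, dite_false, zero_mulVec, dotProduct_zero, abs_zero]
    positivity

/-- The Sherman–Morrison formula for the quadratic forms of a resolvent. -/
lemma resolvent_add_vecMulVec {K : Matrix m m ℝ} (hK : K.PosSemidef) {z : ℝ} (hz : 0 < z)
    (a : m → ℝ) :
    0 ≤ a ⬝ᵥ resolvent K z *ᵥ a ∧ resolvent (K + vecMulVec a a) z = resolvent K z -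
      (1 + a ⬝ᵥ resolvent K z *ᵥ a)⁻¹ • vecMulVec (resolvent K z *ᵥ a) (resolvent K z *ᵥ a) := by
  have hsym : (resolvent K z)ᵀ = resolvent K z := by
    rw [← matFun_cauchyKernel hK hz, matFun_transpose]
  have hpos : 0 ≤ a ⬝ᵥ resolvent K z *ᵥ a := by
    rw [← matFun_cauchyKernel hK hz]
    exact matFun_form_nonneg (fun x hx => inv_nonneg.2 (by positivity)) K a
  refine ⟨hpos, ?_⟩
  set R := resolvent K z with hR
  have hinv : (K + z • (1 : Matrix m m ℝ)) * R = 1 :=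
    mul_nonsing_inv _ (isUnit_det_add_smul_one hK hz)
  apply inv_eq_right_inv
  set t := a ⬝ᵥ R *ᵥ a with ht
  have e1 : K + vecMulVec a a + z • (1 : Matrix m m ℝ) = (K + z • 1) + vecMulVec a a := by abel
  have e2 : (K + z • (1 : Matrix m m ℝ)) * vecMulVec (R *ᵥ a) (R *ᵥ a) = vecMulVec a (R *ᵥ a) := by
    rw [mul_vecMulVec, mulVec_mulVec, hinv, one_mulVec]
  have e3 : vecMulVec a a * R = vecMulVec a (R *ᵥ a) := by
    rw [vecMulVec_mul, ← mulVec_transpose, hsym]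
  have e4 : vecMulVec a a * vecMulVec (R *ᵥ a) (R *ᵥ a) = t • vecMulVec a (R *ᵥ a) := by
    rw [vecMulVec_mul_vecMulVec, vecMulVec_smul]
  rw [e1, add_mul, mul_sub, mul_sub, hinv, mul_smul_comm, mul_smul_comm, e2, e3, e4, smul_smul]
  have ht1 : (1 + t) ≠ 0 := by positivity
  have : vecMulVec a (R *ᵥ a) = (1 + t)⁻¹ • vecMulVec a (R *ᵥ a)
      + ((1 + t)⁻¹ * t) • vecMulVec a (R *ᵥ a) := by
    rw [← add_smul]
    have : (1 + t)⁻¹ + (1 + t)⁻¹ * t = 1 := by field_simp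
    rw [this, one_smul]
  nth_rewrite 2 [this]
  abel

lemma resolvent_add_vecMulVec_form {K : Matrix m m ℝ} (hK : K.PosSemidef) {z : ℝ} (hz : 0 < z)
    (a u v : m → ℝ) :
    u ⬝ᵥ resolvent (K + vecMulVec a a) z *ᵥ v = u ⬝ᵥ resolvent K z *ᵥ v -
      (u ⬝ᵥ resolvent K z *ᵥ a) * (a ⬝ᵥ resolvent K z *ᵥ v) /
        (1 + a ⬝ᵥ resolvent K z *ᵥ a) := by
  have hsym : (resolvent K z)ᵀ = resolvent K z := by
    rw [← matFun_cauchyKernel hK hz, matFun_transpose]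
  rw [(resolvent_add_vecMulVec hK hz a).2, sub_mulVec, dotProduct_sub, smul_mulVec,
    vecMulVec_mulVec, op_smul_eq_smul, dotProduct_smul, dotProduct_smul]
  have : (resolvent K z *ᵥ a) ⬝ᵥ v = a ⬝ᵥ resolvent K z *ᵥ v := by
    rw [dotProduct_mulVec, ← mulVec_transpose, hsym]
  rw [this, smul_eq_mul, smul_eq_mul]
  ring

end LinearAlgebra

section Gaussian

variable {m : Type*} [Fintype m] [DecidableEq m]

/-- The standard Gaussian measure on `m → ℝ`. -/
noncomputable abbrev gaussVec (m : Type*) [Fintype m] : Measure (m → ℝ) :=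
  Measure.pi fun _ : m => gaussianReal 0 1

lemma measurePreserving_mulVec {O : Matrix m m ℝ} (hO : O * Oᵀ = 1) :
    MeasurePreserving (fun x => O *ᵥ x) (gaussVec m) (gaussVec m) := by
  have hO' : Oᵀ * O = 1 := mul_eq_one_comm.1 hO
  have hmeas : Measurable fun x : m → ℝ => O *ᵥ x :=
    (Continuous.matrix_mulVec continuous_const continuous_id).measurable
  refine ⟨hmeas, ?_⟩
  let L : EuclideanSpace ℝ m →ₗᵢ[ℝ] EuclideanSpace ℝ m :=
    ⟨Matrix.toEuclideanLin O, fun x => by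
      rw [← sq_eq_sq₀ (norm_nonneg _) (norm_nonneg _), EuclideanSpace.real_norm_sq_eq,
        EuclideanSpace.real_norm_sq_eq]
      have := dotProduct_mulVec_orthogonal hO' x.ofLp x.ofLp
      simpa [dotProduct, sq] using this⟩
  let f : EuclideanSpace ℝ m ≃ₗᵢ[ℝ] EuclideanSpace ℝ m := L.toLinearIsometryEquiv rfl
  have h1 := stdGaussian_map f
  rw [← map_pi_eq_stdGaussian] at h1
  have h2 := congrArg (Measure.map (WithLp.ofLp : EuclideanSpace ℝ m → m → ℝ)) h1
  have mof : Measurable (WithLp.ofLp : EuclideanSpace ℝ m → m → ℝ) := by fun_prop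
  have mto : Measurable (WithLp.toLp 2 : (m → ℝ) → EuclideanSpace ℝ m) := by fun_prop
  have mf : Measurable f := f.continuous.measurable
  rw [Measure.map_map mof (mf), Measure.map_map (mof.comp mf) mto,
    Measure.map_map mof mto] at h2
  have e1 : (WithLp.ofLp ∘ f) ∘ WithLp.toLp 2 = fun x : m → ℝ => O *ᵥ x := by
    funext x
    simp [f, L]
  have e2 : (WithLp.ofLp : EuclideanSpace ℝ m → m → ℝ) ∘ WithLp.toLp 2 = id := rfl
  rw [e1, e2, Measure.map_id] at h2
  exact h2

lemma memLp_sq_gaussianReal : MemLp (fun x : ℝ => x ^ 2) 2 (gaussianReal 0 1) := by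
  have h := (memLp_id_gaussianReal' (μ := 0) (v := 1) 4 (by norm_num))
  have h2 := MemLp.norm_rpow_div h 2
  have e : (4 : ENNReal) / 2 = 2 := by
    rw [show (4 : ENNReal) = 2 * 2 by norm_num,
      ENNReal.mul_div_cancel_right (by norm_num) (by norm_num)]
  rw [e] at h2
  refine h2.congr_norm (by fun_prop) (Eventually.of_forall fun x => by simp)

lemma integral_sq_gaussianReal : ∫ x, x ^ 2 ∂gaussianReal 0 1 = 1 := by
  have h := variance_fun_id_gaussianReal (μ := 0) (v := 1)
  rw [variance_of_integral_eq_zero (by fun_prop) (by simp)] at h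
  simpa using h

/-- The variance of the square of a standard Gaussian. -/
noncomputable def varSq : ℝ := Var[fun x : ℝ => x ^ 2; gaussianReal 0 1]

lemma varSq_nonneg : 0 ≤ varSq := variance_nonneg _ _

lemma lintegral_abs_le_of_variance {Ω : Type*} [MeasurableSpace Ω] {μ : Measure Ω}
    [IsProbabilityMeasure μ] {X : Ω → ℝ} (hX : MemLp X 2 μ) {V : ℝ} (hV : Var[X; μ] ≤ V) :
    ∫⁻ ω, ENNReal.ofReal |X ω - ∫ ω', X ω' ∂μ| ∂μ ≤ ENNReal.ofReal √V := by
  set Y : Ω → ℝ := fun ω => X ω - ∫ ω', X ω' ∂μ with hY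
  have hYL : MemLp Y 2 μ := hX.sub (memLp_const _)
  have hYi : Integrable Y μ := hYL.integrable (by norm_num)
  rw [← ofReal_integral_eq_lintegral_ofReal hYi.abs (Eventually.of_forall fun _ => abs_nonneg _)]
  refine ENNReal.ofReal_le_ofReal (Real.le_sqrt_of_sq_le ?_)
  have h1 : Var[X; μ] = ∫ ω, (Y ω) ^ 2 ∂μ := variance_eq_integral hX.aemeasurable
  have h2 : 0 ≤ Var[fun ω => |Y ω|; μ] := variance_nonneg _ _
  have h3 := variance_eq_sub hYL.abs
  have h4 : (∫ ω, |Y ω| ∂μ) ^ 2 ≤ ∫ ω, (Y ω) ^ 2 ∂μ := by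
    have h5 : μ[(fun ω => |Y ω|) ^ 2] = ∫ ω, (Y ω) ^ 2 ∂μ := by simp
    have h6 : Var[fun ω => |Y ω|; μ] = μ[(fun ω => |Y ω|) ^ 2] - (∫ ω, |Y ω| ∂μ) ^ 2 := h3
    rw [h5] at h6
    linarith
  linarith

omit [DecidableEq m] in
/-- Concentration of a weighted sum of squares of independent Gaussians. -/
lemma lintegral_weighted_sq_le {d : m → ℝ} {C : ℝ} (hC : 0 ≤ C) (hd : ∀ i, |d i| ≤ C) :
    ∫⁻ g, ENNReal.ofReal |∑ i, d i * (g i * g i) - ∑ i, d i| ∂gaussVec m ≤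
      ENNReal.ofReal (C * √(Fintype.card m * varSq)) := by
  have hL : ∀ i : m, MemLp (fun x : ℝ => d i * x ^ 2) 2 (gaussianReal 0 1) :=
    fun i => memLp_sq_gaussianReal.const_mul _
  have hLp : ∀ i : m, MemLp (fun g : m → ℝ => d i * (g i) ^ 2) 2 (gaussVec m) :=
    fun i => (hL i).comp_measurePreserving (measurePreserving_eval _ i)
  have hvar := variance_sum_pi hL
  have hsum : MemLp (∑ i, fun g : m → ℝ => d i * (g i) ^ 2) 2 (gaussVec m) :=
    memLp_finsetSum' _ fun i _ => hLp i
  have h_int : ∫ g, (∑ i, fun g : m → ℝ => d i * (g i) ^ 2) g ∂gaussVec m = ∑ i, d i := by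
    simp only [Finset.sum_apply]
    rw [integral_finsetSum _ fun i _ => (hLp i).integrable (by norm_num)]
    refine Finset.sum_congr rfl fun i _ => ?_
    rw [integral_const_mul]
    have h2 : ∫ g : m → ℝ, (g i) ^ 2 ∂gaussVec m = ∫ x, x ^ 2 ∂gaussianReal 0 1 := by
      rw [← (measurePreserving_eval (fun _ : m => gaussianReal 0 1) i).map_eq,
        integral_map (measurable_pi_apply i).aemeasurable (by fun_prop)]
    rw [h2, integral_sq_gaussianReal, mul_one]
  have hV : Var[∑ i, fun g : m → ℝ => d i * (g i) ^ 2; gaussVec m] ≤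
      C ^ 2 * (Fintype.card m * varSq) := by
    rw [hvar]
    calc ∑ i, Var[fun x : ℝ => d i * x ^ 2; gaussianReal 0 1] = ∑ i, (d i) ^ 2 * varSq := by
          refine Finset.sum_congr rfl fun i _ => ?_
          rw [variance_const_mul]; rfl
      _ ≤ ∑ _i : m, C ^ 2 * varSq := by
          refine Finset.sum_le_sum fun i _ => mul_le_mul_of_nonneg_right ?_ varSq_nonneg
          rw [← sq_abs]
          exact pow_le_pow_left₀ (abs_nonneg _) (hd i) 2
      _ = _ := by simp; ring
  have h := lintegral_abs_le_of_variance hsum hV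
  rw [h_int, Real.sqrt_mul (sq_nonneg C), Real.sqrt_sq hC] at h
  refine le_trans (le_of_eq ?_) h
  refine lintegral_congr fun g => ?_
  simp [Finset.sum_apply, sq]

omit [DecidableEq m] in
lemma measurable_form {X : Type*} [MeasurableSpace X] {A : X → Matrix m m ℝ} {u v : X → m → ℝ}
    (hA : ∀ i j, Measurable fun x => A x i j) (hu : ∀ i, Measurable fun x => u x i)
    (hv : ∀ i, Measurable fun x => v x i) : Measurable fun x => u x ⬝ᵥ A x *ᵥ v x := by
  simp only [dotProduct, mulVec]
  fun_prop

/-- Concentration of Gaussian quadratic forms. -/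
lemma lintegral_quadratic_form_le {K : Matrix m m ℝ} (hK : K.PosSemidef) {φ : ℝ → ℝ} {C : ℝ}
    (hC : 0 ≤ C) (hφ : ∀ x, 0 ≤ x → |φ x| ≤ C) :
    ∫⁻ g, ENNReal.ofReal |g ⬝ᵥ matFun φ K *ᵥ g - (matFun φ K).trace| ∂gaussVec m ≤
      ENNReal.ofReal (C * √(Fintype.card m * varSq)) := by
  obtain ⟨U, lam, h1, h2, h3, -, h⟩ := exists_matFun_eq hK
  have htr : (matFun φ K).trace = ∑ i, φ (lam i) := by
    rw [h, trace_mul_comm, ← mul_assoc, h2, one_mul, trace_diagonal]; rfl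
  have hform : ∀ g, g ⬝ᵥ matFun φ K *ᵥ g =
      ∑ i, φ (lam i) * ((Uᵀ *ᵥ g) i * (Uᵀ *ᵥ g) i) := fun g => by
    rw [h, dotProduct_conj_diagonal]; rfl
  have hmp : MeasurePreserving (fun x => Uᵀ *ᵥ x) (gaussVec m) (gaussVec m) :=
    measurePreserving_mulVec (by rw [transpose_transpose, h2])
  simp only [htr, hform]
  have := hmp.lintegral_comp (f := fun g : m → ℝ =>
    ENNReal.ofReal |∑ i, φ (lam i) * (g i * g i) - ∑ i, φ (lam i)|) (by fun_prop)
  rw [this]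
  exact lintegral_weighted_sq_le hC fun i => hφ _ (h3 i)

lemma measurable_inv_apply {X : Type*} [MeasurableSpace X] {A : X → Matrix m m ℝ}
    (hA : ∀ i j, Measurable fun x => A x i j) (i j : m) : Measurable fun x => (A x)⁻¹ i j := by
  have hdet : Measurable fun B : m → m → ℝ => (Matrix.of B).det := by
    refine Continuous.measurable (Continuous.matrix_det ?_)
    exact continuous_id
  have hadj : Measurable fun B : m → m → ℝ => (Matrix.of B).adjugate i j := by
    refine Continuous.measurable (Continuous.matrix_elem (Continuous.matrix_adjugate ?_) i j)
    exact continuous_id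
  have hA' : Measurable fun x => (fun i j => A x i j : m → m → ℝ) :=
    measurable_pi_lambda _ fun i => measurable_pi_lambda _ fun j => hA i j
  have : (fun x => (A x)⁻¹ i j) = fun x => ((A x).det)⁻¹ * (A x).adjugate i j := by
    funext x
    rw [inv_def, Matrix.smul_apply, Ring.inverse_eq_inv', smul_eq_mul]
  rw [this]
  exact (hdet.comp hA').inv.mul (hadj.comp hA')

lemma measurable_resolvent_apply {X : Type*} [MeasurableSpace X] {A : X → Matrix m m ℝ} {z : ℝ}
    (hA : ∀ i j, Measurable fun x => A x i j) (i j : m) :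
    Measurable fun x => resolvent (A x) z i j :=
  measurable_inv_apply (A := fun x => A x + z • 1)
    (fun i j => (hA i j).add measurable_const) i j

end Gaussian

section Wishart

variable {m : Type*} [Fintype m] [DecidableEq m] {J : Type*} [Fintype J] [DecidableEq J]

/-- The sample covariance matrix of the vectors `G j`, `j ∈ s`. -/
noncomputable def wishart (κ : ℝ) (s : Finset J) (G : J → m → ℝ) : Matrix m m ℝ :=
  κ • ∑ j ∈ s, vecMulVec (G j) (G j)

omit [Fintype J] [DecidableEq J] [DecidableEq m] [Fintype m] in
lemma wishart_apply (κ : ℝ) (s : Finset J) (G : J → m → ℝ) (i k : m) :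
    wishart κ s G i k = κ * ∑ j ∈ s, G j i * G j k := by
  simp [wishart, Matrix.sum_apply, vecMulVec_apply]

omit [Fintype J] [DecidableEq J] [DecidableEq m] in
lemma wishart_posSemidef {κ : ℝ} (hκ : 0 ≤ κ) (s : Finset J) (G : J → m → ℝ) :
    (wishart κ s G).PosSemidef := by
  refine PosSemidef.smul (posSemidef_sum _ fun j _ => ?_) hκ
  have := posSemidef_vecMulVec_self_star (G j)
  rwa [star_trivial] at this

omit [Fintype J] [DecidableEq m] [Fintype m] in
lemma wishart_erase {κ : ℝ} (hκ : 0 ≤ κ) {s : Finset J} {j : J} (hj : j ∈ s) (G : J → m → ℝ) :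
    wishart κ s G = wishart κ (s.erase j) G + vecMulVec (√κ • G j) (√κ • G j) := by
  rw [wishart, wishart, ← Finset.sum_erase_add _ _ hj, smul_add, smul_vecMulVec, vecMulVec_smul,
    smul_smul, Real.mul_self_sqrt hκ]

omit [Fintype J] [DecidableEq m] [Fintype m] in
lemma wishart_erase_update (κ : ℝ) (s : Finset J) (j : J) (G : J → m → ℝ) (g : m → ℝ) :
    wishart κ (s.erase j) (Function.update G j g) = wishart κ (s.erase j) G := by
  rw [wishart, wishart]
  congr 1
  refine Finset.sum_congr rfl fun k hk => ?_
  rw [Function.update_of_ne (Finset.ne_of_mem_erase hk)]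

omit [Fintype J] [DecidableEq J] in
lemma measurable_wishart_resolvent (κ z : ℝ) (s : Finset J) (i k : m) :
    Measurable fun G : J → m → ℝ => resolvent (wishart κ s G) z i k := by
  refine measurable_resolvent_apply (fun i k => ?_) i k
  simp only [wishart_apply]
  fun_prop

lemma trace_resolvent_nonneg {K : Matrix m m ℝ} (hK : K.PosSemidef) {z : ℝ} (hz : 0 < z) :
    0 ≤ (resolvent K z).trace := by
  have : (resolvent K z).PosSemidef := (posDef_add_smul_one hK hz).inv.posSemidef
  exact this.trace_nonneg

lemma cauchyKernel_abs_le {z x : ℝ} (hz : 0 < z) (hx : 0 ≤ x) : |cauchyKernel z x| ≤ z⁻¹ := by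
  rw [cauchyKernel, abs_of_nonneg (by positivity)]
  exact inv_anti₀ hz (by linarith)

lemma trace_resolvent_le {K : Matrix m m ℝ} (hK : K.PosSemidef) {z : ℝ} (hz : 0 < z) :
    (resolvent K z).trace ≤ Fintype.card m / z := by
  obtain ⟨U, lam, h1, h2, h3, -, h⟩ := exists_matFun_eq hK
  rw [← matFun_cauchyKernel hK hz, h, trace_mul_comm, ← mul_assoc, h2, one_mul, trace_diagonal]
  calc ∑ i, (cauchyKernel z ∘ lam) i ≤ ∑ _i : m, z⁻¹ :=
        Finset.sum_le_sum fun i _ => (le_abs_self _).trans (cauchyKernel_abs_le hz (h3 i))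
    _ = _ := by simp [div_eq_mul_inv]

/-- A rank-one perturbation changes the trace of the resolvent by at most `1 / z`. -/
lemma abs_trace_resolvent_sub_le {K : Matrix m m ℝ} (hK : K.PosSemidef) {z : ℝ} (hz : 0 < z)
    (a : m → ℝ) :
    |(resolvent K z).trace - (resolvent (K + vecMulVec a a) z).trace| ≤ z⁻¹ := by
  obtain ⟨hpos, h⟩ := resolvent_add_vecMulVec hK hz a
  rw [h, trace_sub, trace_smul, trace_vecMulVec, sub_sub_cancel, smul_eq_mul]
  set t := a ⬝ᵥ resolvent K z *ᵥ a
  have hR := matFun_cauchyKernel hK hz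
  have e : (resolvent K z *ᵥ a) ⬝ᵥ (resolvent K z *ᵥ a) =
      a ⬝ᵥ matFun (fun x => cauchyKernel z x * cauchyKernel z x) K *ᵥ a := by
    rw [matFun_mul _ _ hK, hR, ← mulVec_mulVec, dotProduct_mulVec a, ← mulVec_transpose, ← hR,
      matFun_transpose]
  have hle : a ⬝ᵥ matFun (fun x => cauchyKernel z x * cauchyKernel z x) K *ᵥ a ≤ z⁻¹ * t := by
    have hnn : 0 ≤ a ⬝ᵥ matFun (fun x => z⁻¹ * cauchyKernel z x +
        (-1) * (cauchyKernel z x * cauchyKernel z x)) K *ᵥ a := by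
      refine matFun_form_nonneg (fun x hx => ?_) K a
      have h1 := (le_abs_self _).trans (cauchyKernel_abs_le hz hx)
      have h2 : 0 ≤ cauchyKernel z x := inv_nonneg.2 (by positivity)
      nlinarith
    rw [matFun_add, matFun_const_mul, matFun_const_mul, hR, add_mulVec, dotProduct_add,
      smul_mulVec, smul_mulVec, dotProduct_smul, dotProduct_smul] at hnn
    simp only [smul_eq_mul] at hnn
    linarith
  rw [e]
  have h0 : 0 ≤ a ⬝ᵥ matFun (fun x => cauchyKernel z x * cauchyKernel z x) K *ᵥ a :=
    matFun_form_nonneg (fun x _ => mul_self_nonneg _) K a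
  rw [abs_of_nonneg (by positivity), inv_mul_le_iff₀ (by positivity)]
  have : 0 < z⁻¹ := by positivity
  nlinarith

/-- The Marchenko–Pastur equation holds up to leave-one-out errors. -/
lemma abs_trace_equation_le {κ z : ℝ} (hκ : 0 ≤ κ) (hz : 0 < z) (G : J → m → ℝ) :
    let t := κ * (resolvent (wishart κ Finset.univ G) z).trace
    |κ * Fintype.card m - z * t - κ * Fintype.card J * (t / (1 + t))| ≤
      ∑ j, (κ ^ 2 * |G j ⬝ᵥ resolvent (wishart κ (Finset.univ.erase j) G) z *ᵥ G j -
        (resolvent (wishart κ (Finset.univ.erase j) G) z).trace| + κ ^ 2 * z⁻¹) := by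
  intro t
  set R := resolvent (wishart κ Finset.univ G) z with hR
  have hW := wishart_posSemidef hκ Finset.univ G
  have ht0 : 0 ≤ t := mul_nonneg hκ (trace_resolvent_nonneg hW hz)
  set τ : J → ℝ := fun j => κ * (G j ⬝ᵥ resolvent (wishart κ (Finset.univ.erase j) G) z *ᵥ G j)
    with hτ
  have hform : ∀ j, κ * (G j ⬝ᵥ R *ᵥ G j) = τ j / (1 + τ j) ∧ 0 ≤ τ j := by
    intro j
    have hWj := wishart_posSemidef hκ (Finset.univ.erase j) G
    have h := resolvent_add_vecMulVec_form hWj hz (√κ • G j) (√κ • G j) (√κ • G j)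
    have h0 := (resolvent_add_vecMulVec hWj hz (√κ • G j)).1
    rw [← wishart_erase hκ (Finset.mem_univ j), ← hR] at h
    simp only [mulVec_smul, dotProduct_smul, smul_dotProduct, smul_eq_mul, ← mul_assoc,
      Real.mul_self_sqrt hκ] at h h0
    change 0 ≤ τ j at h0
    refine ⟨?_, h0⟩
    rw [h]
    have h1 : 1 + τ j ≠ 0 := by positivity
    simp only [hτ] at h1 ⊢
    field_simp
    ring
  have hsum : κ * Fintype.card m - z * t = κ * ∑ j, τ j / (1 + τ j) := by
    have hinv : (wishart κ Finset.univ G + z • (1 : Matrix m m ℝ)) * R = 1 :=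
      mul_nonsing_inv _ (isUnit_det_add_smul_one hW hz)
    have htr := congrArg Matrix.trace hinv
    rw [add_mul, trace_add, trace_one, smul_mul_assoc, one_mul, trace_smul, wishart,
      smul_mul_assoc, trace_smul, Finset.sum_mul, trace_sum] at htr
    have : ∀ j, (vecMulVec (G j) (G j) * R).trace = G j ⬝ᵥ R *ᵥ G j := by
      intro j
      rw [vecMulVec_mul, trace_vecMulVec, dotProduct_mulVec, dotProduct_comm]
    simp only [this, smul_eq_mul] at htr
    have h2 : ∑ j, τ j / (1 + τ j) = κ * ∑ j, G j ⬝ᵥ R *ᵥ G j := by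
      rw [Finset.mul_sum]
      exact Finset.sum_congr rfl fun j _ => (hform j).1.symm
    rw [h2, ← htr]
    simp only [t]
    ring
  have hrew : κ * Fintype.card m - z * t - κ * Fintype.card J * (t / (1 + t)) =
      ∑ j, κ * (τ j / (1 + τ j) - t / (1 + t)) := by
    rw [hsum, ← Finset.mul_sum, Finset.sum_sub_distrib]
    simp
    ring
  rw [hrew]
  refine (Finset.abs_sum_le_sum_abs _ _).trans (Finset.sum_le_sum fun j _ => ?_)
  have hτ0 := (hform j).2
  have hlip : |τ j / (1 + τ j) - t / (1 + t)| ≤ |τ j - t| := by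
    have : τ j / (1 + τ j) - t / (1 + t) = (τ j - t) / ((1 + τ j) * (1 + t)) := by
      field_simp; ring
    rw [this, abs_div, abs_of_pos (by positivity : 0 < (1 + τ j) * (1 + t))]
    exact div_le_self (abs_nonneg _) (by nlinarith [mul_nonneg hτ0 ht0])
  rw [abs_mul, abs_of_nonneg hκ]
  have htr := abs_trace_resolvent_sub_le (wishart_posSemidef hκ (Finset.univ.erase j) G) hz
    (√κ • G j)
  rw [← wishart_erase hκ (Finset.mem_univ j), ← hR] at htr
  set T := (resolvent (wishart κ (Finset.univ.erase j) G) z).trace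
  have hsplit : τ j - t = κ * (G j ⬝ᵥ resolvent (wishart κ (Finset.univ.erase j) G) z *ᵥ G j - T)
      + κ * (T - R.trace) := by
    simp only [hτ, t]; ring
  have h3 : |τ j - t| ≤ κ * |G j ⬝ᵥ resolvent (wishart κ (Finset.univ.erase j) G) z *ᵥ G j - T|
      + κ * z⁻¹ := by
    rw [hsplit]
    refine (abs_add_le _ _).trans ?_
    rw [abs_mul, abs_mul, abs_of_nonneg hκ]
    gcongr
  calc κ * |τ j / (1 + τ j) - t / (1 + t)| ≤ κ * (κ * |G j ⬝ᵥ
        resolvent (wishart κ (Finset.univ.erase j) G) z *ᵥ G j - T| + κ * z⁻¹) := by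
        gcongr; exact hlip.trans h3
    _ = _ := by ring

lemma lintegral_pi_le_of_update {X : J → Type*} [∀ j, MeasurableSpace (X j)]
    {μ : ∀ j, Measure (X j)} [∀ j, IsProbabilityMeasure (μ j)] {f : (∀ j, X j) → ENNReal}
    (hf : Measurable f) (j : J) {C : ENNReal}
    (h : ∀ x, ∫⁻ y, f (Function.update x j y) ∂μ j ≤ C) :
    ∫⁻ x, f x ∂Measure.pi μ ≤ C := by
  rcases isEmpty_or_nonempty (∀ j, X j) with he | ⟨⟨x⟩⟩
  · simp [lintegral_of_isEmpty]
  rw [lintegral_eq_lmarginal_univ x, lmarginal_erase' _ hf (Finset.mem_univ j)]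
  refine (lmarginal_mono (g := fun _ => C) (fun x => h x) x).trans ?_
  simp [lmarginal]

/-- Columns of the noise matrix: independent standard Gaussian vectors. -/
noncomputable abbrev gaussMat (J m : Type*) [Fintype J] [Fintype m] : Measure (J → m → ℝ) :=
  Measure.pi fun _ : J => gaussVec m

lemma lintegral_trace_equation_le {κ z : ℝ} (hκ : 0 ≤ κ) (hz : 0 < z) :
    ∫⁻ G : J → m → ℝ, ENNReal.ofReal |κ * Fintype.card m -
        z * (κ * (resolvent (wishart κ Finset.univ G) z).trace) - κ * Fintype.card J *
        (κ * (resolvent (wishart κ Finset.univ G) z).trace /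
        (1 + κ * (resolvent (wishart κ Finset.univ G) z).trace))| ∂gaussMat J m ≤
      ENNReal.ofReal (Fintype.card J * (κ ^ 2 * (z⁻¹ * √(Fintype.card m * varSq)) +
        κ ^ 2 * z⁻¹)) := by
  set Y : J → (J → m → ℝ) → ℝ := fun j G =>
    |G j ⬝ᵥ resolvent (wishart κ (Finset.univ.erase j) G) z *ᵥ G j -
        (resolvent (wishart κ (Finset.univ.erase j) G) z).trace| with hY
  have hYm : ∀ j, Measurable (Y j) := by
    intro j
    have h1 : Measurable fun G : J → m → ℝ =>
        G j ⬝ᵥ resolvent (wishart κ (Finset.univ.erase j) G) z *ᵥ G j :=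
      measurable_form (fun i k => measurable_wishart_resolvent κ z _ i k) (fun i => by fun_prop)
        (fun i => by fun_prop)
    have h2 : Measurable fun G : J → m → ℝ =>
        (resolvent (wishart κ (Finset.univ.erase j) G) z).trace :=
      Finset.measurable_sum _ fun i _ => measurable_wishart_resolvent κ z _ i i
    exact (h1.sub h2).norm
  have hYm' : ∀ j, Measurable fun G => ENNReal.ofReal (Y j G) :=
    fun j => ENNReal.measurable_ofReal.comp (hYm j)
  have hYb : ∀ j, ∫⁻ G, ENNReal.ofReal (Y j G) ∂gaussMat J m ≤
      ENNReal.ofReal (z⁻¹ * √(Fintype.card m * varSq)) := by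
    intro j
    refine lintegral_pi_le_of_update (hYm' j) j fun G => ?_
    simp only [hY, Function.update_self, wishart_erase_update]
    rw [← matFun_cauchyKernel (wishart_posSemidef hκ _ _) hz]
    exact lintegral_quadratic_form_le (wishart_posSemidef hκ _ _) (by positivity)
      fun x hx => cauchyKernel_abs_le hz hx
  calc _ ≤ ∫⁻ G, ∑ j, (ENNReal.ofReal (κ ^ 2) * ENNReal.ofReal (Y j G) +
        ENNReal.ofReal (κ ^ 2 * z⁻¹)) ∂gaussMat J m := by
        refine lintegral_mono fun G => ?_
        refine (ENNReal.ofReal_le_ofReal (abs_trace_equation_le hκ hz G)).trans (le_of_eq ?_)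
        rw [ENNReal.ofReal_sum_of_nonneg fun j _ => by positivity]
        refine Finset.sum_congr rfl fun j _ => ?_
        rw [ENNReal.ofReal_add (by positivity) (by positivity), ENNReal.ofReal_mul (by positivity)]
    _ = ∑ j, (ENNReal.ofReal (κ ^ 2) * ∫⁻ G, ENNReal.ofReal (Y j G) ∂gaussMat J m +
        ENNReal.ofReal (κ ^ 2 * z⁻¹)) := by
        rw [lintegral_finsetSum _ fun j _ => ((hYm' j).const_mul _).add_const _]
        refine Finset.sum_congr rfl fun j _ => ?_
        rw [lintegral_add_right _ measurable_const, lintegral_const_mul _ (hYm' j)]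
        simp
    _ ≤ ∑ _j : J, (ENNReal.ofReal (κ ^ 2) * ENNReal.ofReal (z⁻¹ * √(Fintype.card m * varSq)) +
        ENNReal.ofReal (κ ^ 2 * z⁻¹)) := by
        gcongr with j
        exact hYb j
    _ = _ := by
        rw [← ENNReal.ofReal_mul (by positivity), ← ENNReal.ofReal_add (by positivity)
          (by positivity), Finset.sum_const, nsmul_eq_mul, Finset.card_univ,
          ENNReal.ofReal_mul (by positivity), ENNReal.ofReal_natCast]

end Wishart

section Isotropy

variable {m : Type*} [Fintype m] [DecidableEq m] {J : Type*} [Fintype J]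

omit [Fintype J] [DecidableEq m] in
lemma wishart_rotate (κ : ℝ) (s : Finset J) (O : Matrix m m ℝ) (G : J → m → ℝ) :
    wishart κ s (fun j => O *ᵥ G j) = O * wishart κ s G * Oᵀ := by
  rw [wishart, wishart, mul_smul_comm, smul_mul_assoc, Finset.mul_sum, Finset.sum_mul]
  congr 1
  refine Finset.sum_congr rfl fun j _ => ?_
  rw [mul_vecMulVec, vecMulVec_mul, vecMul_transpose]

lemma resolvent_rotate {O : Matrix m m ℝ} (hO : O * Oᵀ = 1) (K : Matrix m m ℝ) (z : ℝ) :
    resolvent (O * K * Oᵀ) z = O * resolvent K z * Oᵀ := by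
  have hO' : Oᵀ * O = 1 := mul_eq_one_comm.1 hO
  have e : O * K * Oᵀ + z • (1 : Matrix m m ℝ) = O * (K + z • 1) * Oᵀ := by
    rw [mul_add, add_mul, mul_smul_comm, smul_mul_assoc, mul_one, hO]
  rw [resolvent, resolvent, e, Matrix.mul_inv_rev, Matrix.mul_inv_rev, inv_eq_right_inv hO,
    inv_eq_right_inv hO', mul_assoc]

/-- The mean deviation of a quadratic form of the Wishart resolvent from its isotropic value. -/
noncomputable def isotropyDefect (J : Type*) [Fintype J] (κ z : ℝ) (u : m → ℝ) : ENNReal :=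
  ∫⁻ G : J → m → ℝ, ENNReal.ofReal |u ⬝ᵥ resolvent (wishart κ Finset.univ G) z *ᵥ u -
    (u ⬝ᵥ u) * ((resolvent (wishart κ Finset.univ G) z).trace / Fintype.card m)| ∂gaussMat J m

lemma measurable_isotropy_integrand (κ z : ℝ) : Measurable fun p : (m → ℝ) × (J → m → ℝ) =>
    ENNReal.ofReal |p.1 ⬝ᵥ resolvent (wishart κ Finset.univ p.2) z *ᵥ p.1 -
    (p.1 ⬝ᵥ p.1) * ((resolvent (wishart κ Finset.univ p.2) z).trace / Fintype.card m)| := by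
  have hR : ∀ i k, Measurable fun p : (m → ℝ) × (J → m → ℝ) =>
      resolvent (wishart κ Finset.univ p.2) z i k :=
    fun i k => (measurable_wishart_resolvent κ z _ i k).comp measurable_snd
  have h1 : Measurable fun p : (m → ℝ) × (J → m → ℝ) =>
      p.1 ⬝ᵥ resolvent (wishart κ Finset.univ p.2) z *ᵥ p.1 :=
    measurable_form hR (fun i => by fun_prop) (fun i => by fun_prop)
  have h2 : Measurable fun p : (m → ℝ) × (J → m → ℝ) =>
      (resolvent (wishart κ Finset.univ p.2) z).trace :=
    Finset.measurable_sum _ fun i _ => hR i i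
  have h3 : Measurable fun p : (m → ℝ) × (J → m → ℝ) => p.1 ⬝ᵥ p.1 := by
    simp only [dotProduct]; fun_prop
  exact ENNReal.measurable_ofReal.comp (h1.sub (h3.mul (h2.div_const _))).norm

lemma measurable_isotropy_integrand_right (κ z : ℝ) (u : m → ℝ) : Measurable fun G : J → m → ℝ =>
    ENNReal.ofReal |u ⬝ᵥ resolvent (wishart κ Finset.univ G) z *ᵥ u -
    (u ⬝ᵥ u) * ((resolvent (wishart κ Finset.univ G) z).trace / Fintype.card m)| := by
  have h := (measurable_isotropy_integrand (m := m) (J := J) κ z).comp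
    (measurable_prodMk_left (x := u))
  exact h

lemma isotropyDefect_rotate (κ z : ℝ) {O : Matrix m m ℝ} (hO : O * Oᵀ = 1) (u : m → ℝ) :
    isotropyDefect J κ z (O *ᵥ u) = isotropyDefect J κ z u := by
  have hO' : Oᵀ * O = 1 := mul_eq_one_comm.1 hO
  have hmp : MeasurePreserving (fun (G : J → m → ℝ) j => O *ᵥ G j) (gaussMat J m) (gaussMat J m) :=
    measurePreserving_pi _ _ fun _ => measurePreserving_mulVec hO
  rw [isotropyDefect, ← hmp.lintegral_comp
    (measurable_isotropy_integrand_right κ z _),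
    isotropyDefect]
  refine lintegral_congr fun G => ?_
  rw [wishart_rotate, resolvent_rotate hO, dotProduct_mulVec_orthogonal hO', trace_mul_comm,
    ← mul_assoc, hO', one_mul, mulVec_mulVec, mul_assoc, hO', mul_one, ← mulVec_mulVec,
    dotProduct_mulVec_orthogonal hO']

lemma isotropyDefect_smul (κ z c : ℝ) (u : m → ℝ) :
    isotropyDefect J κ z (c • u) = ENNReal.ofReal (c ^ 2) * isotropyDefect J κ z u := by
  rw [isotropyDefect, isotropyDefect, ← lintegral_const_mul _
    (measurable_isotropy_integrand_right κ z u)]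
  refine lintegral_congr fun G => ?_
  rw [← ENNReal.ofReal_mul (sq_nonneg c), ← abs_of_nonneg (sq_nonneg c), ← abs_mul]
  simp only [mulVec_smul, dotProduct_smul, smul_dotProduct, smul_eq_mul]
  ring_nf

omit [DecidableEq m] in
lemma dotProduct_self_nonneg_real (u : m → ℝ) : 0 ≤ u ⬝ᵥ u :=
  Finset.sum_nonneg fun _ _ => mul_self_nonneg _

lemma isotropyDefect_mul_comm (κ z : ℝ) (u v : m → ℝ) :
    ENNReal.ofReal (u ⬝ᵥ u) * isotropyDefect J κ z v =
      ENNReal.ofReal (v ⬝ᵥ v) * isotropyDefect J κ z u := by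
  have hu := dotProduct_self_nonneg_real u
  have hv := dotProduct_self_nonneg_real v
  rw [← Real.sq_sqrt hu, ← isotropyDefect_smul, ← Real.sq_sqrt hv, ← isotropyDefect_smul]
  have h : (√(u ⬝ᵥ u) • v) ⬝ᵥ (√(u ⬝ᵥ u) • v) = (√(v ⬝ᵥ v) • u) ⬝ᵥ (√(v ⬝ᵥ v) • u) := by
    simp only [smul_dotProduct, dotProduct_smul, smul_eq_mul, ← mul_assoc, Real.mul_self_sqrt hu,
      Real.mul_self_sqrt hv]
    ring
  obtain ⟨O, hO, hOe⟩ := exists_orthogonal_mulVec_eq h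
  rw [← hOe, isotropyDefect_rotate κ z hO]

omit [DecidableEq m] in
lemma lintegral_dotProduct_self :
    ∫⁻ g : m → ℝ, ENNReal.ofReal (g ⬝ᵥ g) ∂gaussVec m = Fintype.card m := by
  have h1 : ∀ g : m → ℝ, ENNReal.ofReal (g ⬝ᵥ g) = ∑ i, ENNReal.ofReal (g i ^ 2) := by
    intro g
    rw [← ENNReal.ofReal_sum_of_nonneg fun i _ => sq_nonneg _]
    simp [dotProduct, sq]
  simp only [h1]
  rw [lintegral_finsetSum _ fun i _ => by fun_prop]
  have h2 : ∀ i : m, ∫⁻ g : m → ℝ, ENNReal.ofReal (g i ^ 2) ∂gaussVec m = 1 := by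
    intro i
    have := (measurePreserving_eval (fun _ : m => gaussianReal 0 1) i).lintegral_comp
      (f := fun x : ℝ => ENNReal.ofReal (x ^ 2)) (by fun_prop)
    simp only [Function.eval] at this
    rw [this, ← ofReal_integral_eq_lintegral_ofReal (memLp_sq_gaussianReal.integrable (by norm_num))
      (Eventually.of_forall fun x => sq_nonneg x), integral_sq_gaussianReal, ENNReal.ofReal_one]
  simp [h2]

lemma card_mul_isotropyDefect_le {κ z : ℝ} (hκ : 0 ≤ κ) (hz : 0 < z) (u : m → ℝ) :
    Fintype.card m * isotropyDefect J κ z u ≤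
      ENNReal.ofReal ((u ⬝ᵥ u) * (2 * (z⁻¹ * √(Fintype.card m * varSq)))) := by
  have hmeas := measurable_isotropy_integrand (m := m) (J := J) κ z
  have hE : Measurable fun v : m → ℝ => isotropyDefect J κ z v :=
    hmeas.lintegral_prod_right (ν := gaussMat J m)
  have havg : ∫⁻ g, isotropyDefect J κ z g ∂gaussVec m ≤
      ENNReal.ofReal (2 * (z⁻¹ * √(Fintype.card m * varSq))) := by
    simp only [isotropyDefect]
    rw [lintegral_lintegral_swap hmeas.aemeasurable]
    have hin : ∀ G : J → m → ℝ, ∫⁻ g, ENNReal.ofReal |g ⬝ᵥ resolvent (wishart κ Finset.univ G) z *ᵥ g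
        - (g ⬝ᵥ g) * ((resolvent (wishart κ Finset.univ G) z).trace / Fintype.card m)| ∂gaussVec m ≤
        ENNReal.ofReal (2 * (z⁻¹ * √(Fintype.card m * varSq))) := by
      intro G
      have hW := wishart_posSemidef hκ Finset.univ G
      set R := resolvent (wishart κ Finset.univ G) z with hR
      rcases isEmpty_or_nonempty m with he | hne
      · simp [dotProduct]
      have hM : (0 : ℝ) < Fintype.card m := by exact_mod_cast Fintype.card_pos
      have ht0 := trace_resolvent_nonneg hW hz
      have ht1 : R.trace / Fintype.card m ≤ z⁻¹ := by
        rw [div_le_iff₀ hM]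
        exact (trace_resolvent_le hW hz).trans (le_of_eq (by ring))
      have h1 := lintegral_quadratic_form_le hW (φ := cauchyKernel z) (C := z⁻¹) (by positivity)
        fun x hx => cauchyKernel_abs_le hz hx
      rw [matFun_cauchyKernel hW hz, ← hR] at h1
      have h2 := lintegral_quadratic_form_le hW (φ := fun _ => 1) (C := 1) (by positivity)
        (by simp)
      rw [matFun_one hW, trace_one] at h2
      simp only [one_mulVec, one_mul] at h2
      have hm1 : Measurable fun g : m → ℝ => ENNReal.ofReal |g ⬝ᵥ R *ᵥ g - R.trace| := by
        simp only [dotProduct, mulVec]; fun_prop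
      have hm2 : Measurable fun g : m → ℝ => ENNReal.ofReal |g ⬝ᵥ g - Fintype.card m| := by
        simp only [dotProduct]; fun_prop
      calc _ ≤ ∫⁻ g, (ENNReal.ofReal |g ⬝ᵥ R *ᵥ g - R.trace| +
            ENNReal.ofReal z⁻¹ * ENNReal.ofReal |g ⬝ᵥ g - Fintype.card m|) ∂gaussVec m := by
            refine lintegral_mono fun g => ?_
            rw [← ENNReal.ofReal_mul (by positivity), ← ENNReal.ofReal_add (by positivity)
              (by positivity)]
            refine ENNReal.ofReal_le_ofReal ?_
            have e : g ⬝ᵥ R *ᵥ g - (g ⬝ᵥ g) * (R.trace / Fintype.card m) =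
                (g ⬝ᵥ R *ᵥ g - R.trace) -
                (R.trace / Fintype.card m) * (g ⬝ᵥ g - Fintype.card m) := by
              field_simp; ring
            rw [e]
            refine (abs_sub _ _).trans ?_
            rw [abs_mul, abs_of_nonneg (div_nonneg ht0 hM.le)]
            gcongr
        _ ≤ ENNReal.ofReal (z⁻¹ * √(Fintype.card m * varSq)) +
            ENNReal.ofReal z⁻¹ * ENNReal.ofReal (√(Fintype.card m * varSq)) := by
            rw [lintegral_add_left hm1, lintegral_const_mul _ hm2]
            gcongr
        _ = _ := by
            rw [← ENNReal.ofReal_mul (by positivity), ← ENNReal.ofReal_add (by positivity)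
              (by positivity)]
            ring_nf
    refine (lintegral_mono hin).trans ?_
    simp
  calc (Fintype.card m : ENNReal) * isotropyDefect J κ z u
      = ∫⁻ g, ENNReal.ofReal (g ⬝ᵥ g) * isotropyDefect J κ z u ∂gaussVec m := by
        rw [lintegral_mul_const _ (by simp only [dotProduct]; fun_prop), lintegral_dotProduct_self]
    _ = ∫⁻ g, ENNReal.ofReal (u ⬝ᵥ u) * isotropyDefect J κ z g ∂gaussVec m :=
        lintegral_congr fun g => isotropyDefect_mul_comm κ z g u
    _ = ENNReal.ofReal (u ⬝ᵥ u) * ∫⁻ g, isotropyDefect J κ z g ∂gaussVec m :=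
        lintegral_const_mul _ hE
    _ ≤ ENNReal.ofReal (u ⬝ᵥ u) * ENNReal.ofReal (2 * (z⁻¹ * √(Fintype.card m * varSq))) := by
        gcongr
    _ = _ := by rw [← ENNReal.ofReal_mul (dotProduct_self_nonneg_real u)]

end Isotropy

section Stieltjes

/-- The Stieltjes transform at `-z` of the Marchenko–Pastur law of ratio `α` and scale `Δ`. -/
noncomputable def stieltjes (α Δ z : ℝ) : ℝ :=
  (-(z + Δ - α * Δ) + √((z + Δ - α * Δ) ^ 2 + 4 * (α * Δ * z))) / (2 * (α * Δ * z))

variable {α Δ z : ℝ}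

lemma stieltjes_pos (hα : 0 < α) (hΔ : 0 < Δ) (hz : 0 < z) : 0 < stieltjes α Δ z := by
  refine div_pos ?_ (by positivity)
  have : |z + Δ - α * Δ| < √((z + Δ - α * Δ) ^ 2 + 4 * (α * Δ * z)) := by
    rw [← Real.sqrt_sq_eq_abs]
    exact Real.sqrt_lt_sqrt (sq_nonneg _) (lt_add_of_pos_right _ (by positivity))
  linarith [le_abs_self (z + Δ - α * Δ)]

lemma stieltjes_eq (hα : 0 < α) (hΔ : 0 < Δ) (hz : 0 < z) :
    z * stieltjes α Δ z + Δ * stieltjes α Δ z / (1 + α * Δ * stieltjes α Δ z) = 1 := by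
  have hpos := stieltjes_pos hα hΔ hz
  have hA : 0 < α * Δ * z := by positivity
  have hq : α * Δ * z * stieltjes α Δ z ^ 2 + (z + Δ - α * Δ) * stieltjes α Δ z - 1 = 0 := by
    rw [stieltjes]
    set B := z + Δ - α * Δ
    set A := α * Δ * z
    have hs := Real.sq_sqrt (by positivity : 0 ≤ B ^ 2 + 4 * A)
    set S := √(B ^ 2 + 4 * A)
    field_simp
    linear_combination hs
  set g := stieltjes α Δ z
  have hD : 1 + α * Δ * g ≠ 0 := by positivity
  field_simp
  linear_combination hq

end Stieltjes

section Regime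

/-- The proportional regime: the number of dimensions `p.1 + 1` tends to infinity and the number of
samples `p.2` is asymptotically `α` times as large. -/
noncomputable def regime (α : ℝ) : Filter (ℕ × ℕ) :=
  comap Prod.fst atTop ⊓ comap (fun p : ℕ × ℕ => (p.2 : ℝ) / ((p.1 : ℝ) + 1)) (𝓝 α)

variable {α : ℝ}

lemma tendsto_ratio : Tendsto (fun p : ℕ × ℕ => (p.2 : ℝ) / ((p.1 : ℝ) + 1)) (regime α) (𝓝 α) :=
  tendsto_comap.mono_left inf_le_right

lemma tendsto_dim : Tendsto (fun p : ℕ × ℕ => (p.1 : ℝ) + 1) (regime α) atTop :=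
  (tendsto_atTop_add_const_right _ 1 tendsto_natCast_atTop_atTop).comp
    (tendsto_comap.mono_left inf_le_left)

lemma tendsto_regime {k : Type*} {l : Filter k} {f : k → ℕ × ℕ}
    (h1 : Tendsto (fun i => (f i).1) l atTop)
    (h2 : Tendsto (fun i => ((f i).2 : ℝ) / (((f i).1 : ℝ) + 1)) l (𝓝 α)) :
    Tendsto f l (regime α) :=
  tendsto_inf.2 ⟨tendsto_comap_iff.2 h1, tendsto_comap_iff.2 h2⟩

lemma regime_neBot (hα : 0 < α) : (regime α).NeBot := by
  have h : Tendsto (fun n : ℕ => (n, ⌊α * ((n : ℝ) + 1)⌋₊)) atTop (regime α) := by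
    refine tendsto_regime tendsto_id ?_
    have := (tendsto_nat_floor_mul_div_atTop hα.le).comp
      (tendsto_atTop_add_const_right atTop (1 : ℝ) (tendsto_natCast_atTop_atTop (R := ℝ)))
    exact this
  exact h.neBot

lemma tendsto_samples (hα : 0 < α) : Tendsto (fun p : ℕ × ℕ => (p.2 : ℝ)) (regime α) atTop := by
  have h := tendsto_ratio.pos_mul_atTop hα (tendsto_dim (α := α))
  refine h.congr fun p => ?_
  have : (p.1 : ℝ) + 1 ≠ 0 := by positivity
  field_simp

lemma tendsto_sqrt_samples_div_dim :
    Tendsto (fun p : ℕ × ℕ => √(p.2 : ℝ) / ((p.1 : ℝ) + 1)) (regime α) (𝓝 0) := by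
  have h1 : Tendsto (fun p : ℕ × ℕ => √((p.2 : ℝ) / ((p.1 : ℝ) + 1))) (regime α) (𝓝 √α) :=
    (Real.continuous_sqrt.tendsto _).comp tendsto_ratio
  have h2 : Tendsto (fun p : ℕ × ℕ => (√((p.1 : ℝ) + 1))⁻¹) (regime α) (𝓝 0) :=
    tendsto_inv_atTop_zero.comp (Real.tendsto_sqrt_atTop.comp tendsto_dim)
  have h := h1.mul h2
  rw [mul_zero] at h
  refine h.congr fun p => ?_
  have hN : (0 : ℝ) ≤ (p.1 : ℝ) + 1 := by positivity
  rw [Real.sqrt_div (by positivity)]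
  field_simp
  rw [Real.sq_sqrt hN]

end Regime

section Model

/-- The randomness of one data point apart from the noise orthogonal to the class mean. -/
abbrev Cell : Type := (Bool × Bool) × ℝ

noncomputable def cellLaw (θ : ℝ) : Measure Cell :=
  ((bernoulliLaw (1 / 2)).prod (bernoulliLaw θ)).prod (gaussianReal 0 1)

/-- The sample space after a rotation that takes the class mean to a coordinate axis. -/
abbrev Noise (p : ℕ × ℕ) : Type := (Fin p.2 → Cell) × (Fin p.1 → Fin p.2 → ℝ)

noncomputable def noiseLaw (θ : ℝ) (p : ℕ × ℕ) : Measure (Noise p) :=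
  (Measure.pi fun _ : Fin p.2 => cellLaw θ).prod (gaussMat (Fin p.1) (Fin p.2))

lemma isProbabilityMeasure_bernoulliLaw {q : ℝ} (h0 : 0 ≤ q) (h1 : q ≤ 1) :
    IsProbabilityMeasure (bernoulliLaw q) := by
  constructor
  simp only [bernoulliLaw, Measure.add_apply, Measure.smul_apply, measure_univ, smul_eq_mul,
    mul_one]
  rw [← ENNReal.ofReal_add h0 (by linarith)]
  simp

variable {θ : ℝ}

lemma isProbabilityMeasure_cellLaw (h0 : 0 ≤ θ) (h1 : θ ≤ 1 / 2) :
    IsProbabilityMeasure (cellLaw θ) := by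
  have := isProbabilityMeasure_bernoulliLaw (q := 1 / 2) (by norm_num) (by norm_num)
  have := isProbabilityMeasure_bernoulliLaw (q := θ) h0 (by linarith)
  rw [cellLaw]
  infer_instance

lemma isProbabilityMeasure_noiseLaw (h0 : 0 ≤ θ) (h1 : θ ≤ 1 / 2) (p : ℕ × ℕ) :
    IsProbabilityMeasure (noiseLaw θ p) := by
  have := isProbabilityMeasure_cellLaw h0 h1
  rw [noiseLaw]
  infer_instance

/-- Convergence in probability in the proportional regime. -/
noncomputable def limitFilter (α θ : ℝ) : Filter (Σ p, Noise p) := probFilter (regime α) (noiseLaw θ)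

lemma limitFilter_neBot {α : ℝ} (hα : 0 < α) (h0 : 0 ≤ θ) (h1 : θ ≤ 1 / 2) :
    (limitFilter α θ).NeBot := by
  have := regime_neBot hα
  have := isProbabilityMeasure_noiseLaw h0 h1
  rw [limitFilter]
  infer_instance

/-- The noise part of the kernel matrix. -/
noncomputable def noiseKernel (Δ : ℝ) (x : Σ p, Noise p) : Matrix (Fin x.1.2) (Fin x.1.2) ℝ :=
  wishart (Δ / ((x.1.1 : ℝ) + 1)) Finset.univ x.2.2

variable {α Δ z : ℝ}

lemma noiseKernel_posSemidef (hΔ : 0 < Δ) (x : Σ p, Noise p) : (noiseKernel Δ x).PosSemidef :=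
  wishart_posSemidef (by positivity) _ _

lemma tendsto_trace_equation (hΔ : 0 < Δ) (h0 : 0 ≤ θ) (h1 : θ ≤ 1 / 2) (hz : 0 < z) :
    Tendsto (fun x : Σ p, Noise p => Δ / ((x.1.1 : ℝ) + 1) * x.1.2 -
        z * (Δ / ((x.1.1 : ℝ) + 1) * (resolvent (noiseKernel Δ x) z).trace) -
        Δ / ((x.1.1 : ℝ) + 1) * x.1.1 *
        (Δ / ((x.1.1 : ℝ) + 1) * (resolvent (noiseKernel Δ x) z).trace /
        (1 + Δ / ((x.1.1 : ℝ) + 1) * (resolvent (noiseKernel Δ x) z).trace)))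
      (limitFilter α θ) (𝓝 0) := by
  have := isProbabilityMeasure_cellLaw h0 h1
  set T : ∀ p : ℕ × ℕ, (Fin p.1 → Fin p.2 → ℝ) → ℝ := fun p G =>
    (resolvent (wishart (Δ / ((p.1 : ℝ) + 1)) Finset.univ G) z).trace with hT
  have hTm : ∀ p, Measurable (T p) := fun p =>
    Finset.measurable_sum _ fun i _ => measurable_wishart_resolvent _ z _ i i
  set c : ℕ × ℕ → ℝ := fun p => (p.1 : ℝ) * ((Δ / ((p.1 : ℝ) + 1)) ^ 2 * (z⁻¹ * √(p.2 * varSq)) +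
        (Δ / ((p.1 : ℝ) + 1)) ^ 2 * z⁻¹) with hc
  have hc0 : Tendsto c (regime α) (𝓝 0) := by
    have h2 := (tendsto_sqrt_samples_div_dim (α := α)).const_mul (Δ ^ 2 * z⁻¹ * √varSq)
    have h3 := (tendsto_inv_atTop_zero.comp (tendsto_dim (α := α))).const_mul (Δ ^ 2 * z⁻¹)
    have h4 := h2.add h3
    simp only [mul_zero, add_zero] at h4
    refine squeeze_zero (fun p => by positivity) (fun p => ?_) h4
    have hN : (0 : ℝ) < (p.1 : ℝ) + 1 := by positivity
    have hr : (p.1 : ℝ) / ((p.1 : ℝ) + 1) ≤ 1 := (div_le_one hN).2 (by linarith)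
    have e : c p = (p.1 : ℝ) / ((p.1 : ℝ) + 1) * (Δ ^ 2 * z⁻¹ * √varSq *
        (√(p.2 : ℝ) / ((p.1 : ℝ) + 1)) + Δ ^ 2 * z⁻¹ * ((p.1 : ℝ) + 1)⁻¹) := by
      rw [hc]
      simp only
      rw [Real.sqrt_mul (by positivity)]
      field_simp
    rw [e]
    exact mul_le_of_le_one_left (by positivity) hr
  refine tendsto_probFilter_of_lintegral (X := fun p (ω : Noise p) =>
    Δ / ((p.1 : ℝ) + 1) * p.2 - z * (Δ / ((p.1 : ℝ) + 1) * T p ω.2) -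
        Δ / ((p.1 : ℝ) + 1) * p.1 * (Δ / ((p.1 : ℝ) + 1) * T p ω.2 /
        (1 + Δ / ((p.1 : ℝ) + 1) * T p ω.2))) (c := c) ?_ hc0 ?_
  · intro p
    have : Measurable fun ω : Noise p => T p ω.2 := (hTm p).comp measurable_snd
    fun_prop
  · refine Eventually.of_forall fun p => ?_
    have hm : Measurable fun G : Fin p.1 → Fin p.2 → ℝ => ENNReal.ofReal
        |Δ / ((p.1 : ℝ) + 1) * p.2 - z * (Δ / ((p.1 : ℝ) + 1) * T p G) -
        Δ / ((p.1 : ℝ) + 1) * p.1 * (Δ / ((p.1 : ℝ) + 1) * T p G /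
        (1 + Δ / ((p.1 : ℝ) + 1) * T p G))| := by
      have := hTm p
      fun_prop
    have h := lintegral_trace_equation_le (m := Fin p.2) (J := Fin p.1)
      (κ := Δ / ((p.1 : ℝ) + 1)) (by positivity) hz
    simp only [Fintype.card_fin] at h
    have hmp : MeasurePreserving (Prod.snd : Noise p → _) (noiseLaw θ p)
        (gaussMat (Fin p.1) (Fin p.2)) := measurePreserving_snd
    rw [hmp.lintegral_comp hm]
    exact h

/-- The Marchenko–Pastur law. -/
lemma tendsto_trace_resolvent (hα : 0 < α) (hΔ : 0 < Δ) (h0 : 0 ≤ θ) (h1 : θ ≤ 1 / 2)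
    (hz : 0 < z) :
    Tendsto (fun x : Σ p, Noise p => (resolvent (noiseKernel Δ x) z).trace / x.1.2)
      (limitFilter α θ) (𝓝 (stieltjes α Δ z)) := by
  set t : (Σ p, Noise p) → ℝ := fun x =>
    Δ / ((x.1.1 : ℝ) + 1) * (resolvent (noiseKernel Δ x) z).trace with ht
  have ht0 : ∀ x, 0 ≤ t x := fun x =>
    mul_nonneg (by positivity) (trace_resolvent_nonneg (noiseKernel_posSemidef hΔ x) hz)
  have heq := tendsto_trace_equation (α := α) hΔ h0 h1 hz
  have hfst : Tendsto Sigma.fst (limitFilter α θ) (regime α) := tendsto_fst_probFilter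
  have hκM : Tendsto (fun x : Σ p, Noise p => Δ / ((x.1.1 : ℝ) + 1) * x.1.2)
      (limitFilter α θ) (𝓝 (Δ * α)) := by
    refine ((tendsto_ratio.comp hfst).const_mul Δ).congr fun x => ?_
    simp only [Function.comp]; ring
  have hκn : Tendsto (fun x : Σ p, Noise p => Δ / ((x.1.1 : ℝ) + 1) * x.1.1)
      (limitFilter α θ) (𝓝 Δ) := by
    have h := ((tendsto_inv_atTop_zero.comp (tendsto_dim (α := α))).comp hfst).const_mul Δ
    have h2 := (tendsto_const_nhds (x := Δ)).sub h
    simp only [mul_zero, sub_zero] at h2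
    refine h2.congr fun x => ?_
    simp only [Function.comp]
    have : (x.1.1 : ℝ) + 1 ≠ 0 := by positivity
    field_simp
    ring
  set γ := stieltjes α Δ z with hγ
  have hγ0 : 0 < γ := stieltjes_pos hα hΔ hz
  have hγe := stieltjes_eq hα hΔ hz
  rw [← hγ] at hγe
  set s := α * Δ * γ with hs
  have hs0 : 0 < s := by positivity
  have hse : Δ * α - z * s - Δ * (s / (1 + s)) = 0 := by
    rw [hs]
    field_simp
    field_simp at hγe
    linear_combination (-Δ * α) * hγe
  have hbd : Tendsto (fun x => (Δ / ((x.1.1 : ℝ) + 1) * x.1.1 - Δ) * (t x / (1 + t x)))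
      (limitFilter α θ) (𝓝 0) := by
    have h := (hκn.sub_const Δ).abs
    rw [sub_self, abs_zero] at h
    refine squeeze_zero_norm (fun x => ?_) h
    rw [norm_mul, Real.norm_eq_abs, Real.norm_eq_abs]
    refine mul_le_of_le_one_right (abs_nonneg _) ?_
    have := ht0 x
    rw [abs_of_nonneg (by positivity)]
    exact (div_le_one (by positivity)).2 (by linarith)
  have hF : Tendsto (fun x => Δ * α - z * t x - Δ * (t x / (1 + t x))) (limitFilter α θ) (𝓝 0) := by
    have h := (heq.add hbd).sub (hκM.sub_const (Δ * α))
    simp only [add_zero, sub_self] at h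
    refine h.congr fun x => ?_
    simp only [ht]
    ring
  have htl : Tendsto t (limitFilter α θ) (𝓝 s) := by
    rw [tendsto_iff_norm_sub_tendsto_zero]
    have h := hF.abs.const_mul z⁻¹
    rw [abs_zero, mul_zero] at h
    refine squeeze_zero (fun _ => norm_nonneg _) (fun x => ?_) h
    have htx := ht0 x
    have e : Δ * α - z * t x - Δ * (t x / (1 + t x)) =
        -(t x - s) * (z + Δ / ((1 + t x) * (1 + s))) := by
      rw [← sub_zero (Δ * α - z * t x - Δ * (t x / (1 + t x))), ← hse]
      field_simp
      ring
    rw [e, abs_mul, abs_neg, Real.norm_eq_abs,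
      abs_of_pos (by positivity : 0 < z + Δ / ((1 + t x) * (1 + s)))]
    rw [le_inv_mul_iff₀ hz, mul_comm]
    refine mul_le_mul_of_nonneg_left ?_ (abs_nonneg _)
    have : 0 ≤ Δ / ((1 + t x) * (1 + s)) := by positivity
    linarith
  have hfin := htl.div hκM (by positivity)
  have e : s / (Δ * α) = γ := by rw [hs]; field_simp
  rw [e] at hfin
  have hM : ∀ᶠ x : Σ p, Noise p in limitFilter α θ, (0 : ℝ) < x.1.2 :=
    ((tendsto_samples hα).comp hfst).eventually_gt_atTop 0
  refine hfin.congr' ?_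
  filter_upwards [hM] with x hx
  simp only [ht, Pi.div_apply]
  have : (x.1.1 : ℝ) + 1 ≠ 0 := by positivity
  field_simp

end Model

section CellVectors

variable {α Δ θ z : ℝ}

/-- A vector indexed by the samples, normalized by the square root of the dimension. -/
noncomputable def cellVec (ψ : Cell → ℝ) (x : Σ p, Noise p) : Fin x.1.2 → ℝ :=
  fun i => ψ (x.2.1 i) / √((x.1.1 : ℝ) + 1)

lemma cellVec_dotProduct (ψ₁ ψ₂ : Cell → ℝ) (x : Σ p, Noise p) :
    cellVec ψ₁ x ⬝ᵥ cellVec ψ₂ x =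
      (∑ i, (fun c => ψ₁ c * ψ₂ c) (x.2.1 i)) / ((x.1.1 : ℝ) + 1) := by
  rw [Finset.sum_div]
  refine Finset.sum_congr rfl fun i _ => ?_
  simp only [cellVec]
  rw [div_mul_div_comm, Real.mul_self_sqrt (by positivity)]

lemma integral_pi_eval (h0 : 0 ≤ θ) (h1 : θ ≤ 1 / 2) {ψ : Cell → ℝ} (hψ : Measurable ψ) {M : ℕ}
    (i : Fin M) : ∫ c : Fin M → Cell, ψ (c i) ∂(Measure.pi fun _ => cellLaw θ) =
      ∫ c, ψ c ∂cellLaw θ := by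
  have := isProbabilityMeasure_cellLaw h0 h1
  have hmp := measurePreserving_eval (fun _ : Fin M => cellLaw θ) i
  conv_rhs => rw [← hmp.map_eq]
  rw [integral_map (measurable_pi_apply i).aemeasurable hψ.aestronglyMeasurable]

/-- The law of large numbers in the proportional regime. -/
lemma tendsto_sum_cell (h0 : 0 ≤ θ) (h1 : θ ≤ 1 / 2) {ψ : Cell → ℝ} (hψm : Measurable ψ)
    (hψ : MemLp ψ 2 (cellLaw θ)) :
    Tendsto (fun x : Σ p, Noise p => (∑ i, ψ (x.2.1 i)) / ((x.1.1 : ℝ) + 1)) (limitFilter α θ)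
      (𝓝 (α * ∫ c, ψ c ∂cellLaw θ)) := by
  have := isProbabilityMeasure_cellLaw h0 h1
  set E := ∫ c, ψ c ∂cellLaw θ with hE
  set V := Var[ψ; cellLaw θ] with hV
  have hdev : Tendsto (fun x : Σ p, Noise p =>
      (∑ i, ψ (x.2.1 i) - x.1.2 * E) / ((x.1.1 : ℝ) + 1)) (limitFilter α θ) (𝓝 0) := by
    refine tendsto_probFilter_of_lintegral (X := fun p (ω : Noise p) =>
      (∑ i, ψ (ω.1 i) - p.2 * E) / ((p.1 : ℝ) + 1))
      (c := fun p => √(p.2 * V) / ((p.1 : ℝ) + 1)) ?_ ?_ ?_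
    · intro p; fun_prop
    · have h := (tendsto_sqrt_samples_div_dim (α := α)).mul_const √V
      rw [zero_mul] at h
      refine h.congr fun p => ?_
      rw [Real.sqrt_mul (by positivity)]
      ring
    · refine Eventually.of_forall fun p => ?_
      set P := Measure.pi fun _ : Fin p.2 => cellLaw θ
      have hL : ∀ i : Fin p.2, MemLp (fun c : Fin p.2 → Cell => ψ (c i)) 2 P :=
        fun i => hψ.comp_measurePreserving (measurePreserving_eval _ i)
      have hsum : MemLp (∑ i, fun c : Fin p.2 → Cell => ψ (c i)) 2 P :=
        memLp_finsetSum' _ fun i _ => hL i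
      have hvar : Var[∑ i, fun c : Fin p.2 → Cell => ψ (c i); P] = p.2 * V := by
        rw [variance_sum_pi (X := fun _ => ψ) fun _ => hψ]
        simp [hV]
      have h_int : ∫ c, (∑ i, fun c : Fin p.2 → Cell => ψ (c i)) c ∂P = p.2 * E := by
        simp only [Finset.sum_apply]
        rw [integral_finsetSum _ fun i _ => (hL i).integrable (by norm_num)]
        simp only [P, integral_pi_eval h0 h1 hψm]
        simp [hE]
      have h := lintegral_abs_le_of_variance hsum hvar.le
      rw [h_int] at h
      have hm : Measurable fun c : Fin p.2 → Cell =>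
          ENNReal.ofReal |(∑ i, ψ (c i) - p.2 * E) / ((p.1 : ℝ) + 1)| := by fun_prop
      have hmp : MeasurePreserving (Prod.fst : Noise p → _) (noiseLaw θ p) P :=
        measurePreserving_fst
      rw [hmp.lintegral_comp hm]
      have hN : (0 : ℝ) < (p.1 : ℝ) + 1 := by positivity
      have e : ∀ c : Fin p.2 → Cell, ENNReal.ofReal |(∑ i, ψ (c i) - p.2 * E) / ((p.1 : ℝ) + 1)| =
          ENNReal.ofReal ((p.1 : ℝ) + 1)⁻¹ * ENNReal.ofReal |∑ i, ψ (c i) - p.2 * E| := by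
        intro c
        rw [← ENNReal.ofReal_mul (by positivity), abs_div, abs_of_pos hN, div_eq_inv_mul]
      simp only [e]
      rw [lintegral_const_mul _ (by fun_prop), div_eq_inv_mul, ENNReal.ofReal_mul (by positivity)]
      gcongr
      simpa only [Finset.sum_apply] using h
  have hfst : Tendsto Sigma.fst (limitFilter α θ) (regime α) := tendsto_fst_probFilter
  have h := hdev.add ((tendsto_ratio.comp hfst).mul_const E)
  rw [zero_add] at h
  refine h.congr fun x => ?_
  simp only [Function.comp]
  ring

lemma memLp_mul_cell {ψ₁ ψ₂ : Cell → ℝ} (h₁ : MemLp ψ₁ 4 (cellLaw θ)) (h₂ : MemLp ψ₂ 4 (cellLaw θ)) :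
    MemLp (fun c => ψ₁ c * ψ₂ c) 2 (cellLaw θ) := by
  have : ENNReal.HolderTriple 4 4 2 := ⟨by
    rw [← two_mul, show (4 : ENNReal) = 2 * 2 by norm_num,
      ENNReal.mul_inv (by norm_num) (by norm_num), ← mul_assoc,
      ENNReal.mul_inv_cancel (by norm_num) (by norm_num), one_mul]⟩
  exact h₂.mul h₁

lemma tendsto_cellVec_dotProduct (h0 : 0 ≤ θ) (h1 : θ ≤ 1 / 2) {ψ₁ ψ₂ : Cell → ℝ}
    (hm₁ : Measurable ψ₁) (hm₂ : Measurable ψ₂)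
    (h₁ : MemLp ψ₁ 4 (cellLaw θ)) (h₂ : MemLp ψ₂ 4 (cellLaw θ)) :
    Tendsto (fun x => cellVec ψ₁ x ⬝ᵥ cellVec ψ₂ x) (limitFilter α θ)
      (𝓝 (α * ∫ c, ψ₁ c * ψ₂ c ∂cellLaw θ)) := by
  have h := tendsto_sum_cell (α := α) (ψ := fun c => ψ₁ c * ψ₂ c) h0 h1 (hm₁.mul hm₂)
    (memLp_mul_cell h₁ h₂)
  exact h.congr fun x => (cellVec_dotProduct ψ₁ ψ₂ x).symm

lemma lintegral_cellVec_sq (h0 : 0 ≤ θ) (h1 : θ ≤ 1 / 2) {ψ : Cell → ℝ} (hm : Measurable ψ)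
    (h : MemLp ψ 4 (cellLaw θ)) (M : ℕ) {N : ℝ} (hN : 0 < N) :
    ∫⁻ c : Fin M → Cell, ENNReal.ofReal ((fun i => ψ (c i) / √N) ⬝ᵥ fun i => ψ (c i) / √N)
      ∂(Measure.pi fun _ => cellLaw θ) = ENNReal.ofReal (M / N * ∫ c, ψ c * ψ c ∂cellLaw θ) := by
  have := isProbabilityMeasure_cellLaw h0 h1
  have hI : ∀ i : Fin M, Integrable (fun c : Fin M → Cell => ψ (c i) * ψ (c i))
      (Measure.pi fun _ => cellLaw θ) := fun i =>
    (((memLp_mul_cell h h).comp_measurePreserving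
      (measurePreserving_eval (fun _ : Fin M => cellLaw θ) i))).integrable (by norm_num)
  have e : ∀ c : Fin M → Cell, ((fun i => ψ (c i) / √N) ⬝ᵥ fun i => ψ (c i) / √N) =
      N⁻¹ * ∑ i, ψ (c i) * ψ (c i) := by
    intro c
    rw [Finset.mul_sum]
    refine Finset.sum_congr rfl fun i _ => ?_
    rw [div_mul_div_comm, Real.mul_self_sqrt hN.le, div_eq_inv_mul]
  simp only [e]
  rw [← ofReal_integral_eq_lintegral_ofReal ((integrable_finsetSum _ fun i _ => hI i).const_mul _)]
  · rw [integral_const_mul, integral_finsetSum _ fun i _ => hI i]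
    have : ∀ i : Fin M, ∫ c : Fin M → Cell, ψ (c i) * ψ (c i) ∂(Measure.pi fun _ => cellLaw θ) =
        ∫ c, ψ c * ψ c ∂cellLaw θ := fun i =>
      integral_pi_eval h0 h1 (ψ := fun c => ψ c * ψ c) (hm.mul hm) i
    simp only [this, Finset.sum_const, Finset.card_univ, Fintype.card_fin, nsmul_eq_mul]
    ring_nf
  · exact Eventually.of_forall fun c => mul_nonneg (by positivity)
      (Finset.sum_nonneg fun i _ => mul_self_nonneg _)

lemma tendsto_quadratic_form_sub (hα : 0 < α) (hΔ : 0 < Δ) (h0 : 0 ≤ θ) (h1 : θ ≤ 1 / 2)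
    (hz : 0 < z) {ψ : Cell → ℝ} (hm : Measurable ψ) (h : MemLp ψ 4 (cellLaw θ)) :
    Tendsto (fun x => cellVec ψ x ⬝ᵥ resolvent (noiseKernel Δ x) z *ᵥ cellVec ψ x -
      (cellVec ψ x ⬝ᵥ cellVec ψ x) * ((resolvent (noiseKernel Δ x) z).trace / x.1.2))
      (limitFilter α θ) (𝓝 0) := by
  have := isProbabilityMeasure_cellLaw h0 h1
  set A := ∫ c, ψ c * ψ c ∂cellLaw θ with hA
  have hA0 : 0 ≤ A := integral_nonneg fun c => mul_self_nonneg _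
  set u : ∀ p : ℕ × ℕ, (Fin p.2 → Cell) → Fin p.2 → ℝ := fun p c i => ψ (c i) / √((p.1 : ℝ) + 1)
    with hu
  have hum : ∀ p, Measurable (u p) := fun p => by
    refine measurable_pi_lambda _ fun i => ?_
    simp only [hu]; fun_prop
  set X : ∀ p : ℕ × ℕ, Noise p → ℝ := fun p ω => u p ω.1 ⬝ᵥ
      resolvent (wishart (Δ / ((p.1 : ℝ) + 1)) Finset.univ ω.2) z *ᵥ u p ω.1 -
      (u p ω.1 ⬝ᵥ u p ω.1) *
      ((resolvent (wishart (Δ / ((p.1 : ℝ) + 1)) Finset.univ ω.2) z).trace / p.2) with hX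
  have hXm : ∀ p, Measurable (X p) := by
    intro p
    have hR : ∀ i k, Measurable fun ω : Noise p =>
        resolvent (wishart (Δ / ((p.1 : ℝ) + 1)) Finset.univ ω.2) z i k :=
      fun i k => (measurable_wishart_resolvent _ z _ i k).comp measurable_snd
    have hu1 : ∀ i, Measurable fun ω : Noise p => u p ω.1 i := fun i =>
      (measurable_pi_apply i).comp ((hum p).comp measurable_fst)
    have h1 : Measurable fun ω : Noise p => u p ω.1 ⬝ᵥ
      resolvent (wishart (Δ / ((p.1 : ℝ) + 1)) Finset.univ ω.2) z *ᵥ u p ω.1 :=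
      measurable_form hR hu1 hu1
    have h2 : Measurable fun ω : Noise p =>
        (resolvent (wishart (Δ / ((p.1 : ℝ) + 1)) Finset.univ ω.2) z).trace :=
      Finset.measurable_sum _ fun i _ => hR i i
    have h3 : Measurable fun ω : Noise p => u p ω.1 ⬝ᵥ u p ω.1 :=
      Finset.measurable_sum _ fun i _ => (hu1 i).mul (hu1 i)
    exact h1.sub (h3.mul (h2.div_const _))
  refine tendsto_probFilter_of_lintegral (X := X)
    (c := fun p => (2 * z⁻¹ * A * √varSq) * (√(p.2 : ℝ) / ((p.1 : ℝ) + 1))) hXm ?_ ?_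
  · simpa using (tendsto_sqrt_samples_div_dim (α := α)).const_mul (2 * z⁻¹ * A * √varSq)
  · filter_upwards [(tendsto_samples hα).eventually_gt_atTop 0] with p hp
    have hXe : Measurable fun ω : Noise p => ENNReal.ofReal |X p ω| :=
      ENNReal.measurable_ofReal.comp (hXm p).norm
    rw [noiseLaw, lintegral_prod _ hXe.aemeasurable]
    have hin : ∀ c : Fin p.2 → Cell, ∫⁻ G, ENNReal.ofReal |X p (c, G)|
        ∂gaussMat (Fin p.1) (Fin p.2) ≤ ENNReal.ofReal (2 * (z⁻¹ * √(p.2 * varSq)) / p.2) *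
          ENNReal.ofReal (u p c ⬝ᵥ u p c) := by
      intro c
      have hle := card_mul_isotropyDefect_le (J := Fin p.1) (κ := Δ / ((p.1 : ℝ) + 1))
        (by positivity) hz (u p c)
      simp only [Fintype.card_fin] at hle
      have hX' : ∫⁻ G, ENNReal.ofReal |X p (c, G)| ∂gaussMat (Fin p.1) (Fin p.2) =
          isotropyDefect (Fin p.1) (Δ / ((p.1 : ℝ) + 1)) z (u p c) := by
        simp only [isotropyDefect, Fintype.card_fin, hX]
      rw [hX', ← ENNReal.ofReal_mul (by positivity)]
      have hp' : (p.2 : ENNReal) ≠ 0 := by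
        have : p.2 ≠ 0 := by rintro h; simp [h] at hp
        exact_mod_cast this
      rw [← ENNReal.mul_le_mul_iff_right hp' (ENNReal.natCast_ne_top _)]
      refine hle.trans (le_of_eq ?_)
      rw [← ENNReal.ofReal_natCast, ← ENNReal.ofReal_mul hp.le]
      congr 1
      field_simp
    refine (lintegral_mono hin).trans ?_
    rw [lintegral_const_mul _ (by
      refine ENNReal.measurable_ofReal.comp (Finset.measurable_sum _ fun i _ => ?_)
      exact ((measurable_pi_apply i).comp (hum p)).mul ((measurable_pi_apply i).comp (hum p)))]
    have hsq := lintegral_cellVec_sq h0 h1 hm h p.2 (N := (p.1 : ℝ) + 1) (by positivity)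
    simp only [hu]
    rw [hsq, ← ENNReal.ofReal_mul (by positivity), ← hA]
    refine le_of_eq (congrArg _ ?_)
    rw [Real.sqrt_mul (by positivity)]
    field_simp

lemma tendsto_noise_form (hα : 0 < α) (hΔ : 0 < Δ) (h0 : 0 ≤ θ) (h1 : θ ≤ 1 / 2)
    (hz : 0 < z) {ψ₁ ψ₂ : Cell → ℝ} (hm₁ : Measurable ψ₁) (hm₂ : Measurable ψ₂)
    (h₁ : MemLp ψ₁ 4 (cellLaw θ)) (h₂ : MemLp ψ₂ 4 (cellLaw θ)) :
    Tendsto (fun x => cellVec ψ₁ x ⬝ᵥ resolvent (noiseKernel Δ x) z *ᵥ cellVec ψ₂ x)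
      (limitFilter α θ) (𝓝 (α * (∫ c, ψ₁ c * ψ₂ c ∂cellLaw θ) * stieltjes α Δ z)) := by
  have hp := tendsto_quadratic_form_sub hα hΔ h0 h1 hz (hm₁.add hm₂) (h₁.add h₂)
  have hq := tendsto_quadratic_form_sub hα hΔ h0 h1 hz (hm₁.sub hm₂) (h₁.sub h₂)
  have hd := (tendsto_cellVec_dotProduct (α := α) h0 h1 hm₁ hm₂ h₁ h₂).mul
    (tendsto_trace_resolvent hα hΔ h0 h1 hz)
  have h := ((hp.sub hq).div_const 4).add hd
  simp only [sub_zero, zero_div, zero_add] at h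
  refine h.congr fun x => ?_
  set R := resolvent (noiseKernel Δ x) z with hR
  have hsym : Rᵀ = R := by
    rw [hR, ← matFun_cauchyKernel (noiseKernel_posSemidef hΔ x) hz, matFun_transpose]
  have ea : cellVec (ψ₁ + ψ₂) x = cellVec ψ₁ x + cellVec ψ₂ x := by
    funext i; simp [cellVec, add_div]
  have es : cellVec (ψ₁ - ψ₂) x = cellVec ψ₁ x - cellVec ψ₂ x := by
    funext i; simp [cellVec, sub_div]
  have hsw : cellVec ψ₂ x ⬝ᵥ R *ᵥ cellVec ψ₁ x = cellVec ψ₁ x ⬝ᵥ R *ᵥ cellVec ψ₂ x := by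
    rw [dotProduct_mulVec, ← mulVec_transpose, hsym, dotProduct_comm]
  rw [ea, es]
  simp only [mulVec_add, mulVec_sub, add_dotProduct, dotProduct_add, sub_dotProduct,
    dotProduct_sub, hsw, dotProduct_comm (cellVec ψ₂ x) (cellVec ψ₁ x)]
  ring

end CellVectors

section KernelForms

variable {α Δ θ z : ℝ}

/-- The true class as a sign. -/
noncomputable def classSign (b : Bool × Bool) : ℝ := if b.1 then 1 else -1

/-- The observed class as a sign. -/
noncomputable def labelSign (b : Bool × Bool) : ℝ := if b.2 then -classSign b else classSign b

/-- The component of a data point along the class mean. -/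
noncomputable def signalCoord (Δ : ℝ) (c : Cell) : ℝ := classSign c.1 + √Δ * c.2

noncomputable def labelCoord (c : Cell) : ℝ := labelSign c.1

def unitCoord (_ : Cell) : ℝ := 1

lemma measurable_signalCoord (Δ : ℝ) : Measurable (signalCoord Δ) := by
  have : Measurable classSign := measurable_of_countable _
  unfold signalCoord
  fun_prop

lemma measurable_labelCoord : Measurable labelCoord := by
  have : Measurable labelSign := measurable_of_countable _
  unfold labelCoord
  fun_prop

lemma measurable_unitCoord : Measurable unitCoord := measurable_const

lemma abs_classSign (b : Bool × Bool) : |classSign b| = 1 := by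
  unfold classSign; split_ifs <;> simp

lemma abs_labelSign (b : Bool × Bool) : |labelSign b| = 1 := by
  unfold labelSign; split_ifs <;> simp [abs_classSign]

lemma memLp_labelCoord (h0 : 0 ≤ θ) (h1 : θ ≤ 1 / 2) : MemLp labelCoord 4 (cellLaw θ) := by
  have := isProbabilityMeasure_cellLaw h0 h1
  exact MemLp.of_bound measurable_labelCoord.aestronglyMeasurable 1
    (Eventually.of_forall fun c => (abs_labelSign c.1).le)

lemma memLp_unitCoord (h0 : 0 ≤ θ) (h1 : θ ≤ 1 / 2) : MemLp unitCoord 4 (cellLaw θ) := by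
  have := isProbabilityMeasure_cellLaw h0 h1
  exact memLp_const 1

lemma memLp_signalCoord (h0 : 0 ≤ θ) (h1 : θ ≤ 1 / 2) : MemLp (signalCoord Δ) 4 (cellLaw θ) := by
  have := isProbabilityMeasure_cellLaw h0 h1
  have := isProbabilityMeasure_bernoulliLaw (q := 1 / 2) (by norm_num) (by norm_num)
  have := isProbabilityMeasure_bernoulliLaw (q := θ) h0 (by linarith)
  have hs : Measurable classSign := measurable_of_countable _
  have hA : MemLp (fun c : Cell => classSign c.1) 4 (cellLaw θ) :=
    MemLp.of_bound (hs.comp measurable_fst).aestronglyMeasurable 1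
      (Eventually.of_forall fun c => (abs_classSign c.1).le)
  have hmp : MeasurePreserving (Prod.snd : Cell → ℝ) (cellLaw θ) (gaussianReal 0 1) :=
    measurePreserving_snd
  have hB : MemLp (fun c : Cell => c.2) 4 (cellLaw θ) :=
    (memLp_id_gaussianReal' (μ := 0) (v := 1) 4 (by norm_num)).comp_measurePreserving hmp
  exact hA.add (hB.const_mul √Δ)

lemma integral_bernoulliLaw {q : ℝ} (h0 : 0 ≤ q) (h1 : q ≤ 1) (f : Bool → ℝ) :
    ∫ b, f b ∂bernoulliLaw q = q * f true + (1 - q) * f false := by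
  rw [bernoulliLaw, integral_add_measure (Integrable.smul_measure Integrable.of_finite (by simp))
    (Integrable.smul_measure Integrable.of_finite (by simp)), integral_smul_measure,
    integral_smul_measure, integral_dirac, integral_dirac, ENNReal.toReal_ofReal h0,
    ENNReal.toReal_ofReal (by linarith)]
  rfl

lemma integral_cellLaw (h0 : 0 ≤ θ) (h1 : θ ≤ 1 / 2) {f : Cell → ℝ} (hf : Integrable f (cellLaw θ)) :
    ∫ c, f c ∂cellLaw θ =
      1 / 2 * (θ * ∫ x, f ((true, true), x) ∂gaussianReal 0 1 +
        (1 - θ) * ∫ x, f ((true, false), x) ∂gaussianReal 0 1) +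
      1 / 2 * (θ * ∫ x, f ((false, true), x) ∂gaussianReal 0 1 +
        (1 - θ) * ∫ x, f ((false, false), x) ∂gaussianReal 0 1) := by
  have := isProbabilityMeasure_bernoulliLaw (q := 1 / 2) (by norm_num) (by norm_num)
  have := isProbabilityMeasure_bernoulliLaw (q := θ) h0 (by linarith)
  rw [cellLaw] at hf ⊢
  rw [integral_prod _ hf, integral_prod _ Integrable.of_finite,
    integral_bernoulliLaw (by norm_num) (by norm_num), integral_bernoulliLaw h0 (by linarith),
    integral_bernoulliLaw h0 (by linarith)]
  ring

lemma integrable_mul_cell (h0 : 0 ≤ θ) (h1 : θ ≤ 1 / 2) {ψ₁ ψ₂ : Cell → ℝ}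
    (h₁ : MemLp ψ₁ 4 (cellLaw θ)) (h₂ : MemLp ψ₂ 4 (cellLaw θ)) :
    Integrable (fun c => ψ₁ c * ψ₂ c) (cellLaw θ) := by
  have := isProbabilityMeasure_cellLaw h0 h1
  exact (memLp_mul_cell h₁ h₂).integrable (by norm_num)

lemma integral_affine_gaussian (a b : ℝ) : ∫ x, (a + b * x) ∂gaussianReal 0 1 = a := by
  have hi : Integrable (fun x : ℝ => x) (gaussianReal 0 1) :=
    (memLp_id_gaussianReal' (μ := 0) (v := 1) 1 (by norm_num)).integrable le_rfl
  rw [integral_add (integrable_const _) (hi.const_mul _), integral_const_mul,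
    integral_id_gaussianReal]
  simp

lemma integral_affine_sq_gaussian (a b : ℝ) :
    ∫ x, ((a + b * x) * (a + b * x)) ∂gaussianReal 0 1 = a ^ 2 + b ^ 2 := by
  have hi : Integrable (fun x : ℝ => x ^ 2) (gaussianReal 0 1) :=
    memLp_sq_gaussianReal.integrable (by norm_num)
  have hj : Integrable (fun x : ℝ => x) (gaussianReal 0 1) :=
    (memLp_id_gaussianReal' (μ := 0) (v := 1) 1 (by norm_num)).integrable le_rfl
  have e : ∀ x : ℝ, (a + b * x) * (a + b * x) = (a ^ 2 + 2 * a * b * x) + b ^ 2 * x ^ 2 :=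
    fun x => by ring
  simp only [e]
  have hk : Integrable (fun x : ℝ => a ^ 2 + 2 * a * b * x) (gaussianReal 0 1) :=
    (integrable_const _).add (hj.const_mul _)
  rw [integral_add hk (hi.const_mul _), integral_affine_gaussian, integral_const_mul, integral_sq_gaussianReal, mul_one]

lemma integral_label_label (h0 : 0 ≤ θ) (h1 : θ ≤ 1 / 2) :
    ∫ c, labelCoord c * labelCoord c ∂cellLaw θ = 1 := by
  have := isProbabilityMeasure_cellLaw h0 h1
  have : ∀ c : Cell, labelCoord c * labelCoord c = 1 := fun c => by
    rw [← abs_mul_abs_self, labelCoord, abs_labelSign, one_mul]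
  simp [this]

lemma integral_unit_unit (h0 : 0 ≤ θ) (h1 : θ ≤ 1 / 2) :
    ∫ c, unitCoord c * unitCoord c ∂cellLaw θ = 1 := by
  have := isProbabilityMeasure_cellLaw h0 h1
  simp [unitCoord]

lemma integral_unit_label (h0 : 0 ≤ θ) (h1 : θ ≤ 1 / 2) :
    ∫ c, unitCoord c * labelCoord c ∂cellLaw θ = 0 := by
  rw [integral_cellLaw h0 h1
    (integrable_mul_cell h0 h1 (memLp_unitCoord h0 h1) (memLp_labelCoord h0 h1))]
  simp [unitCoord, labelCoord, labelSign, classSign]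
  ring

lemma integral_unit_signal (h0 : 0 ≤ θ) (h1 : θ ≤ 1 / 2) :
    ∫ c, unitCoord c * signalCoord Δ c ∂cellLaw θ = 0 := by
  rw [integral_cellLaw h0 h1
    (integrable_mul_cell h0 h1 (memLp_unitCoord h0 h1) (memLp_signalCoord h0 h1))]
  simp only [unitCoord, signalCoord, one_mul, integral_affine_gaussian]
  simp [classSign]
  ring

lemma integral_signal_label (h0 : 0 ≤ θ) (h1 : θ ≤ 1 / 2) :
    ∫ c, signalCoord Δ c * labelCoord c ∂cellLaw θ = 1 - 2 * θ := by
  rw [integral_cellLaw h0 h1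
    (integrable_mul_cell h0 h1 (memLp_signalCoord h0 h1) (memLp_labelCoord h0 h1))]
  simp only [labelCoord, signalCoord, integral_mul_const, integral_affine_gaussian]
  simp [classSign, labelSign]
  ring

lemma integral_signal_signal (hΔ : 0 < Δ) (h0 : 0 ≤ θ) (h1 : θ ≤ 1 / 2) :
    ∫ c, signalCoord Δ c * signalCoord Δ c ∂cellLaw θ = 1 + Δ := by
  rw [integral_cellLaw h0 h1
    (integrable_mul_cell h0 h1 (memLp_signalCoord h0 h1) (memLp_signalCoord h0 h1))]
  simp only [signalCoord, integral_affine_sq_gaussian, Real.sq_sqrt hΔ.le]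
  simp [classSign]
  ring

noncomputable abbrev signalVec (Δ : ℝ) (x : Σ p, Noise p) : Fin x.1.2 → ℝ :=
  cellVec (signalCoord Δ) x

noncomputable abbrev labelVec (x : Σ p, Noise p) : Fin x.1.2 → ℝ := cellVec labelCoord x

noncomputable abbrev unitVec (x : Σ p, Noise p) : Fin x.1.2 → ℝ := cellVec unitCoord x

/-- The kernel matrix of the rotated data. -/
noncomputable def kernel (Δ : ℝ) (x : Σ p, Noise p) : Matrix (Fin x.1.2) (Fin x.1.2) ℝ :=
  noiseKernel Δ x + vecMulVec (signalVec Δ x) (signalVec Δ x)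

lemma kernel_posSemidef (hΔ : 0 < Δ) (x : Σ p, Noise p) : (kernel Δ x).PosSemidef := by
  have := posSemidef_vecMulVec_self_star (signalVec Δ x)
  rw [star_trivial] at this
  exact (noiseKernel_posSemidef hΔ x).add this

/-- The limit of `a · (K + z)⁻¹ h`. -/
noncomputable def alignment (α Δ θ z : ℝ) : ℝ :=
  (1 - 2 * θ) * α * stieltjes α Δ z / (1 + α * (1 + Δ) * stieltjes α Δ z)

/-- The limit of `h · (K + z)⁻¹ h`. -/
noncomputable def labelEnergy (α Δ θ z : ℝ) : ℝ :=
  α * stieltjes α Δ z - (1 - 2 * θ) ^ 2 * α ^ 2 * stieltjes α Δ z ^ 2 /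
    (1 + α * (1 + Δ) * stieltjes α Δ z)

lemma tendsto_kernel_form (hα : 0 < α) (hΔ : 0 < Δ) (h0 : 0 ≤ θ) (h1 : θ ≤ 1 / 2)
    (hz : 0 < z) {ψ₁ ψ₂ : Cell → ℝ} (hm₁ : Measurable ψ₁) (hm₂ : Measurable ψ₂)
    (h₁ : MemLp ψ₁ 4 (cellLaw θ)) (h₂ : MemLp ψ₂ 4 (cellLaw θ)) {e₁₂ e₁ e₂ : ℝ}
    (he₁₂ : ∫ c, ψ₁ c * ψ₂ c ∂cellLaw θ = e₁₂)
    (he₁ : ∫ c, ψ₁ c * signalCoord Δ c ∂cellLaw θ = e₁)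
    (he₂ : ∫ c, signalCoord Δ c * ψ₂ c ∂cellLaw θ = e₂) :
    Tendsto (fun x => cellVec ψ₁ x ⬝ᵥ resolvent (kernel Δ x) z *ᵥ cellVec ψ₂ x)
      (limitFilter α θ) (𝓝 (α * e₁₂ * stieltjes α Δ z - (α * e₁ * stieltjes α Δ z) *
        (α * e₂ * stieltjes α Δ z) / (1 + α * (1 + Δ) * stieltjes α Δ z))) := by
  have hs := stieltjes_pos hα hΔ hz
  have hA := memLp_signalCoord (Δ := Δ) h0 h1
  have hAm := measurable_signalCoord Δ
  have t12 := tendsto_noise_form hα hΔ h0 h1 hz hm₁ hm₂ h₁ h₂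
  have t1 := tendsto_noise_form hα hΔ h0 h1 hz hm₁ hAm h₁ hA
  have t2 := tendsto_noise_form hα hΔ h0 h1 hz hAm hm₂ hA h₂
  have tA := tendsto_noise_form hα hΔ h0 h1 hz hAm hAm hA hA
  rw [he₁₂] at t12
  rw [he₁] at t1
  rw [he₂] at t2
  rw [integral_signal_signal hΔ h0 h1] at tA
  refine (t12.sub ((t1.mul t2).div (tA.const_add 1) (by positivity))).congr fun x => ?_
  exact (resolvent_add_vecMulVec_form (noiseKernel_posSemidef hΔ x) hz _ _ _).symm

lemma tendsto_signal_label (hα : 0 < α) (hΔ : 0 < Δ) (h0 : 0 ≤ θ) (h1 : θ ≤ 1 / 2) (hz : 0 < z) :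
    Tendsto (fun x => signalVec Δ x ⬝ᵥ resolvent (kernel Δ x) z *ᵥ labelVec x)
      (limitFilter α θ) (𝓝 (alignment α Δ θ z)) := by
  have h := tendsto_kernel_form hα hΔ h0 h1 hz (measurable_signalCoord Δ) measurable_labelCoord
    (memLp_signalCoord h0 h1) (memLp_labelCoord h0 h1) (integral_signal_label h0 h1)
    (integral_signal_signal hΔ h0 h1) (integral_signal_label h0 h1)
  have hs := stieltjes_pos hα hΔ hz
  convert h using 2
  rw [alignment]
  field_simp
  ring

lemma tendsto_label_label (hα : 0 < α) (hΔ : 0 < Δ) (h0 : 0 ≤ θ) (h1 : θ ≤ 1 / 2) (hz : 0 < z) :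
    Tendsto (fun x => labelVec x ⬝ᵥ resolvent (kernel Δ x) z *ᵥ labelVec x)
      (limitFilter α θ) (𝓝 (labelEnergy α Δ θ z)) := by
  have h := tendsto_kernel_form hα hΔ h0 h1 hz measurable_labelCoord measurable_labelCoord
    (memLp_labelCoord h0 h1) (memLp_labelCoord h0 h1) (integral_label_label h0 h1)
    (e₁ := 1 - 2 * θ) (by rw [← integral_signal_label (Δ := Δ) h0 h1]; simp only [mul_comm])
    (integral_signal_label h0 h1)
  convert h using 2
  rw [labelEnergy]
  ring

lemma tendsto_unit_label (hα : 0 < α) (hΔ : 0 < Δ) (h0 : 0 ≤ θ) (h1 : θ ≤ 1 / 2) (hz : 0 < z) :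
    Tendsto (fun x => unitVec x ⬝ᵥ resolvent (kernel Δ x) z *ᵥ labelVec x)
      (limitFilter α θ) (𝓝 0) := by
  have h := tendsto_kernel_form hα hΔ h0 h1 hz measurable_unitCoord measurable_labelCoord
    (memLp_unitCoord h0 h1) (memLp_labelCoord h0 h1) (integral_unit_label h0 h1)
    (integral_unit_signal h0 h1) (integral_signal_label h0 h1)
  convert h using 2
  ring

lemma tendsto_unit_unit (hα : 0 < α) (hΔ : 0 < Δ) (h0 : 0 ≤ θ) (h1 : θ ≤ 1 / 2) (hz : 0 < z) :
    Tendsto (fun x => unitVec x ⬝ᵥ resolvent (kernel Δ x) z *ᵥ unitVec x)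
      (limitFilter α θ) (𝓝 (α * stieltjes α Δ z)) := by
  have h := tendsto_kernel_form hα hΔ h0 h1 hz measurable_unitCoord measurable_unitCoord
    (memLp_unitCoord h0 h1) (memLp_unitCoord h0 h1) (integral_unit_unit h0 h1)
    (integral_unit_signal h0 h1)
    (e₂ := 0) (by rw [← integral_unit_signal (Δ := Δ) h0 h1]; simp only [mul_comm])
  convert h using 2
  ring

/-- The squared lengths of the three vectors converge. -/
lemma tendsto_signal_sq (hΔ : 0 < Δ) (h0 : 0 ≤ θ) (h1 : θ ≤ 1 / 2) :
    Tendsto (fun x => signalVec Δ x ⬝ᵥ signalVec Δ x) (limitFilter α θ) (𝓝 (α * (1 + Δ))) := by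
  have h := tendsto_cellVec_dotProduct (α := α) h0 h1 (measurable_signalCoord Δ)
    (measurable_signalCoord Δ) (memLp_signalCoord h0 h1) (memLp_signalCoord h0 h1)
  rwa [integral_signal_signal hΔ h0 h1] at h

lemma tendsto_label_sq (h0 : 0 ≤ θ) (h1 : θ ≤ 1 / 2) :
    Tendsto (fun x => labelVec x ⬝ᵥ labelVec x) (limitFilter α θ) (𝓝 α) := by
  have h := tendsto_cellVec_dotProduct (α := α) h0 h1 measurable_labelCoord
    measurable_labelCoord (memLp_labelCoord h0 h1) (memLp_labelCoord h0 h1)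
  rwa [integral_label_label h0 h1, mul_one] at h

lemma tendsto_unit_sq (h0 : 0 ≤ θ) (h1 : θ ≤ 1 / 2) :
    Tendsto (fun x => unitVec x ⬝ᵥ unitVec x) (limitFilter α θ) (𝓝 α) := by
  have h := tendsto_cellVec_dotProduct (α := α) h0 h1 measurable_unitCoord
    measurable_unitCoord (memLp_unitCoord h0 h1) (memLp_unitCoord h0 h1)
  rwa [integral_unit_unit h0 h1, mul_one] at h

end KernelForms

section SpectralFunctional

variable {Ω : Type*} {F : Filter Ω} {L : (ℝ → ℝ) → Ω → ℝ}

/-- A family of linear functionals, controlled by the supremum norm on the half-line. -/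
structure IsSpectral (F : Filter Ω) (L : (ℝ → ℝ) → Ω → ℝ) : Prop where
  add : ∀ φ ψ x, L (fun t => φ t + ψ t) x = L φ x + L ψ x
  const_mul : ∀ c φ x, L (fun t => c * φ t) x = c * L φ x
  bound : ∃ (b : Ω → ℝ) (β : ℝ), (∀ x, 0 ≤ b x) ∧ Tendsto b F (𝓝 β) ∧
    ∀ φ C, 0 ≤ C → (∀ t, 0 ≤ t → |φ t| ≤ C) → ∀ x, |L φ x| ≤ C * b x

namespace IsSpectral

lemma sub (hL : IsSpectral F L) (φ ψ : ℝ → ℝ) (x : Ω) :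
    L (fun t => φ t - ψ t) x = L φ x - L ψ x := by
  have e : (fun t => φ t - ψ t) = fun t => φ t + (fun t => (-1) * ψ t) t := by funext t; ring
  rw [e, hL.add, hL.const_mul]; ring

/-- The functions on which the functionals converge are closed under uniform limits. -/
lemma exists_tendsto_of_approx [F.NeBot] (hL : IsSpectral F L) {φ : ℝ → ℝ} {ψ : ℕ → ℝ → ℝ}
    {δ ℓ : ℕ → ℝ} (hδ0 : ∀ n, 0 ≤ δ n) (hδ : Tendsto δ atTop (𝓝 0))
    (hφ : ∀ n t, 0 ≤ t → |φ t - ψ n t| ≤ δ n) (hψ : ∀ n, Tendsto (L (ψ n)) F (𝓝 (ℓ n))) :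
    ∃ a, Tendsto ℓ atTop (𝓝 a) ∧ Tendsto (L φ) F (𝓝 a) := by
  obtain ⟨b, β, hb0, hb, hbound⟩ := hL.bound
  have hβ0 : 0 ≤ β := ge_of_tendsto' hb hb0
  have hdist : ∀ n k, dist (ℓ n) (ℓ k) ≤ (δ n + δ k) * β := by
    intro n k
    have h1 : Tendsto (fun x => |L (ψ n) x - L (ψ k) x|) F (𝓝 |ℓ n - ℓ k|) :=
      ((hψ n).sub (hψ k)).abs
    refine le_of_tendsto_of_tendsto' h1 (hb.const_mul _) fun x => ?_
    rw [← hL.sub]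
    refine hbound _ _ (add_nonneg (hδ0 n) (hδ0 k)) (fun t ht => ?_) x
    have e : ψ n t - ψ k t = (φ t - ψ k t) - (φ t - ψ n t) := by ring
    rw [e]
    exact (abs_sub _ _).trans (by linarith [hφ n t ht, hφ k t ht])
  have hcauchy : CauchySeq ℓ := by
    rw [Metric.cauchySeq_iff]
    intro ε hε
    have h' := (hδ.mul_const β).eventually (gt_mem_nhds (a := ε / 2) (by simpa using half_pos hε))
    obtain ⟨n₀, hn₀⟩ := eventually_atTop.1 h'
    refine ⟨n₀, fun n hn k hk => (hdist n k).trans_lt ?_⟩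
    have := hn₀ n hn
    have := hn₀ k hk
    linarith
  obtain ⟨a, ha⟩ := cauchySeq_tendsto_of_complete hcauchy
  refine ⟨a, ha, ?_⟩
  rw [Metric.tendsto_nhds]
  intro ε hε
  have h1 := (hδ.mul_const (β + 1)).eventually (gt_mem_nhds (a := ε / 3) (by simpa using by linarith))
  have h2 := Metric.tendsto_nhds.1 ha (ε / 3) (by linarith)
  obtain ⟨n, hn1, hn2⟩ := (h1.and h2).exists
  filter_upwards [Metric.tendsto_nhds.1 (hψ n) (ε / 3) (by linarith),
    hb.eventually (gt_mem_nhds (a := β + 1) (by linarith))] with x hx hbx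
  have h3 : dist (L φ x) (L (ψ n) x) ≤ δ n * (β + 1) := by
    rw [Real.dist_eq, ← hL.sub]
    exact (hbound _ _ (hδ0 n) (hφ n) x).trans (mul_le_mul_of_nonneg_left hbx.le (hδ0 n))
  calc dist (L φ x) a ≤ dist (L φ x) (L (ψ n) x) + dist (L (ψ n) x) (ℓ n) + dist (ℓ n) a :=
        dist_triangle4 _ _ _ _
    _ < ε := by linarith

end IsSpectral

lemma cauchyKernel_nonneg {z t : ℝ} (hz : 0 < z) (ht : 0 ≤ t) : 0 ≤ cauchyKernel z t :=
  inv_nonneg.2 (by positivity)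

lemma cauchyKernel_sub {z w t : ℝ} (hz : 0 < z) (hw : 0 < w) (ht : 0 ≤ t) :
    cauchyKernel z t - cauchyKernel w t = (w - z) * (cauchyKernel z t * cauchyKernel w t) := by
  rw [cauchyKernel, cauchyKernel]
  field_simp
  ring

/-- A finite product of Cauchy kernels. -/
noncomputable def kernelProd (l : List ℝ) (t : ℝ) : ℝ := (l.map fun z => cauchyKernel z t).prod

lemma exists_bound_kernelProd (l : List ℝ) (hl : ∀ z ∈ l, 0 < z) :
    ∃ C, 0 ≤ C ∧ ∀ t, 0 ≤ t → |kernelProd l t| ≤ C := by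
  induction l with
  | nil => exact ⟨1, zero_le_one, fun t _ => by simp [kernelProd]⟩
  | cons z l ih =>
    obtain ⟨C, hC, h⟩ := ih fun w hw => hl w (List.mem_cons_of_mem _ hw)
    have hz := hl z List.mem_cons_self
    refine ⟨z⁻¹ * C, by positivity, fun t ht => ?_⟩
    have e : kernelProd (z :: l) t = cauchyKernel z t * kernelProd l t := by simp [kernelProd]
    rw [e, abs_mul]
    exact mul_le_mul (cauchyKernel_abs_le hz ht) (h t ht) (abs_nonneg _) (by positivity)

lemma kernelProd_cons (z : ℝ) (l : List ℝ) (t : ℝ) :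
    kernelProd (z :: l) t = cauchyKernel z t * kernelProd l t := by simp [kernelProd]

lemma abs_confluent_sub_le {z ε t q C : ℝ} (hz : 0 < z) (hε : 0 < ε) (ht : 0 ≤ t) (hq : |q| ≤ C) :
    |cauchyKernel z t * (cauchyKernel z t * q) - cauchyKernel z t * (cauchyKernel (z + ε) t * q)| ≤
      ε * (z⁻¹ * z⁻¹ * z⁻¹ * C) := by
  have e : cauchyKernel z t * (cauchyKernel z t * q) -
      cauchyKernel z t * (cauchyKernel (z + ε) t * q) =
      ε * (cauchyKernel z t * cauchyKernel z t * cauchyKernel (z + ε) t * q) := by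
    have := cauchyKernel_sub hz (by linarith : 0 < z + ε) ht
    linear_combination cauchyKernel z t * q * this
  have h1 := cauchyKernel_abs_le hz ht
  have h2 : |cauchyKernel (z + ε) t| ≤ z⁻¹ :=
    (cauchyKernel_abs_le (by linarith : 0 < z + ε) ht).trans (inv_anti₀ hz (by linarith))
  rw [e, abs_mul, abs_of_pos hε, abs_mul, abs_mul, abs_mul]
  gcongr

lemma tendsto_one_div_nat_mul (C : ℝ) :
    Tendsto (fun n : ℕ => 1 / ((n : ℝ) + 1) * C) atTop (𝓝 0) := by
  simpa using (tendsto_one_div_add_atTop_nhds_zero_nat (𝕜 := ℝ)).mul_const C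

namespace IsSpectral

/-- If the functionals converge on the Cauchy kernels, they converge on their products. -/
lemma exists_tendsto_kernelProd [F.NeBot] (hL : IsSpectral F L)
    (h : ∀ z, 0 < z → ∃ a, Tendsto (L (cauchyKernel z)) F (𝓝 a)) :
    ∀ l : List ℝ, l ≠ [] → (∀ z ∈ l, 0 < z) → ∃ a, Tendsto (L (kernelProd l)) F (𝓝 a) := by
  have main : ∀ (n : ℕ) (l : List ℝ), l.length = n + 1 → (∀ z ∈ l, 0 < z) →
      ∃ a, Tendsto (L (kernelProd l)) F (𝓝 a) := by
    intro n
    induction n with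
    | zero =>
      intro l hl hpos
      obtain ⟨z, rfl⟩ := List.length_eq_one_iff.1 hl
      have e : kernelProd [z] = cauchyKernel z := by funext t; simp [kernelProd]
      rw [e]
      exact h z (hpos z (by simp))
    | succ n ih =>
      have hne : ∀ z w l, l.length = n → z ≠ w → (∀ y ∈ z :: w :: l, 0 < y) →
          ∃ a, Tendsto (L (kernelProd (z :: w :: l))) F (𝓝 a) := by
        intro z w l hl hzw hpos
        have hz : 0 < z := hpos z (by simp)
        have hw : 0 < w := hpos w (by simp)
        obtain ⟨a, ha⟩ := ih (z :: l) (by simp [hl]) fun y hy => hpos y (by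
          rcases List.mem_cons.1 hy with rfl | hy <;> simp [*])
        obtain ⟨b, hb⟩ := ih (w :: l) (by simp [hl]) fun y hy => hpos y (by
          rcases List.mem_cons.1 hy with rfl | hy <;> simp [*])
        refine ⟨(w - z)⁻¹ * (a - b), ?_⟩
        have hlim := (ha.sub hb).const_mul (w - z)⁻¹
        obtain ⟨bb, β, hb0, hbt, hbound⟩ := hL.bound
        refine hlim.congr fun x => ?_
        rw [← hL.sub, ← hL.const_mul, ← sub_eq_zero, ← hL.sub]
        have hz0 := hbound (fun t => (w - z)⁻¹ * (kernelProd (z :: l) t - kernelProd (w :: l) t) -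
          kernelProd (z :: w :: l) t) 0 le_rfl (fun t ht => by
            have hs := cauchyKernel_sub hz hw ht
            have hwz : w - z ≠ 0 := sub_ne_zero.2 hzw.symm
            simp only [kernelProd_cons]
            rw [← sub_mul, hs, abs_nonpos_iff]
            field_simp
            ring) x
        rw [zero_mul] at hz0
        exact abs_nonpos_iff.1 hz0
      intro l hl hpos
      obtain ⟨z, l₁, rfl⟩ : ∃ z l₁, l = z :: l₁ := by
        cases l with
        | nil => simp at hl
        | cons z l₁ => exact ⟨z, l₁, rfl⟩
      obtain ⟨w, l₂, rfl⟩ : ∃ w l₂, l₁ = w :: l₂ := by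
        cases l₁ with
        | nil => simp at hl
        | cons w l₂ => exact ⟨w, l₂, rfl⟩
      have hl₂ : l₂.length = n := by simpa using hl
      by_cases hzw : z = w
      · subst hzw
        have hz : 0 < z := hpos z (by simp)
        obtain ⟨C, hC, hCb⟩ := exists_bound_kernelProd l₂ fun y hy => hpos y (by simp [hy])
        have hex : ∀ k : ℕ, ∃ a, Tendsto (L (kernelProd (z :: (z + 1 / ((k : ℝ) + 1)) :: l₂))) F
            (𝓝 a) := by
          intro k
          have hk : (0 : ℝ) < 1 / ((k : ℝ) + 1) := by positivity
          refine hne z _ l₂ hl₂ (by linarith) fun y hy => ?_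
          simp only [List.mem_cons] at hy
          rcases hy with rfl | rfl | hy
          · exact hz
          · linarith
          · exact hpos y (by simp [hy])
        choose ℓ hℓ using hex
        obtain ⟨a, -, ha⟩ := hL.exists_tendsto_of_approx (φ := kernelProd (z :: z :: l₂))
          (δ := fun k : ℕ => 1 / ((k : ℝ) + 1) * (z⁻¹ * z⁻¹ * z⁻¹ * C))
          (fun k => by positivity) (tendsto_one_div_nat_mul _)
          (fun k t ht => by
            simp only [kernelProd_cons]
            exact abs_confluent_sub_le hz (by positivity) ht (hCb t ht)) hℓ
        exact ⟨a, ha⟩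
      · exact hne z w l₂ hl₂ hzw hpos
  intro l hl hpos
  obtain ⟨n, hn⟩ := Nat.exists_eq_succ_of_ne_zero (mt List.length_eq_zero_iff.1 hl)
  exact main n l hn hpos

/-- The limit of the functionals on a product of two Cauchy kernels is a divided difference. -/
lemma tendsto_kernel_mul_kernel [F.NeBot] (hL : IsSpectral F L) {H : ℝ → ℝ} {H₂ : ℝ → ℝ → ℝ}
    (hH : ∀ z, 0 < z → Tendsto (L (cauchyKernel z)) F (𝓝 (H z)))
    (hdiff : ∀ z w, 0 < z → 0 < w → H z - H w = (w - z) * H₂ z w)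
    (hcont : ∀ z, 0 < z → ContinuousAt (H₂ z) z) {z w : ℝ} (hz : 0 < z) (hw : 0 < w) :
    Tendsto (L fun t => cauchyKernel z t * cauchyKernel w t) F (𝓝 (H₂ z w)) := by
  have hne : ∀ z w, 0 < z → 0 < w → z ≠ w →
      Tendsto (L fun t => cauchyKernel z t * cauchyKernel w t) F (𝓝 (H₂ z w)) := by
    intro z w hz hw hzw
    have hwz : w - z ≠ 0 := sub_ne_zero.2 hzw.symm
    have hlim := ((hH z hz).sub (hH w hw)).const_mul (w - z)⁻¹
    rw [hdiff z w hz hw, inv_mul_cancel_left₀ hwz] at hlim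
    obtain ⟨bb, β, hb0, hbt, hbound⟩ := hL.bound
    refine hlim.congr fun x => ?_
    rw [← hL.sub, ← hL.const_mul, ← sub_eq_zero, ← hL.sub]
    have hz0 := hbound (fun t => (w - z)⁻¹ * (cauchyKernel z t - cauchyKernel w t) -
      cauchyKernel z t * cauchyKernel w t) 0 le_rfl (fun t ht => by
        rw [cauchyKernel_sub hz hw ht, inv_mul_cancel_left₀ hwz]; simp) x
    rw [zero_mul] at hz0
    exact abs_nonpos_iff.1 hz0
  by_cases hzw : z = w
  · subst hzw
    obtain ⟨a, ha, hlim⟩ := hL.exists_tendsto_of_approx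
      (φ := fun t => cauchyKernel z t * cauchyKernel z t)
      (ψ := fun (k : ℕ) t => cauchyKernel z t * cauchyKernel (z + 1 / ((k : ℝ) + 1)) t)
      (δ := fun k : ℕ => 1 / ((k : ℝ) + 1) * (z⁻¹ * z⁻¹ * z⁻¹ * 1))
      (ℓ := fun k : ℕ => H₂ z (z + 1 / ((k : ℝ) + 1)))
      (fun k => by positivity) (tendsto_one_div_nat_mul _)
      (fun k t ht => by
        have := abs_confluent_sub_le (q := 1) (C := 1) hz
          (by positivity : (0 : ℝ) < 1 / ((k : ℝ) + 1)) ht (by simp)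
        simpa only [mul_one] using this)
      (fun k => hne _ _ hz (by positivity) (by
        have : (0 : ℝ) < 1 / ((k : ℝ) + 1) := by positivity
        linarith))
    have hseq : Tendsto (fun k : ℕ => z + 1 / ((k : ℝ) + 1)) atTop (𝓝 z) := by
      simpa using (tendsto_one_div_add_atTop_nhds_zero_nat (𝕜 := ℝ)).const_add z
    rw [tendsto_nhds_unique ha ((hcont z hz).tendsto.comp hseq)] at hlim
    exact hlim
  · exact hne z w hz hw hzw

end IsSpectral

end SpectralFunctional

section Scalar

variable {α Δ θ z w : ℝ}

lemma stieltjes_poly (hα : 0 < α) (hΔ : 0 < Δ) (hz : 0 < z) :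
    z * stieltjes α Δ z * (1 + α * Δ * stieltjes α Δ z) =
      1 + α * Δ * stieltjes α Δ z - Δ * stieltjes α Δ z := by
  have h := stieltjes_eq hα hΔ hz
  have := stieltjes_pos hα hΔ hz
  field_simp at h
  linear_combination h

lemma stieltjes_scaled_lt (hα : 0 < α) (hΔ : 0 < Δ) (hz : 0 < z) :
    Δ * stieltjes α Δ z < 1 + α * Δ * stieltjes α Δ z := by
  have h := stieltjes_poly hα hΔ hz
  have := stieltjes_pos hα hΔ hz
  have : 0 < z * stieltjes α Δ z * (1 + α * Δ * stieltjes α Δ z) := by positivity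
  linarith

lemma stieltjes_mul_lt_one (hα : 0 < α) (hΔ : 0 < Δ) (hz : 0 < z) : z * stieltjes α Δ z < 1 := by
  have h := stieltjes_eq hα hΔ hz
  have := stieltjes_pos hα hΔ hz
  have : 0 < Δ * stieltjes α Δ z / (1 + α * Δ * stieltjes α Δ z) := by positivity
  linarith

lemma continuousAt_stieltjes (hα : 0 < α) (hΔ : 0 < Δ) (hz : 0 < z) :
    ContinuousAt (stieltjes α Δ) z := by
  unfold stieltjes
  refine ContinuousAt.div ?_ (by fun_prop) (by positivity)
  fun_prop

lemma tendsto_stieltjes (hα : 0 < α) (hΔ : 0 < Δ) :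
    Tendsto (stieltjes α Δ) atTop (𝓝 0) := by
  refine tendsto_of_tendsto_of_tendsto_of_le_of_le' tendsto_const_nhds tendsto_inv_atTop_zero ?_ ?_
  · filter_upwards [eventually_gt_atTop 0] with z hz using (stieltjes_pos hα hΔ hz).le
  · filter_upwards [eventually_gt_atTop 0] with z hz
    rw [← one_div, le_div_iff₀ hz, mul_comm]
    exact (stieltjes_mul_lt_one hα hΔ hz).le

lemma stieltjes_den_pos (hα : 0 < α) (hΔ : 0 < Δ) (hz : 0 < z) (hw : 0 < w) :
    0 < (1 + α * Δ * stieltjes α Δ z) * (1 + α * Δ * stieltjes α Δ w) -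
      α * Δ ^ 2 * stieltjes α Δ z * stieltjes α Δ w := by
  have h1 := stieltjes_scaled_lt hα hΔ hz
  have h3 := stieltjes_pos hα hΔ hz
  have h4 := stieltjes_pos hα hΔ hw
  have h5 : 0 < α * Δ * stieltjes α Δ w := by positivity
  nlinarith [mul_pos (sub_pos.2 h1) h5]

/-- The negative of the divided difference of the Stieltjes transform. -/
noncomputable def stieltjes₂ (α Δ z w : ℝ) : ℝ :=
  stieltjes α Δ z * stieltjes α Δ w *
    ((1 + α * Δ * stieltjes α Δ z) * (1 + α * Δ * stieltjes α Δ w)) /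
    ((1 + α * Δ * stieltjes α Δ z) * (1 + α * Δ * stieltjes α Δ w) -
      α * Δ ^ 2 * stieltjes α Δ z * stieltjes α Δ w)

lemma stieltjes_sub (hα : 0 < α) (hΔ : 0 < Δ) (hz : 0 < z) (hw : 0 < w) :
    stieltjes α Δ z - stieltjes α Δ w = (w - z) * stieltjes₂ α Δ z w := by
  have hd := stieltjes_den_pos hα hΔ hz hw
  have pz := stieltjes_poly hα hΔ hz
  have pw := stieltjes_poly hα hΔ hw
  rw [stieltjes₂, ← mul_div_assoc, eq_div_iff hd.ne']
  set g := stieltjes α Δ z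
  set k := stieltjes α Δ w
  linear_combination k * (1 + α * Δ * k) * pz - g * (1 + α * Δ * g) * pw

lemma continuousAt_stieltjes₂ (hα : 0 < α) (hΔ : 0 < Δ) (hz : 0 < z) :
    ContinuousAt (stieltjes₂ α Δ z) z := by
  have hc := continuousAt_stieltjes hα hΔ hz
  unfold stieltjes₂
  refine ContinuousAt.div (by fun_prop) (by fun_prop) (stieltjes_den_pos hα hΔ hz hz).ne'

noncomputable def alignment₂ (α Δ θ z w : ℝ) : ℝ :=
  (1 - 2 * θ) * α * stieltjes₂ α Δ z w /
    ((1 + α * (1 + Δ) * stieltjes α Δ z) * (1 + α * (1 + Δ) * stieltjes α Δ w))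

lemma alignment_sub (hα : 0 < α) (hΔ : 0 < Δ) (hz : 0 < z) (hw : 0 < w) :
    alignment α Δ θ z - alignment α Δ θ w = (w - z) * alignment₂ α Δ θ z w := by
  have h := stieltjes_sub hα hΔ hz hw
  have h3 := stieltjes_pos hα hΔ hz
  have h4 := stieltjes_pos hα hΔ hw
  rw [alignment, alignment, alignment₂]
  field_simp
  linear_combination (1 - 2 * θ) * h

lemma continuousAt_alignment₂ (hα : 0 < α) (hΔ : 0 < Δ) (hz : 0 < z) :
    ContinuousAt (alignment₂ α Δ θ z) z := by
  have hc := continuousAt_stieltjes hα hΔ hz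
  have hc₂ := continuousAt_stieltjes₂ hα hΔ hz
  have h3 := stieltjes_pos hα hΔ hz
  unfold alignment₂
  exact ContinuousAt.div (by fun_prop) (by fun_prop) (by positivity)

noncomputable def labelEnergy₂ (α Δ θ z w : ℝ) : ℝ :=
  stieltjes₂ α Δ z w * (α - (1 - 2 * θ) ^ 2 * α ^ 2 * (stieltjes α Δ z + stieltjes α Δ w +
    α * (1 + Δ) * stieltjes α Δ z * stieltjes α Δ w) /
    ((1 + α * (1 + Δ) * stieltjes α Δ z) * (1 + α * (1 + Δ) * stieltjes α Δ w)))

lemma labelEnergy_sub (hα : 0 < α) (hΔ : 0 < Δ) (hz : 0 < z) (hw : 0 < w) :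
    labelEnergy α Δ θ z - labelEnergy α Δ θ w = (w - z) * labelEnergy₂ α Δ θ z w := by
  have h := stieltjes_sub hα hΔ hz hw
  have h3 := stieltjes_pos hα hΔ hz
  have h4 := stieltjes_pos hα hΔ hw
  rw [labelEnergy, labelEnergy, labelEnergy₂, ← mul_assoc, ← h]
  field_simp
  ring

lemma continuousAt_labelEnergy₂ (hα : 0 < α) (hΔ : 0 < Δ) (hz : 0 < z) :
    ContinuousAt (labelEnergy₂ α Δ θ z) z := by
  have hc := continuousAt_stieltjes hα hΔ hz
  have hc₂ := continuousAt_stieltjes₂ hα hΔ hz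
  have h3 := stieltjes_pos hα hΔ hz
  unfold labelEnergy₂
  refine hc₂.mul (continuousAt_const.sub (ContinuousAt.div (by fun_prop) (by fun_prop) ?_))
  positivity

/-- The limit of the squared length of the stage-`0` weights. -/
noncomputable def weightSq (α Δ θ z : ℝ) : ℝ := labelEnergy α Δ θ z - z * labelEnergy₂ α Δ θ z z

/-- The part of `weightSq` orthogonal to the class mean, divided by the square of the Stieltjes
transform. -/
noncomputable def residualSq (α Δ θ g : ℝ) : ℝ :=
  Δ / ((1 + α * Δ * g) * (1 + α * Δ * g) - α * Δ ^ 2 * g * g) *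
    (α - (1 - 2 * θ) ^ 2 * α ^ 2 * (g + g + α * (1 + Δ) * g * g) /
      ((1 + α * (1 + Δ) * g) * (1 + α * (1 + Δ) * g)))

lemma weightSq_eq (hα : 0 < α) (hΔ : 0 < Δ) (hz : 0 < z) :
    weightSq α Δ θ z = alignment α Δ θ z ^ 2 +
      stieltjes α Δ z ^ 2 * residualSq α Δ θ (stieltjes α Δ z) := by
  have hd := stieltjes_den_pos hα hΔ hz hz
  have hp := stieltjes_poly hα hΔ hz
  have h3 := stieltjes_pos hα hΔ hz
  rw [weightSq, labelEnergy, labelEnergy₂, alignment, residualSq]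
  have hz2 : z * stieltjes₂ α Δ z z = stieltjes α Δ z - stieltjes α Δ z ^ 2 * (Δ /
      ((1 + α * Δ * stieltjes α Δ z) * (1 + α * Δ * stieltjes α Δ z) -
        α * Δ ^ 2 * stieltjes α Δ z * stieltjes α Δ z)) := by
    rw [stieltjes₂, ← mul_div_assoc, ← mul_div_assoc, div_eq_iff hd.ne', sub_mul,
      div_mul_cancel₀ _ hd.ne']
    linear_combination stieltjes α Δ z * (1 + α * Δ * stieltjes α Δ z) * hp
  rw [← mul_assoc, hz2, sub_mul]
  set q := Δ / ((1 + α * Δ * stieltjes α Δ z) * (1 + α * Δ * stieltjes α Δ z) -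
        α * Δ ^ 2 * stieltjes α Δ z * stieltjes α Δ z)
  set g := stieltjes α Δ z
  field_simp
  ring

/-- The residual is at least its value at infinite regularization. -/
lemma residualSq_ge (hα : 0 < α) (hΔ : 0 < Δ) (hz : 0 < z) (h0 : 0 ≤ θ) (h1 : θ ≤ 1 / 2) :
    α * Δ / (1 + α * (1 + Δ) * stieltjes α Δ z) ^ 2 ≤ residualSq α Δ θ (stieltjes α Δ z) := by
  have hd := stieltjes_den_pos hα hΔ hz hz
  have h3 := stieltjes_pos hα hΔ hz
  rw [residualSq]
  set g := stieltjes α Δ z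
  have hc : (1 - 2 * θ) ^ 2 ≤ 1 := by nlinarith
  have e : Δ / ((1 + α * Δ * g) * (1 + α * Δ * g) - α * Δ ^ 2 * g * g) *
      (α - (1 - 2 * θ) ^ 2 * α ^ 2 * (g + g + α * (1 + Δ) * g * g) /
      ((1 + α * (1 + Δ) * g) * (1 + α * (1 + Δ) * g))) =
      α * Δ / (1 + α * (1 + Δ) * g) ^ 2 * (((1 + α * (1 + Δ) * g) ^ 2 -
        (1 - 2 * θ) ^ 2 * α * (g + g + α * (1 + Δ) * g * g)) /
        ((1 + α * Δ * g) * (1 + α * Δ * g) - α * Δ ^ 2 * g * g)) := by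
    field_simp
  rw [e]
  refine le_mul_of_one_le_right (by positivity) ((one_le_div hd).2 ?_)
  have hx : 0 ≤ α * (g + g + α * (1 + Δ) * g * g) := by positivity
  have hy : 0 ≤ α ^ 2 * Δ * g ^ 2 + α * Δ ^ 2 * g ^ 2 := by positivity
  nlinarith [mul_le_mul_of_nonneg_right hc hx]

lemma weightSq_pos (hα : 0 < α) (hΔ : 0 < Δ) (hz : 0 < z) (h0 : 0 ≤ θ) (h1 : θ ≤ 1 / 2) :
    0 < weightSq α Δ θ z := by
  have h3 := stieltjes_pos hα hΔ hz
  have h := residualSq_ge hα hΔ hz h0 h1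
  have : 0 < α * Δ / (1 + α * (1 + Δ) * stieltjes α Δ z) ^ 2 := by positivity
  rw [weightSq_eq hα hΔ hz]
  have : 0 < residualSq α Δ θ (stieltjes α Δ z) := by linarith
  positivity

/-- The signal-to-noise ratio of stage `0` is maximal at infinite regularization. -/
lemma alignment_ratio_le (hα : 0 < α) (hΔ : 0 < Δ) (hz : 0 < z) (h0 : 0 ≤ θ) (h1 : θ ≤ 1 / 2) :
    alignment α Δ θ z / (√Δ * √(weightSq α Δ θ z)) ≤
      √α * (1 - 2 * θ) / √(Δ * (Δ + α * (1 - 2 * θ) ^ 2)) := by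
  have h3 := stieltjes_pos hα hΔ hz
  have hc : 0 ≤ 1 - 2 * θ := by linarith
  have hW := weightSq_pos hα hΔ hz h0 h1
  have hA : 0 ≤ alignment α Δ θ z := by rw [alignment]; positivity
  rw [← Real.sqrt_mul hΔ.le]
  refine (sq_le_sq₀ (by positivity) (by positivity)).1 ?_
  rw [div_pow, div_pow, mul_pow, Real.sq_sqrt hα.le, Real.sq_sqrt (by positivity),
    Real.sq_sqrt (by positivity), div_le_div_iff₀ (by positivity) (by positivity),
    weightSq_eq hα hΔ hz]
  have h := residualSq_ge hα hΔ hz h0 h1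
  have hA2 : alignment α Δ θ z ^ 2 = (1 - 2 * θ) ^ 2 * α * (stieltjes α Δ z ^ 2 *
      (α / (1 + α * (1 + Δ) * stieltjes α Δ z) ^ 2)) := by
    rw [alignment]; field_simp
  have e : α * Δ / (1 + α * (1 + Δ) * stieltjes α Δ z) ^ 2 =
    Δ * (α / (1 + α * (1 + Δ) * stieltjes α Δ z) ^ 2) := by ring
  rw [e] at h
  rw [hA2]
  set r := residualSq α Δ θ (stieltjes α Δ z)
  set q := α / (1 + α * (1 + Δ) * stieltjes α Δ z) ^ 2
  set g := stieltjes α Δ z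
  have hk : 0 ≤ Δ * ((1 - 2 * θ) ^ 2 * α) * g ^ 2 := by positivity
  nlinarith [mul_le_mul_of_nonneg_left h hk]

lemma tendsto_alignment_ratio (hα : 0 < α) (hΔ : 0 < Δ) :
    Tendsto (fun z => alignment α Δ θ z / (√Δ * √(weightSq α Δ θ z))) atTop
      (𝓝 (√α * (1 - 2 * θ) / √(Δ * (Δ + α * (1 - 2 * θ) ^ 2)))) := by
  have hg := tendsto_stieltjes hα hΔ
  set f : ℝ → ℝ := fun g => (1 - 2 * θ) * α / (1 + α * (1 + Δ) * g) with hf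
  have hfc : ContinuousAt f 0 := by
    rw [hf]
    exact ContinuousAt.div (by fun_prop) (by fun_prop) (by simp)
  have hrc : ContinuousAt (residualSq α Δ θ) 0 := by
    unfold residualSq
    refine ContinuousAt.mul (ContinuousAt.div (by fun_prop) (by fun_prop) (by simp))
      (continuousAt_const.sub (ContinuousAt.div (by fun_prop) (by fun_prop) (by simp)))
  have hcont : ContinuousAt (fun g => f g / (√Δ * √(f g ^ 2 + residualSq α Δ θ g))) 0 := by
    refine ContinuousAt.div hfc (continuousAt_const.mul
      ((hfc.pow 2).add hrc).sqrt) ?_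
    have : 0 < f 0 ^ 2 + residualSq α Δ θ 0 := by
      have : residualSq α Δ θ 0 = Δ * α := by simp [residualSq]
      rw [this]; positivity
    positivity
  have hlim := hcont.tendsto.comp hg
  have hval : f 0 / (√Δ * √(f 0 ^ 2 + residualSq α Δ θ 0)) =
      √α * (1 - 2 * θ) / √(Δ * (Δ + α * (1 - 2 * θ) ^ 2)) := by
    have e : residualSq α Δ θ 0 = Δ * α := by simp [residualSq]
    have e2 : f 0 = (1 - 2 * θ) * α := by simp [hf]
    rw [e, e2, ← Real.sqrt_mul hΔ.le,
      show Δ * (((1 - 2 * θ) * α) ^ 2 + Δ * α) = α * (Δ * (Δ + α * (1 - 2 * θ) ^ 2)) by ring,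
      Real.sqrt_mul hα.le]
    have hs : √α ≠ 0 := by positivity
    have hs2 : √(Δ * (Δ + α * (1 - 2 * θ) ^ 2)) ≠ 0 := by positivity
    field_simp
    rw [Real.sq_sqrt hα.le]
  rw [hval] at hlim
  refine hlim.congr' ?_
  filter_upwards [eventually_gt_atTop 0] with z hz
  have h3 := stieltjes_pos hα hΔ hz
  simp only [Function.comp]
  rw [weightSq_eq hα hΔ hz]
  have eA : alignment α Δ θ z = stieltjes α Δ z * f (stieltjes α Δ z) := by
    rw [alignment, hf]; ring
  rw [eA, mul_pow, ← mul_add, Real.sqrt_mul (sq_nonneg _), Real.sqrt_sq h3.le]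
  field_simp

end Scalar

section ScalarDistilled

variable {α Δ θ z w : ℝ}

lemma tendsto_mul_stieltjes (hα : 0 < α) (hΔ : 0 < Δ) :
    Tendsto (fun z => z * stieltjes α Δ z) atTop (𝓝 1) := by
  have hg := tendsto_stieltjes hα hΔ
  have hc : ContinuousAt (fun g : ℝ => 1 - Δ * g / (1 + α * Δ * g)) 0 :=
    continuousAt_const.sub (ContinuousAt.div (by fun_prop) (by fun_prop) (by simp))
  have h := hc.tendsto.comp hg
  simp only [mul_zero, zero_div, sub_zero] at h
  refine h.congr' ?_
  filter_upwards [eventually_gt_atTop 0] with z hz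
  have := stieltjes_eq hα hΔ hz
  simp only [Function.comp]
  linarith

/-- The limit of `a · K (K + z)⁻¹ (K + w)⁻¹ h`. -/
noncomputable def distilledAlignment (α Δ θ z w : ℝ) : ℝ :=
  alignment α Δ θ w - z * alignment₂ α Δ θ z w

lemma distilledAlignment_eq (hα : 0 < α) (hΔ : 0 < Δ) (hz : 0 < z) (hw : 0 < w) :
    distilledAlignment α Δ θ z w = stieltjes α Δ z * stieltjes α Δ w *
      ((1 - 2 * θ) * α * (α * (1 + Δ) * (1 + α * Δ * stieltjes α Δ z) *
        (1 + α * Δ * stieltjes α Δ w) - (1 + α * (1 + Δ) * stieltjes α Δ z) * (α * Δ ^ 2) *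
        stieltjes α Δ w + Δ * (1 + α * Δ * stieltjes α Δ w)) /
      ((1 + α * (1 + Δ) * stieltjes α Δ z) * (1 + α * (1 + Δ) * stieltjes α Δ w) *
        ((1 + α * Δ * stieltjes α Δ z) * (1 + α * Δ * stieltjes α Δ w) -
          α * Δ ^ 2 * stieltjes α Δ z * stieltjes α Δ w))) := by
  have hd := (stieltjes_den_pos hα hΔ hz hw).ne'
  have hp := stieltjes_poly hα hΔ hz
  have h3 := stieltjes_pos hα hΔ hz
  have h4 := stieltjes_pos hα hΔ hw
  have hz2 : z * stieltjes₂ α Δ z w = (1 + α * Δ * stieltjes α Δ z - Δ * stieltjes α Δ z) *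
      stieltjes α Δ w * (1 + α * Δ * stieltjes α Δ w) /
      ((1 + α * Δ * stieltjes α Δ z) * (1 + α * Δ * stieltjes α Δ w) -
        α * Δ ^ 2 * stieltjes α Δ z * stieltjes α Δ w) := by
    rw [stieltjes₂, ← hp]; ring
  have e : z * alignment₂ α Δ θ z w = (1 - 2 * θ) * α * (z * stieltjes₂ α Δ z w) /
    ((1 + α * (1 + Δ) * stieltjes α Δ z) * (1 + α * (1 + Δ) * stieltjes α Δ w)) := by
    rw [alignment₂]; ring
  rw [distilledAlignment, e, hz2, alignment]
  obtain ⟨d, hdd⟩ : ∃ d, d = (1 + α * Δ * stieltjes α Δ z) * (1 + α * Δ * stieltjes α Δ w) -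
    α * Δ ^ 2 * stieltjes α Δ z * stieltjes α Δ w := ⟨_, rfl⟩
  rw [← hdd] at hd ⊢
  field_simp
  rw [hdd]
  ring

lemma tendsto_distilledAlignment (hα : 0 < α) (hΔ : 0 < Δ) :
    Tendsto (fun l : ℝ × ℝ => l.1 * l.2 * distilledAlignment α Δ θ l.1 l.2) (atTop ×ˢ atTop)
      (𝓝 (α * (Δ + α + Δ * α) * (1 - 2 * θ))) := by
  have g₁ : Tendsto (fun l : ℝ × ℝ => stieltjes α Δ l.1) (atTop ×ˢ atTop) (𝓝 0) :=
    (tendsto_stieltjes hα hΔ).comp tendsto_fst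
  have g₂ : Tendsto (fun l : ℝ × ℝ => stieltjes α Δ l.2) (atTop ×ˢ atTop) (𝓝 0) :=
    (tendsto_stieltjes hα hΔ).comp tendsto_snd
  have s₁ : Tendsto (fun l : ℝ × ℝ => l.1 * stieltjes α Δ l.1) (atTop ×ˢ atTop) (𝓝 1) :=
    (tendsto_mul_stieltjes hα hΔ).comp tendsto_fst
  have s₂ : Tendsto (fun l : ℝ × ℝ => l.2 * stieltjes α Δ l.2) (atTop ×ˢ atTop) (𝓝 1) :=
    (tendsto_mul_stieltjes hα hΔ).comp tendsto_snd
  set q : ℝ × ℝ → ℝ := fun g => (1 - 2 * θ) * α * (α * (1 + Δ) * (1 + α * Δ * g.1) *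
        (1 + α * Δ * g.2) - (1 + α * (1 + Δ) * g.1) * (α * Δ ^ 2) *
        g.2 + Δ * (1 + α * Δ * g.2)) /
      ((1 + α * (1 + Δ) * g.1) * (1 + α * (1 + Δ) * g.2) *
        ((1 + α * Δ * g.1) * (1 + α * Δ * g.2) - α * Δ ^ 2 * g.1 * g.2)) with hq
  have hqc : ContinuousAt q (0, 0) := by
    rw [hq]
    exact ContinuousAt.div (by fun_prop) (by fun_prop) (by simp)
  have hql := hqc.tendsto.comp (g₁.prodMk_nhds g₂)
  have h := (s₁.mul s₂).mul hql
  have hval : (1 : ℝ) * 1 * q (0, 0) = α * (Δ + α + Δ * α) * (1 - 2 * θ) := by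
    simp [hq]; ring
  rw [hval] at h
  refine h.congr' ?_
  have hpos : ∀ᶠ l : ℝ × ℝ in atTop ×ˢ atTop, 0 < l.1 ∧ 0 < l.2 :=
    (eventually_gt_atTop 0).prod_mk (eventually_gt_atTop 0)
  filter_upwards [hpos] with l hl
  rw [distilledAlignment_eq hα hΔ hl.1 hl.2]
  simp only [Function.comp, hq]
  ring

/-- The remainder of the expansion of the Stieltjes transform at infinity. -/
noncomputable def momentTail (a Δ g : ℝ) : ℝ :=
  Δ * (1 - Δ * g / (1 + a * g)) * ((1 + a * g) * (a ^ 2 + 3 * a * Δ + a ^ 2 * (a + Δ) * g) + Δ ^ 2) /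
    (1 + a * g) ^ 3

/-- The remainder of the expansion of the rank-one correction at infinity. -/
noncomputable def spikeTail (a b Δ g : ℝ) : ℝ :=
  (1 - Δ * g / (1 + a * g)) * (-2 * a * (Δ / (1 + a * g)) - 3 * (Δ / (1 + a * g)) ^ 2 -
    b * (Δ / (1 + a * g)) + (Δ / (1 + a * g)) ^ 3 * g - b * (2 * Δ + b)) / (1 + b * g)

lemma moment_expansion {a Δ g z : ℝ} (hg : 0 < g) (ha : 0 < a)
    (h : z * g * (1 + a * g) = 1 + a * g - Δ * g) :
    z ^ 4 * g = z ^ 3 - Δ * z ^ 2 + Δ * (a + Δ) * z - momentTail a Δ g := by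
  have hD : 1 + a * g ≠ 0 := by positivity
  have hz : z = (1 + a * g - Δ * g) / (g * (1 + a * g)) := by
    field_simp; linear_combination h
  have e1 : z * (1 - z * g) = Δ * (1 - Δ * g / (1 + a * g)) / (1 + a * g) := by
    rw [hz]; field_simp; ring
  have e2 : z * (Δ - Δ * (1 - Δ * g / (1 + a * g)) / (1 + a * g)) =
      Δ * (1 - Δ * g / (1 + a * g)) * (a * (1 + a * g) + Δ) / (1 + a * g) ^ 2 := by
    rw [hz]; field_simp; ring
  have e3 : z * (Δ * (a + Δ) - Δ * (1 - Δ * g / (1 + a * g)) * (a * (1 + a * g) + Δ) /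
      (1 + a * g) ^ 2) = momentTail a Δ g := by
    rw [hz, momentTail]; field_simp; ring
  rw [← e3, ← e2, ← e1]
  ring

lemma spike_expansion {a b Δ g z : ℝ} (hg : 0 < g) (ha : 0 < a) (hb : 0 < b)
    (h : z * g * (1 + a * g) = 1 + a * g - Δ * g) :
    z ^ 4 * (g ^ 2 / (1 + b * g)) = z ^ 2 - (2 * Δ + b) * z - spikeTail a b Δ g := by
  have hD : 1 + a * g ≠ 0 := by positivity
  have hB : 1 + b * g ≠ 0 := by positivity
  set e := Δ / (1 + a * g) with he
  have hzg : z * g = 1 - e * g := by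
    rw [he]; field_simp; linear_combination h
  have hz : z = (1 - e * g) / g := by field_simp; linear_combination hzg
  have heD : e * (1 + a * g) = Δ := by rw [he]; field_simp
  have e1 : z ^ 2 * (g ^ 2 / (1 + b * g)) = (1 - e * g) ^ 2 / (1 + b * g) := by
    rw [← mul_div_assoc, ← mul_pow, hzg]
  have e2 : z * (-1 + (1 - e * g) ^ 2 / (1 + b * g)) =
      -((1 - e * g) * (e * (2 - e * g) + b) / (1 + b * g)) := by
    rw [hz]; field_simp; ring
  have e3 : z * (-(2 * Δ + b) + (1 - e * g) * (e * (2 - e * g) + b) / (1 + b * g)) =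
      spikeTail a b Δ g := by
    have hst : spikeTail a b Δ g = (1 - e * g) * (-2 * a * e - 3 * e ^ 2 -
        b * e + e ^ 3 * g - b * (2 * Δ + b)) / (1 + b * g) := by
      rw [spikeTail, ← he]
      have : Δ * g / (1 + a * g) = e * g := by rw [he]; ring
      rw [this]
    rw [hst, hz]
    field_simp
    rw [← heD]
    ring
  rw [← e3]
  have : z ^ 4 * (g ^ 2 / (1 + b * g)) = z ^ 2 * (z ^ 2 * (g ^ 2 / (1 + b * g))) := by ring
  rw [this, e1]
  have e2' : (1 - e * g) * (e * (2 - e * g) + b) / (1 + b * g) =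
      -(z * (-1 + (1 - e * g) ^ 2 / (1 + b * g))) := by rw [e2, neg_neg]
  rw [e2']
  ring

/-- The remainder of the expansion of `labelEnergy` at infinity; it tends to the third moment. -/
noncomputable def energyTail (α Δ θ g : ℝ) : ℝ :=
  α * momentTail (α * Δ) Δ g - (1 - 2 * θ) ^ 2 * α ^ 2 * spikeTail (α * Δ) (α * (1 + Δ)) Δ g

lemma labelEnergy_expansion (hα : 0 < α) (hΔ : 0 < Δ) (hz : 0 < z) :
    z ^ 4 * labelEnergy α Δ θ z = α * z ^ 3 - (α * Δ + (1 - 2 * θ) ^ 2 * α ^ 2) * z ^ 2 +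
      (α * (Δ * (α * Δ + Δ)) + (1 - 2 * θ) ^ 2 * α ^ 2 * (2 * Δ + α * (1 + Δ))) * z -
      energyTail α Δ θ (stieltjes α Δ z) := by
  have hg := stieltjes_pos hα hΔ hz
  have hp := stieltjes_poly hα hΔ hz
  have hA := moment_expansion hg (by positivity : 0 < α * Δ) hp
  have hB := spike_expansion (b := α * (1 + Δ)) hg (by positivity : 0 < α * Δ) (by positivity) hp
  rw [energyTail, labelEnergy]
  have e : z ^ 4 * (α * stieltjes α Δ z - (1 - 2 * θ) ^ 2 * α ^ 2 * stieltjes α Δ z ^ 2 /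
      (1 + α * (1 + Δ) * stieltjes α Δ z)) = α * (z ^ 4 * stieltjes α Δ z) -
      (1 - 2 * θ) ^ 2 * α ^ 2 * (z ^ 4 * (stieltjes α Δ z ^ 2 /
      (1 + α * (1 + Δ) * stieltjes α Δ z))) := by ring
  rw [e, hA, hB]
  ring

/-- The third moment of the spectral measure of the labels. -/
noncomputable def thirdMoment (α Δ θ : ℝ) : ℝ :=
  (α ^ 2 + 3 * α + 1) * Δ ^ 3 * α +
      α ^ 2 * (Δ ^ 2 * (α ^ 2 + 5 * α + 3) + Δ * (2 * α + 3) * α + α ^ 2) * (1 - 2 * θ) ^ 2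

lemma thirdMoment_pos (hα : 0 < α) (hΔ : 0 < Δ) : 0 < thirdMoment α Δ θ := by
  rw [thirdMoment]; positivity

lemma tendsto_energyTail (hα : 0 < α) (hΔ : 0 < Δ) :
    Tendsto (fun z => energyTail α Δ θ (stieltjes α Δ z)) atTop (𝓝 (thirdMoment α Δ θ)) := by
  have hc : ContinuousAt (energyTail α Δ θ) 0 := by
    have h1 : ContinuousAt (fun g : ℝ => Δ / (1 + α * Δ * g)) 0 :=
      ContinuousAt.div (by fun_prop) (by fun_prop) (by simp)
    have h2 : ContinuousAt (fun g : ℝ => Δ * g / (1 + α * Δ * g)) 0 :=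
      ContinuousAt.div (by fun_prop) (by fun_prop) (by simp)
    unfold energyTail momentTail spikeTail
    refine (continuousAt_const.mul (ContinuousAt.div (by fun_prop) (by fun_prop) (by simp))).sub
      (continuousAt_const.mul (ContinuousAt.div (by fun_prop) (by fun_prop) (by simp)))
  have h := hc.tendsto.comp (tendsto_stieltjes hα hΔ)
  have hval : energyTail α Δ θ 0 = thirdMoment α Δ θ := by
    simp [energyTail, momentTail, spikeTail, thirdMoment]; ring
  rw [hval] at h
  exact h

/-- The limit of the functional on `24 z⁴ t³ / ((t + z) (t + 2 z) (t + 3 z) (t + 4 z))`. -/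
noncomputable def probeEnergy (α Δ θ z : ℝ) : ℝ :=
  24 * z ^ 4 * (-(1 / 6) * labelEnergy α Δ θ z + 4 * labelEnergy α Δ θ (2 * z) -
    27 / 2 * labelEnergy α Δ θ (3 * z) + 32 / 3 * labelEnergy α Δ θ (4 * z))

lemma tendsto_probeEnergy (hα : 0 < α) (hΔ : 0 < Δ) :
    Tendsto (probeEnergy α Δ θ) atTop (𝓝 (thirdMoment α Δ θ)) := by
  have hT := tendsto_energyTail (θ := θ) hα hΔ
  have hs : ∀ k : ℝ, 0 < k → Tendsto (fun z => energyTail α Δ θ (stieltjes α Δ (k * z))) atTop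
      (𝓝 (thirdMoment α Δ θ)) := fun k hk => hT.comp (tendsto_id.const_mul_atTop hk)
  have h := (((hT.const_mul 4).sub ((hs 2 (by norm_num)).const_mul 6)).add
    ((hs 3 (by norm_num)).const_mul 4)).sub (hs 4 (by norm_num))
  have hval : 4 * thirdMoment α Δ θ - 6 * thirdMoment α Δ θ + 4 * thirdMoment α Δ θ -
      thirdMoment α Δ θ = thirdMoment α Δ θ := by ring
  rw [hval] at h
  refine h.congr' ?_
  filter_upwards [eventually_gt_atTop 0] with z hz
  have e1 := labelEnergy_expansion (θ := θ) hα hΔ hz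
  have e2 := labelEnergy_expansion (θ := θ) hα hΔ (by positivity : 0 < 2 * z)
  have e3 := labelEnergy_expansion (θ := θ) hα hΔ (by positivity : 0 < 3 * z)
  have e4 := labelEnergy_expansion (θ := θ) hα hΔ (by positivity : 0 < 4 * z)
  rw [probeEnergy]
  linear_combination 4 * e1 - 6 * e2 + 4 * e3 - e4

end ScalarDistilled

section KernelLimits

variable {α Δ θ z w : ℝ}

lemma IsSpectral.congr {Ω : Type*} {F : Filter Ω} {L : (ℝ → ℝ) → Ω → ℝ} (hL : IsSpectral F L)
    {φ ψ : ℝ → ℝ} (h : ∀ t, 0 ≤ t → φ t = ψ t) : L φ = L ψ := by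
  obtain ⟨b, β, -, -, hb⟩ := hL.bound
  funext x
  rw [← sub_eq_zero, ← hL.sub]
  have h0 := hb (fun t => φ t - ψ t) 0 le_rfl (fun t ht => by simp [h t ht]) x
  rw [zero_mul] at h0
  exact abs_nonpos_iff.1 h0

lemma isSpectral_form {F : Filter (Σ p, Noise p)} (Δ : ℝ) {u v : ∀ x : Σ p, Noise p, Fin x.1.2 → ℝ}
    {a b : ℝ} (hu : Tendsto (fun x => u x ⬝ᵥ u x) F (𝓝 a))
    (hv : Tendsto (fun x => v x ⬝ᵥ v x) F (𝓝 b)) :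
    IsSpectral F fun φ x => u x ⬝ᵥ matFun φ (kernel Δ x) *ᵥ v x where
  add φ ψ x := by rw [matFun_add, add_mulVec, dotProduct_add]
  const_mul c φ x := by rw [matFun_const_mul, smul_mulVec, dotProduct_smul, smul_eq_mul]
  bound := ⟨fun x => (u x ⬝ᵥ u x + v x ⬝ᵥ v x) / 2, (a + b) / 2, fun x => by
      have := dotProduct_self_nonneg_real (u x)
      have := dotProduct_self_nonneg_real (v x)
      positivity, (hu.add hv).div_const 2,
    fun φ C hC hφ x => abs_matFun_form_le hC hφ _ _ _⟩

lemma mul_cauchyKernel {z t : ℝ} (hz : 0 < z) (ht : 0 ≤ t) :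
    t * cauchyKernel z t = 1 - z * cauchyKernel z t := by
  rw [cauchyKernel]; field_simp; ring

/-- The kernel that defines the squared length of the stage-`1` weights. -/
noncomputable def distilledKernel (z w t : ℝ) : ℝ :=
  t * ((t * (cauchyKernel z t * cauchyKernel w t)) * (t * (cauchyKernel z t * cauchyKernel w t)))

/-- The limit of the squared length of the stage-`1` weights at inverse temperature `1`. -/
noncomputable def distilledSq (α Δ θ z w : ℝ) : ℝ :=
  limUnder (limitFilter α θ) fun x =>
    labelVec x ⬝ᵥ matFun (distilledKernel z w) (kernel Δ x) *ᵥ labelVec x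

section

variable (hα : 0 < α) (hΔ : 0 < Δ) (h0 : 0 ≤ θ) (h1 : θ ≤ 1 / 2)

include hα hΔ h0 h1

lemma tendsto_label_kernel (hz : 0 < z) :
    Tendsto (fun x => labelVec x ⬝ᵥ matFun (cauchyKernel z) (kernel Δ x) *ᵥ labelVec x)
      (limitFilter α θ) (𝓝 (labelEnergy α Δ θ z)) :=
  (tendsto_label_label hα hΔ h0 h1 hz).congr fun x => by
    rw [matFun_cauchyKernel (kernel_posSemidef hΔ x) hz]

lemma tendsto_signal_kernel (hz : 0 < z) :
    Tendsto (fun x => signalVec Δ x ⬝ᵥ matFun (cauchyKernel z) (kernel Δ x) *ᵥ labelVec x)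
      (limitFilter α θ) (𝓝 (alignment α Δ θ z)) :=
  (tendsto_signal_label hα hΔ h0 h1 hz).congr fun x => by
    rw [matFun_cauchyKernel (kernel_posSemidef hΔ x) hz]

lemma tendsto_unit_kernel (hz : 0 < z) :
    Tendsto (fun x => unitVec x ⬝ᵥ matFun (cauchyKernel z) (kernel Δ x) *ᵥ labelVec x)
      (limitFilter α θ) (𝓝 0) :=
  (tendsto_unit_label hα hΔ h0 h1 hz).congr fun x => by
    rw [matFun_cauchyKernel (kernel_posSemidef hΔ x) hz]

omit hα hΔ in
lemma isSpectral_label : IsSpectral (limitFilter α θ) fun φ x =>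
    labelVec x ⬝ᵥ matFun φ (kernel Δ x) *ᵥ labelVec x :=
  isSpectral_form Δ (tendsto_label_sq h0 h1) (tendsto_label_sq h0 h1)

lemma tendsto_unit_kernel_mul_kernel (hz : 0 < z) (hw : 0 < w) :
    Tendsto (fun x => unitVec x ⬝ᵥ
      matFun (fun t => cauchyKernel z t * cauchyKernel w t) (kernel Δ x) *ᵥ labelVec x)
      (limitFilter α θ) (𝓝 0) := by
  have := limitFilter_neBot hα h0 h1
  exact (isSpectral_form Δ (tendsto_unit_sq h0 h1) (tendsto_label_sq h0 h1)).tendsto_kernel_mul_kernel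
    (H := fun _ => 0) (H₂ := fun _ _ => 0) (fun z hz => tendsto_unit_kernel hα hΔ h0 h1 hz)
    (by simp) (fun _ _ => continuousAt_const) hz hw

lemma tendsto_weightSq (hz : 0 < z) :
    Tendsto (fun x => labelVec x ⬝ᵥ matFun (fun t => t * (cauchyKernel z t * cauchyKernel z t))
      (kernel Δ x) *ᵥ labelVec x) (limitFilter α θ) (𝓝 (weightSq α Δ θ z)) := by
  have := limitFilter_neBot hα h0 h1
  have hL := isSpectral_label (α := α) (Δ := Δ) h0 h1
  have h2 := hL.tendsto_kernel_mul_kernel (H := labelEnergy α Δ θ) (H₂ := labelEnergy₂ α Δ θ)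
    (fun z hz => tendsto_label_kernel hα hΔ h0 h1 hz)
    (fun z w hz hw => labelEnergy_sub hα hΔ hz hw)
    (fun z hz => continuousAt_labelEnergy₂ hα hΔ hz) hz hz
  have h := (tendsto_label_kernel hα hΔ h0 h1 hz).sub (h2.const_mul z)
  refine h.congr fun x => ?_
  have e := congrFun (hL.congr (φ := fun t => t * (cauchyKernel z t * cauchyKernel z t))
    (ψ := fun t => cauchyKernel z t - z * (cauchyKernel z t * cauchyKernel z t)) (fun t ht => by
      rw [← mul_assoc, mul_cauchyKernel hz ht]; ring)) x
  rw [e, hL.sub, hL.const_mul]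

lemma tendsto_distilledAlignment_form (hz : 0 < z) (hw : 0 < w) :
    Tendsto (fun x => signalVec Δ x ⬝ᵥ matFun (fun t => t * (cauchyKernel z t * cauchyKernel w t))
      (kernel Δ x) *ᵥ labelVec x) (limitFilter α θ) (𝓝 (distilledAlignment α Δ θ z w)) := by
  have := limitFilter_neBot hα h0 h1
  have hL := isSpectral_form (F := limitFilter α θ) Δ (tendsto_signal_sq hΔ h0 h1)
    (tendsto_label_sq h0 h1)
  have h2 := hL.tendsto_kernel_mul_kernel (H := alignment α Δ θ) (H₂ := alignment₂ α Δ θ)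
    (fun z hz => tendsto_signal_kernel hα hΔ h0 h1 hz)
    (fun z w hz hw => alignment_sub hα hΔ hz hw)
    (fun z hz => continuousAt_alignment₂ hα hΔ hz) hz hw
  have h := (tendsto_signal_kernel hα hΔ h0 h1 hw).sub (h2.const_mul z)
  refine h.congr fun x => ?_
  have e := congrFun (hL.congr (φ := fun t => t * (cauchyKernel z t * cauchyKernel w t))
    (ψ := fun t => cauchyKernel w t - z * (cauchyKernel z t * cauchyKernel w t)) (fun t ht => by
      rw [← mul_assoc, mul_cauchyKernel hz ht]; ring)) x
  rw [e, hL.sub, hL.const_mul]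

lemma tendsto_distilledSq (hz : 0 < z) (hw : 0 < w) :
    Tendsto (fun x => labelVec x ⬝ᵥ matFun (distilledKernel z w) (kernel Δ x) *ᵥ labelVec x)
      (limitFilter α θ) (𝓝 (distilledSq α Δ θ z w)) := by
  have := limitFilter_neBot hα h0 h1
  have hL := isSpectral_label (α := α) (Δ := Δ) h0 h1
  apply tendsto_nhds_limUnder
  have hex := hL.exists_tendsto_kernelProd (fun z hz => ⟨_, tendsto_label_kernel hα hΔ h0 h1 hz⟩)
  obtain ⟨a₁, t₁⟩ := hex [w] (by simp) (by simp [hw])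
  obtain ⟨a₂, t₂⟩ := hex [w, w] (by simp) (by simp [hw])
  obtain ⟨a₃, t₃⟩ := hex [z, w] (by simp) (by simp [hw, hz])
  obtain ⟨a₄, t₄⟩ := hex [z, w, w] (by simp) (by simp [hw, hz])
  obtain ⟨a₅, t₅⟩ := hex [z, z, w] (by simp) (by simp [hw, hz])
  obtain ⟨a₆, t₆⟩ := hex [z, z, w, w] (by simp) (by simp [hw, hz])
  have h := ((t₁.sub (t₂.const_mul w)).add ((t₄.const_mul (2 * z * w)).sub
    (t₃.const_mul (2 * z)))).add ((t₅.const_mul (z ^ 2)).sub (t₆.const_mul (z ^ 2 * w)))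
  refine ⟨_, h.congr fun x => ?_⟩
  have e := congrFun (hL.congr (φ := distilledKernel z w)
    (ψ := fun t => ((kernelProd [w] t - w * kernelProd [w, w] t) +
      (2 * z * w * kernelProd [z, w, w] t - 2 * z * kernelProd [z, w] t)) +
      (z ^ 2 * kernelProd [z, z, w] t - z ^ 2 * w * kernelProd [z, z, w, w] t)) (fun t ht => by
      have h1 := mul_cauchyKernel hz ht
      have h2 := mul_cauchyKernel hw ht
      have e1 : distilledKernel z w t = (t * cauchyKernel z t) * (t * cauchyKernel z t) *
        (t * cauchyKernel w t) * cauchyKernel w t := by rw [distilledKernel]; ring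
      rw [e1, h1, h2]
      simp only [kernelProd, List.map_cons, List.map_nil, List.prod_cons, List.prod_nil]
      ring)) x
  rw [e, hL.add, hL.add, hL.sub, hL.sub, hL.sub, hL.const_mul, hL.const_mul, hL.const_mul,
    hL.const_mul, hL.const_mul]

omit hΔ in
lemma label_limit_mono {φ ψ : ℝ → ℝ} {a b : ℝ} (h : ∀ t, 0 ≤ t → φ t ≤ ψ t)
    (hφ : Tendsto (fun x => labelVec x ⬝ᵥ matFun φ (kernel Δ x) *ᵥ labelVec x)
      (limitFilter α θ) (𝓝 a))
    (hψ : Tendsto (fun x => labelVec x ⬝ᵥ matFun ψ (kernel Δ x) *ᵥ labelVec x)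
      (limitFilter α θ) (𝓝 b)) : a ≤ b := by
  have := limitFilter_neBot hα h0 h1
  have hL := isSpectral_label (α := α) (Δ := Δ) h0 h1
  refine le_of_tendsto_of_tendsto' hφ hψ fun x => ?_
  rw [← sub_nonneg, ← hL.sub]
  exact matFun_form_nonneg (fun t ht => sub_nonneg.2 (h t ht)) _ _

omit hα in
lemma tendsto_const_form :
    Tendsto (fun x => labelVec x ⬝ᵥ matFun (fun _ => 1) (kernel Δ x) *ᵥ labelVec x)
      (limitFilter α θ) (𝓝 α) :=
  (tendsto_label_sq h0 h1).congr fun x => by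
    rw [matFun_one (kernel_posSemidef hΔ x), one_mulVec]

lemma distilledSq_pos (hz : 0 < z) (hw : 0 < w) : 0 < distilledSq α Δ θ z w := by
  have hL := isSpectral_label (α := α) (Δ := Δ) h0 h1
  have hW := weightSq_pos hα hΔ hz h0 h1
  set ε : ℝ := weightSq α Δ θ z * z ^ 2 / (2 * α) with hε
  have hε0 : 0 < ε := by positivity
  have hlim := ((tendsto_const_form (Δ := Δ) hΔ h0 h1).const_mul (ε * (z⁻¹ * z⁻¹))).add
    ((tendsto_distilledSq hα hΔ h0 h1 hz hw).const_mul ((1 + w / ε) ^ 2))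
  have hlim' : Tendsto (fun x => labelVec x ⬝ᵥ matFun (fun t => ε * (z⁻¹ * z⁻¹) * 1 +
      (1 + w / ε) ^ 2 * distilledKernel z w t) (kernel Δ x) *ᵥ labelVec x)
      (limitFilter α θ) (𝓝 (ε * (z⁻¹ * z⁻¹) * α + (1 + w / ε) ^ 2 * distilledSq α Δ θ z w)) :=
    hlim.congr fun x => by rw [hL.add, hL.const_mul, hL.const_mul]
  have hle := label_limit_mono hα h0 h1 (fun t ht => ?_) (tendsto_weightSq hα hΔ h0 h1 hz) hlim'
  · have e : ε * (z⁻¹ * z⁻¹) * α = weightSq α Δ θ z / 2 := by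
      rw [hε]; field_simp
    rw [e] at hle
    have : 0 < (1 + w / ε) ^ 2 * distilledSq α Δ θ z w := by linarith
    exact pos_of_mul_pos_right this (by positivity)
  · have hr := cauchyKernel_nonneg hz ht
    have hr1 := (le_abs_self _).trans (cauchyKernel_abs_le hz ht)
    have hs := cauchyKernel_nonneg hw ht
    have hdk : 0 ≤ distilledKernel z w t := by rw [distilledKernel]; positivity
    rcases le_total t ε with hte | hte
    · have : t * (cauchyKernel z t * cauchyKernel z t) ≤ ε * (z⁻¹ * z⁻¹) := by gcongr
      have : 0 ≤ (1 + w / ε) ^ 2 * distilledKernel z w t := by positivity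
      linarith
    · have hone : 1 ≤ (1 + w / ε) * (t * cauchyKernel w t) := by
        have ht0 : 0 < t := hε0.trans_le hte
        have e : t * cauchyKernel w t = (1 + w / t)⁻¹ := by
          rw [cauchyKernel]; field_simp
        rw [e, ← div_eq_mul_inv, one_le_div (by positivity)]
        gcongr
      have h2 : 1 ≤ ((1 + w / ε) * (t * cauchyKernel w t)) ^ 2 := one_le_pow₀ hone
      have e : (1 + w / ε) ^ 2 * distilledKernel z w t =
          t * (cauchyKernel z t * cauchyKernel z t) * ((1 + w / ε) * (t * cauchyKernel w t)) ^ 2 := by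
        rw [distilledKernel]; ring
      rw [e]
      have h3 : t * (cauchyKernel z t * cauchyKernel z t) ≤ t * (cauchyKernel z t * cauchyKernel z t)
          * ((1 + w / ε) * (t * cauchyKernel w t)) ^ 2 := le_mul_of_one_le_right (by positivity) h2
      have : 0 ≤ ε * (z⁻¹ * z⁻¹) * 1 := by positivity
      linarith

/-- A function comparable to `t ^ 3` whose functional is known explicitly. -/
lemma tendsto_probe (hz : 0 < z) :
    Tendsto (fun x => labelVec x ⬝ᵥ matFun (fun t => t ^ 3 * ((z * cauchyKernel z t) *
      (2 * z * cauchyKernel (2 * z) t) * (3 * z * cauchyKernel (3 * z) t) *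
      (4 * z * cauchyKernel (4 * z) t))) (kernel Δ x) *ᵥ labelVec x)
      (limitFilter α θ) (𝓝 (probeEnergy α Δ θ z)) := by
  have hL := isSpectral_label (α := α) (Δ := Δ) h0 h1
  have t₁ := tendsto_label_kernel hα hΔ h0 h1 hz
  have t₂ := tendsto_label_kernel hα hΔ h0 h1 (by positivity : 0 < 2 * z)
  have t₃ := tendsto_label_kernel hα hΔ h0 h1 (by positivity : 0 < 3 * z)
  have t₄ := tendsto_label_kernel hα hΔ h0 h1 (by positivity : 0 < 4 * z)
  have h := ((((t₁.const_mul (-(1 / 6))).add (t₂.const_mul 4)).sub (t₃.const_mul (27 / 2))).add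
    (t₄.const_mul (32 / 3))).const_mul (24 * z ^ 4)
  refine h.congr fun x => ?_
  have e := congrFun (hL.congr (φ := fun t => t ^ 3 * ((z * cauchyKernel z t) *
      (2 * z * cauchyKernel (2 * z) t) * (3 * z * cauchyKernel (3 * z) t) *
      (4 * z * cauchyKernel (4 * z) t)))
    (ψ := fun t => 24 * z ^ 4 * (((-(1 / 6) * cauchyKernel z t + 4 * cauchyKernel (2 * z) t) -
      27 / 2 * cauchyKernel (3 * z) t) + 32 / 3 * cauchyKernel (4 * z) t)) (fun t ht => by
      simp only [cauchyKernel]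
      field_simp
      ring)) x
  rw [e, hL.const_mul, hL.add, hL.sub, hL.add, hL.const_mul, hL.const_mul, hL.const_mul,
    hL.const_mul]

end

lemma scaled_kernel_mono {z w t : ℝ} (hz : 0 < z) (hzw : z ≤ w) (ht : 0 ≤ t) :
    z * cauchyKernel z t ≤ w * cauchyKernel w t := by
  have hw : 0 < w := hz.trans_le hzw
  rw [cauchyKernel, cauchyKernel, ← div_eq_mul_inv, ← div_eq_mul_inv,
    div_le_div_iff₀ (by positivity) (by positivity)]
  nlinarith [mul_le_mul_of_nonneg_right hzw ht]

lemma tendsto_scaled_distilledSq (hα : 0 < α) (hΔ : 0 < Δ) (h0 : 0 ≤ θ) (h1 : θ ≤ 1 / 2) :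
    Tendsto (fun l : ℝ × ℝ => (l.1 * l.2) ^ 2 * distilledSq α Δ θ l.1 l.2) (atTop ×ˢ atTop)
      (𝓝 (thirdMoment α Δ θ)) := by
  have hpos : ∀ᶠ l : ℝ × ℝ in atTop ×ˢ atTop, 0 < l.1 ∧ 0 < l.2 :=
    (eventually_gt_atTop 0).prod_mk (eventually_gt_atTop 0)
  have hmin : Tendsto (fun l : ℝ × ℝ => min l.1 l.2 / 4) (atTop ×ˢ atTop) atTop :=
    tendsto_atTop.2 fun b => by
      filter_upwards [(eventually_ge_atTop (4 * b)).prod_mk (eventually_ge_atTop (4 * b))] with l hl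
      rw [le_div_iff₀ (by norm_num), mul_comm]
      exact le_min hl.1 hl.2
  have hmax : Tendsto (fun l : ℝ × ℝ => max l.1 l.2) (atTop ×ˢ atTop) atTop :=
    tendsto_atTop_mono (fun l => le_max_left l.1 l.2) tendsto_fst
  refine tendsto_of_tendsto_of_tendsto_of_le_of_le'
    ((tendsto_probeEnergy hα hΔ).comp hmin) ((tendsto_probeEnergy hα hΔ).comp hmax) ?_ ?_
  all_goals
    filter_upwards [hpos] with l hl
    have hL := isSpectral_label (α := α) (Δ := Δ) h0 h1
    have hQ : Tendsto (fun x => labelVec x ⬝ᵥ matFun (fun t => (l.1 * l.2) ^ 2 *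
        distilledKernel l.1 l.2 t) (kernel Δ x) *ᵥ labelVec x) (limitFilter α θ)
        (𝓝 ((l.1 * l.2) ^ 2 * distilledSq α Δ θ l.1 l.2)) :=
      ((tendsto_distilledSq hα hΔ h0 h1 hl.1 hl.2).const_mul _).congr fun x => by rw [hL.const_mul]
    have hk : ∀ t, (l.1 * l.2) ^ 2 * distilledKernel l.1 l.2 t = t ^ 3 *
        ((l.1 * cauchyKernel l.1 t) * (l.1 * cauchyKernel l.1 t) * (l.2 * cauchyKernel l.2 t) *
        (l.2 * cauchyKernel l.2 t)) := fun t => by rw [distilledKernel]; ring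
    simp only [Function.comp]
  · set z := min l.1 l.2 / 4 with hz
    have hz0 : 0 < z := div_pos (lt_min hl.1 hl.2) (by norm_num)
    have hz1 : 4 * z ≤ l.1 := by rw [hz]; linarith [min_le_left l.1 l.2]
    have hz2 : 4 * z ≤ l.2 := by rw [hz]; linarith [min_le_right l.1 l.2]
    refine label_limit_mono hα h0 h1 (fun t ht => ?_) (tendsto_probe hα hΔ h0 h1 hz0) hQ
    rw [hk]
    have n1 := cauchyKernel_nonneg hz0 ht
    have n2 := cauchyKernel_nonneg (by positivity : 0 < 2 * z) ht
    have n3 := cauchyKernel_nonneg (by positivity : 0 < 3 * z) ht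
    have n4 := cauchyKernel_nonneg (by positivity : 0 < 4 * z) ht
    have m1 := cauchyKernel_nonneg hl.1 ht
    have m2 := cauchyKernel_nonneg hl.2 ht
    have p1 := hl.1
    have p2 := hl.2
    have i1 := scaled_kernel_mono hz0 (by linarith : z ≤ l.1) ht
    have i2 := scaled_kernel_mono (by positivity) (by linarith : 2 * z ≤ l.1) ht
    have i3 := scaled_kernel_mono (by positivity) (by linarith : 3 * z ≤ l.2) ht
    have i4 := scaled_kernel_mono (by positivity) (by linarith : 4 * z ≤ l.2) ht
    gcongr
  · set z := max l.1 l.2 with hz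
    have hz1 : l.1 ≤ z := le_max_left _ _
    have hz2 : l.2 ≤ z := le_max_right _ _
    have hz0 : 0 < z := hl.1.trans_le hz1
    refine label_limit_mono hα h0 h1 (fun t ht => ?_) hQ (tendsto_probe hα hΔ h0 h1 hz0)
    rw [hk]
    have n1 := cauchyKernel_nonneg hz0 ht
    have n2 := cauchyKernel_nonneg (by positivity : 0 < 2 * z) ht
    have n3 := cauchyKernel_nonneg (by positivity : 0 < 3 * z) ht
    have n4 := cauchyKernel_nonneg (by positivity : 0 < 4 * z) ht
    have m1 := cauchyKernel_nonneg hl.1 ht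
    have m2 := cauchyKernel_nonneg hl.2 ht
    have p1 := hl.1
    have p2 := hl.2
    have i1 := scaled_kernel_mono p1 (by linarith : l.1 ≤ z) ht
    have i2 := scaled_kernel_mono p1 (by linarith : l.1 ≤ 2 * z) ht
    have i3 := scaled_kernel_mono p2 (by linarith : l.2 ≤ 3 * z) ht
    have i4 := scaled_kernel_mono p2 (by linarith : l.2 ≤ 4 * z) ht
    gcongr

end KernelLimits

section Ridge

variable {m : Type*} [Fintype m] [DecidableEq m]

/-- The bias of kernel ridge regression with kernel `K` and targets `h`, where `o` is the direction
of the constant functions. -/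
noncomputable def ridgeBias (K : Matrix m m ℝ) (z : ℝ) (o h : m → ℝ) : ℝ :=
  (o ⬝ᵥ resolvent K z *ᵥ h) / (o ⬝ᵥ resolvent K z *ᵥ o)

/-- The dual variables of kernel ridge regression with kernel `K` and targets `h`. -/
noncomputable def ridgeDual (K : Matrix m m ℝ) (z : ℝ) (o h : m → ℝ) : m → ℝ :=
  resolvent K z *ᵥ (h - ridgeBias K z o h • o)

/-- The predictions of the first stage on the training set, used as targets of the second. -/
noncomputable def distilledTarget (K : Matrix m m ℝ) (z b : ℝ) (o h : m → ℝ) : m → ℝ :=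
  b • (h - z • ridgeDual K z o h)

lemma ridgeBias_smul (K : Matrix m m ℝ) (z : ℝ) (o h : m → ℝ) {c : ℝ} (hc : c ≠ 0) :
    ridgeBias K z (c • o) (c • h) = ridgeBias K z o h := by
  simp only [ridgeBias, mulVec_smul, smul_dotProduct, dotProduct_smul, smul_eq_mul]
  rw [← mul_assoc, ← mul_assoc, mul_div_mul_left _ _ (mul_ne_zero hc hc)]

lemma ridgeDual_smul (K : Matrix m m ℝ) (z : ℝ) (o h : m → ℝ) {c : ℝ} (hc : c ≠ 0) :
    ridgeDual K z (c • o) (c • h) = c • ridgeDual K z o h := by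
  rw [ridgeDual, ridgeBias_smul K z o h hc, ridgeDual, ← mulVec_smul, smul_sub, smul_comm c]

lemma distilledTarget_smul (K : Matrix m m ℝ) (z b : ℝ) (o h : m → ℝ) {c : ℝ} (hc : c ≠ 0) :
    distilledTarget K z b (c • o) (c • h) = c • distilledTarget K z b o h := by
  rw [distilledTarget, ridgeDual_smul K z o h hc, distilledTarget, smul_comm c b, smul_sub c,
    smul_comm c z]

lemma ridgeDual_eq {K : Matrix m m ℝ} (hK : K.PosSemidef) {z : ℝ} (hz : 0 < z) (o h : m → ℝ) :
    ridgeDual K z o h = matFun (cauchyKernel z) K *ᵥ h +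
      matFun (fun t => -ridgeBias K z o h * cauchyKernel z t) K *ᵥ o := by
  rw [ridgeDual, matFun_const_mul, matFun_cauchyKernel hK hz, mulVec_sub, mulVec_smul, neg_smul,
    neg_mulVec, smul_mulVec, sub_eq_add_neg]

lemma matFun_congr {φ ψ : ℝ → ℝ} (h : ∀ t, 0 ≤ t → φ t = ψ t) {K : Matrix m m ℝ}
    (hK : K.PosSemidef) : matFun φ K = matFun ψ K := by
  obtain ⟨U, lam, -, -, hl, -, hU⟩ := exists_matFun_eq hK
  have : φ ∘ lam = ψ ∘ lam := funext fun i => h _ (hl i)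
  rw [hU, hU, this]

lemma distilledTarget_eq {K : Matrix m m ℝ} (hK : K.PosSemidef) {z : ℝ} (hz : 0 < z) (b : ℝ)
    (o h : m → ℝ) :
    distilledTarget K z b o h = matFun (fun t => b * (t * cauchyKernel z t)) K *ᵥ h +
      matFun (fun t => b * z * ridgeBias K z o h * cauchyKernel z t) K *ᵥ o := by
  have e : matFun (fun t => b * (t * cauchyKernel z t)) K =
      b • (1 - z • matFun (cauchyKernel z) K) := by
    rw [← matFun_one hK, ← matFun_const_mul]
    have := matFun_add (fun t => b * (t * cauchyKernel z t)) (fun t => b * (z * cauchyKernel z t)) K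
    rw [smul_sub, eq_sub_iff_add_eq, ← matFun_const_mul b, ← matFun_const_mul b, ← this]
    refine matFun_congr (fun t ht => ?_) hK
    rw [mul_cauchyKernel hz ht]; ring
  rw [e, distilledTarget, ridgeDual_eq hK hz, matFun_const_mul, matFun_const_mul]
  simp only [smul_mulVec, sub_mulVec, one_mulVec, smul_add, smul_sub, smul_smul]
  module

end Ridge

section Perturbation

variable {α Δ θ z w b : ℝ}

lemma mul_cauchyKernel_abs_le {z t : ℝ} (hz : 0 < z) (ht : 0 ≤ t) : |t * cauchyKernel z t| ≤ 1 := by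
  have h := cauchyKernel_nonneg hz ht
  rw [abs_of_nonneg (by positivity), mul_cauchyKernel hz ht]
  have : 0 ≤ z * cauchyKernel z t := by positivity
  linarith

/-- A form whose kernel vanishes in the limit. -/
lemma tendsto_form_zero {F : Filter (Σ p, Noise p)} {u v : ∀ x : Σ p, Noise p, Fin x.1.2 → ℝ}
    {a b : ℝ} (hu : Tendsto (fun x => u x ⬝ᵥ u x) F (𝓝 a))
    (hv : Tendsto (fun x => v x ⬝ᵥ v x) F (𝓝 b)) {ε : (Σ p, Noise p) → ℝ → ℝ}
    {δ : (Σ p, Noise p) → ℝ} (hδ0 : ∀ x, 0 ≤ δ x) (hδ : Tendsto δ F (𝓝 0))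
    (hε : ∀ x t, 0 ≤ t → |ε x t| ≤ δ x) :
    Tendsto (fun x => u x ⬝ᵥ matFun (ε x) (kernel Δ x) *ᵥ v x) F (𝓝 0) := by
  have h := hδ.mul ((hu.add hv).div_const 2)
  rw [zero_mul] at h
  exact squeeze_zero_norm (fun x => abs_matFun_form_le (hδ0 x) (hε x) _ _ _) h

lemma tendsto_perturbed (hΔ : 0 < Δ) (h0 : 0 ≤ θ) (h1 : θ ≤ 1 / 2) {φ : ℝ → ℝ} {C s q : ℝ}
    {ε : (Σ p, Noise p) → ℝ → ℝ} {δ : (Σ p, Noise p) → ℝ}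
    (hδ0 : ∀ x, 0 ≤ δ x) (hδ : Tendsto δ (limitFilter α θ) (𝓝 0))
    (hφ : ∀ t, 0 ≤ t → |φ t| ≤ C)
    (hε : ∀ x t, 0 ≤ t → |ε x t| ≤ δ x) (hε' : ∀ x t, 0 ≤ t → |t * ε x t| ≤ δ x)
    (hs : Tendsto (fun x => signalVec Δ x ⬝ᵥ matFun φ (kernel Δ x) *ᵥ labelVec x)
      (limitFilter α θ) (𝓝 s))
    (hq : Tendsto (fun x => labelVec x ⬝ᵥ matFun (fun t => t * (φ t * φ t)) (kernel Δ x) *ᵥ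
      labelVec x) (limitFilter α θ) (𝓝 q))
    {d : ∀ x : Σ p, Noise p, Fin x.1.2 → ℝ}
    (hd : ∀ x, d x = matFun φ (kernel Δ x) *ᵥ labelVec x + matFun (ε x) (kernel Δ x) *ᵥ unitVec x) :
    Tendsto (fun x => signalVec Δ x ⬝ᵥ d x) (limitFilter α θ) (𝓝 s) ∧
    Tendsto (fun x => d x ⬝ᵥ kernel Δ x *ᵥ d x) (limitFilter α θ) (𝓝 q) := by
  have hC : 0 ≤ C := (abs_nonneg _).trans (hφ 0 le_rfl)
  constructor
  · have h := hs.add (tendsto_form_zero (Δ := Δ) (tendsto_signal_sq hΔ h0 h1) (tendsto_unit_sq h0 h1)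
      hδ0 hδ hε)
    rw [add_zero] at h
    exact h.congr fun x => by rw [hd, dotProduct_add]
  · have hCδ : Tendsto (fun x => C * δ x) (limitFilter α θ) (𝓝 0) := by simpa using hδ.const_mul C
    have hδδ : Tendsto (fun x => δ x * δ x) (limitFilter α θ) (𝓝 0) := by simpa using hδ.mul hδ
    have t1 := tendsto_form_zero (Δ := Δ) (ε := fun x t => t * (φ t * ε x t))
      (tendsto_label_sq (α := α) h0 h1) (tendsto_unit_sq h0 h1)
      (fun x => mul_nonneg hC (hδ0 x)) hCδ (fun x t ht => by
        rw [mul_left_comm, abs_mul]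
        exact mul_le_mul (hφ t ht) (hε' x t ht) (abs_nonneg _) hC)
    have t2 := tendsto_form_zero (Δ := Δ) (ε := fun x t => t * (ε x t * ε x t))
      (tendsto_unit_sq (α := α) h0 h1) (tendsto_unit_sq h0 h1)
      (fun x => mul_nonneg (hδ0 x) (hδ0 x)) hδδ (fun x t ht => by
        rw [mul_left_comm, abs_mul]
        exact mul_le_mul (hε x t ht) (hε' x t ht) (abs_nonneg _) (hδ0 x))
    have h := (hq.add (t1.const_mul 2)).add t2
    rw [mul_zero, add_zero, add_zero] at h
    refine h.congr fun x => ?_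
    have hK := kernel_posSemidef hΔ x
    have key : ∀ (f g : ℝ → ℝ) (u v : Fin x.1.2 → ℝ),
        (matFun f (kernel Δ x) *ᵥ u) ⬝ᵥ kernel Δ x *ᵥ (matFun g (kernel Δ x) *ᵥ v) =
        u ⬝ᵥ matFun (fun t => t * (f t * g t)) (kernel Δ x) *ᵥ v := fun f g u v => by
      have e : matFun (fun t => t * (f t * g t)) (kernel Δ x) =
          matFun f (kernel Δ x) * (kernel Δ x * matFun g (kernel Δ x)) := by
        have e1 := matFun_mul f (fun t => t * g t) hK
        rw [matFun_mul (fun t => t) g hK, matFun_id hK] at e1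
        rw [← e1]
        exact congrArg (fun φ => matFun φ (kernel Δ x)) (funext fun t => by ring)
      rw [e, ← mulVec_mulVec, ← mulVec_mulVec, dotProduct_mulVec u, ← mulVec_transpose,
        matFun_transpose]
    rw [hd, mulVec_add, add_dotProduct, dotProduct_add, dotProduct_add, key, key, key, key]
    have sw : unitVec x ⬝ᵥ matFun (fun t => t * (ε x t * φ t)) (kernel Δ x) *ᵥ labelVec x =
        labelVec x ⬝ᵥ matFun (fun t => t * (φ t * ε x t)) (kernel Δ x) *ᵥ unitVec x := by
      rw [dotProduct_mulVec, ← mulVec_transpose, matFun_transpose, dotProduct_comm]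
      simp only [mul_comm (ε x _)]
    rw [sw]
    ring

/-- The learned parameters of the first stage, up to the rotation and the scaling of the data. -/
noncomputable abbrev biasZero (Δ z : ℝ) (x : Σ p, Noise p) : ℝ :=
  ridgeBias (kernel Δ x) z (unitVec x) (labelVec x)

noncomputable abbrev dualZero (Δ z : ℝ) (x : Σ p, Noise p) : Fin x.1.2 → ℝ :=
  ridgeDual (kernel Δ x) z (unitVec x) (labelVec x)

/-- The learned parameters of the second stage, up to the rotation and the scaling of the data. -/
noncomputable abbrev biasOne (Δ z w b : ℝ) (x : Σ p, Noise p) : ℝ :=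
  ridgeBias (kernel Δ x) w (unitVec x)
    (distilledTarget (kernel Δ x) z b (unitVec x) (labelVec x))

noncomputable abbrev dualOne (Δ z w b : ℝ) (x : Σ p, Noise p) : Fin x.1.2 → ℝ :=
  ridgeDual (kernel Δ x) w (unitVec x)
    (distilledTarget (kernel Δ x) z b (unitVec x) (labelVec x))

lemma tendsto_biasZero (hα : 0 < α) (hΔ : 0 < Δ) (h0 : 0 ≤ θ) (h1 : θ ≤ 1 / 2) (hz : 0 < z) :
    Tendsto (biasZero Δ z) (limitFilter α θ) (𝓝 0) := by
  have hs := stieltjes_pos hα hΔ hz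
  have h := (tendsto_unit_label hα hΔ h0 h1 hz).div (tendsto_unit_unit hα hΔ h0 h1 hz)
    (by positivity)
  rw [zero_div] at h
  exact h

lemma tendsto_dualZero (hα : 0 < α) (hΔ : 0 < Δ) (h0 : 0 ≤ θ) (h1 : θ ≤ 1 / 2) (hz : 0 < z) :
    Tendsto (fun x => signalVec Δ x ⬝ᵥ dualZero Δ z x) (limitFilter α θ)
      (𝓝 (alignment α Δ θ z)) ∧
    Tendsto (fun x => dualZero Δ z x ⬝ᵥ kernel Δ x *ᵥ dualZero Δ z x) (limitFilter α θ)
      (𝓝 (weightSq α Δ θ z)) := by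
  have hB := (tendsto_biasZero hα hΔ h0 h1 hz).abs.mul_const (z⁻¹ + 1)
  rw [abs_zero, zero_mul] at hB
  have hz' : 0 < z⁻¹ := inv_pos.2 hz
  refine tendsto_perturbed hΔ h0 h1 (fun x => by positivity) hB
    (fun t ht => cauchyKernel_abs_le hz ht)
    (ε := fun x t => -biasZero Δ z x * cauchyKernel z t) (fun x t ht => ?_) (fun x t ht => ?_)
    (tendsto_signal_kernel hα hΔ h0 h1 hz) (tendsto_weightSq hα hΔ h0 h1 hz)
    (fun x => ridgeDual_eq (kernel_posSemidef hΔ x) hz _ _)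
  · rw [abs_mul, abs_neg]
    have := cauchyKernel_abs_le hz ht
    gcongr
    linarith
  · rw [mul_left_comm, abs_mul, abs_neg]
    have := mul_cauchyKernel_abs_le hz ht
    gcongr
    linarith

lemma resolvent_mulVec_distilledTarget {x : Σ p, Noise p} (hΔ : 0 < Δ) (hz : 0 < z) (hw : 0 < w) :
    resolvent (kernel Δ x) w *ᵥ distilledTarget (kernel Δ x) z b (unitVec x) (labelVec x) =
      matFun (fun t => b * (t * (cauchyKernel z t * cauchyKernel w t))) (kernel Δ x) *ᵥ labelVec x +
      matFun (fun t => b * z * biasZero Δ z x * (cauchyKernel z t * cauchyKernel w t))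
        (kernel Δ x) *ᵥ unitVec x := by
  have hK := kernel_posSemidef hΔ x
  rw [distilledTarget_eq hK hz, ← matFun_cauchyKernel hK hw, mulVec_add, mulVec_mulVec,
    mulVec_mulVec, ← matFun_mul _ _ hK, ← matFun_mul _ _ hK]
  congr 2 <;> exact congrArg (fun φ => matFun φ (kernel Δ x)) (funext fun t => by ring)

lemma tendsto_biasOne (hα : 0 < α) (hΔ : 0 < Δ) (h0 : 0 ≤ θ) (h1 : θ ≤ 1 / 2) (hz : 0 < z)
    (hw : 0 < w) : Tendsto (biasOne Δ z w b) (limitFilter α θ) (𝓝 0) := by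
  have hs := stieltjes_pos hα hΔ hw
  have hL := isSpectral_form Δ (tendsto_unit_sq (α := α) h0 h1) (tendsto_label_sq (α := α) h0 h1)
  have t1 := ((tendsto_unit_kernel hα hΔ h0 h1 hw).sub
    ((tendsto_unit_kernel_mul_kernel hα hΔ h0 h1 hz hw).const_mul z)).const_mul b
  simp only [mul_zero, sub_zero] at t1
  have hB := ((tendsto_biasZero hα hΔ h0 h1 hz).const_mul (b * z)).abs.mul_const (z⁻¹ * w⁻¹)
  rw [mul_zero, abs_zero, zero_mul] at hB
  have t2 := tendsto_form_zero (Δ := Δ)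
    (ε := fun x t => b * z * biasZero Δ z x * (cauchyKernel z t * cauchyKernel w t))
    (tendsto_unit_sq (α := α) h0 h1) (tendsto_unit_sq h0 h1) (fun x => by positivity) hB
    (fun x t ht => by
      rw [abs_mul, abs_mul (cauchyKernel z t)]
      have := cauchyKernel_abs_le hz ht
      have := cauchyKernel_abs_le hw ht
      gcongr)
  have h := (t1.add t2).div (tendsto_unit_unit hα hΔ h0 h1 hw) (by positivity)
  rw [add_zero, zero_div] at h
  refine h.congr fun x => ?_
  simp only [Pi.div_apply, biasOne, ridgeBias]
  rw [resolvent_mulVec_distilledTarget hΔ hz hw, dotProduct_add]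
  congr 2
  have e := congrFun (hL.congr (φ := fun t => b * (t * (cauchyKernel z t * cauchyKernel w t)))
    (ψ := fun t => b * (cauchyKernel w t - z * (cauchyKernel z t * cauchyKernel w t))) (fun t ht => by
      rw [← mul_assoc t, mul_cauchyKernel hz ht]; ring)) x
  rw [e, hL.const_mul, hL.sub, hL.const_mul]

lemma tendsto_dualOne (hα : 0 < α) (hΔ : 0 < Δ) (h0 : 0 ≤ θ) (h1 : θ ≤ 1 / 2) (hz : 0 < z)
    (hw : 0 < w) (b : ℝ) :
    Tendsto (fun x => signalVec Δ x ⬝ᵥ dualOne Δ z w b x) (limitFilter α θ)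
      (𝓝 (b * distilledAlignment α Δ θ z w)) ∧
    Tendsto (fun x => dualOne Δ z w b x ⬝ᵥ kernel Δ x *ᵥ dualOne Δ z w b x) (limitFilter α θ)
      (𝓝 (b ^ 2 * distilledSq α Δ θ z w)) := by
  have hB := (((tendsto_biasZero hα hΔ h0 h1 hz).abs.const_mul |b|).add
    (tendsto_biasOne (b := b) hα hΔ h0 h1 hz hw).abs).mul_const (w⁻¹ + 1)
  rw [abs_zero, mul_zero, add_zero, zero_mul] at hB
  have hw' : 0 < w⁻¹ := inv_pos.2 hw
  have hε : ∀ x t, 0 ≤ t → ∀ u, |u * cauchyKernel w t| ≤ w⁻¹ + 1 →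
      |u * (b * z * biasZero Δ z x * (cauchyKernel z t * cauchyKernel w t) -
        biasOne Δ z w b x * cauchyKernel w t)| ≤
      (|b| * |biasZero Δ z x| + |biasOne Δ z w b x|) * (w⁻¹ + 1) := fun x t ht u hu => by
    have hr : |z * cauchyKernel z t| ≤ 1 := by
      have h2 := cauchyKernel_nonneg hz ht
      have h3 := mul_cauchyKernel hz ht
      have : 0 ≤ t * cauchyKernel z t := by positivity
      rw [abs_of_nonneg (by positivity)]
      linarith
    have e : u * (b * z * biasZero Δ z x * (cauchyKernel z t * cauchyKernel w t) -
        biasOne Δ z w b x * cauchyKernel w t) = (b * biasZero Δ z x * (z * cauchyKernel z t) -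
        biasOne Δ z w b x) * (u * cauchyKernel w t) := by ring
    rw [e, abs_mul]
    gcongr
    refine (abs_sub _ _).trans ?_
    gcongr
    rw [abs_mul, abs_mul]
    exact mul_le_of_le_one_right (by positivity) hr
  refine tendsto_perturbed hΔ h0 h1 (fun x => by positivity) hB (C := |b| * w⁻¹)
    (φ := fun t => b * (t * (cauchyKernel z t * cauchyKernel w t)))
    (fun t ht => ?_)
    (ε := fun x t => b * z * biasZero Δ z x * (cauchyKernel z t * cauchyKernel w t) -
      biasOne Δ z w b x * cauchyKernel w t) (fun x t ht => ?_) (fun x t ht => ?_)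
    ?_ ?_ (fun x => ?_)
  · rw [← mul_assoc t, abs_mul, abs_mul]
    have h2 := mul_cauchyKernel_abs_le hz ht
    have h3 := cauchyKernel_abs_le hw ht
    gcongr
    exact (mul_le_of_le_one_left (abs_nonneg _) h2).trans h3
  · have h3 := cauchyKernel_abs_le hw ht
    simpa using hε x t ht 1 (by rw [one_mul]; linarith)
  · exact hε x t ht t (by linarith [mul_cauchyKernel_abs_le hw ht])
  · exact ((tendsto_distilledAlignment_form hα hΔ h0 h1 hz hw).const_mul b).congr fun x => by
      rw [matFun_const_mul b, smul_mulVec, dotProduct_smul, smul_eq_mul]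
  · refine ((tendsto_distilledSq hα hΔ h0 h1 hz hw).const_mul (b ^ 2)).congr fun x => ?_
    rw [← smul_eq_mul, ← dotProduct_smul, ← smul_mulVec, ← matFun_const_mul]
    congr 2
    exact congrArg (fun φ => matFun φ (kernel Δ x)) (funext fun t => by rw [distilledKernel]; ring)
  · have hK := kernel_posSemidef hΔ x
    rw [dualOne, ridgeDual, mulVec_sub, resolvent_mulVec_distilledTarget hΔ hz hw, add_sub_assoc,
      mulVec_smul, ← matFun_cauchyKernel hK hw, ← smul_mulVec, ← matFun_const_mul, ← sub_mulVec]
    congr 2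
    rw [sub_eq_iff_eq_add, ← matFun_add]
    exact congrArg (fun φ => matFun φ (kernel Δ x)) (funext fun t => by ring)

end Perturbation

section Minimizer

variable {N M : ℕ}

/-- The kernel matrix of the linear model. -/
noncomputable def dataKernel (x : Fin M → Fin N → ℝ) : Matrix (Fin M) (Fin M) ℝ :=
  Matrix.of fun μ ν => (∑ i, x μ i * x ν i) / N

lemma dataKernel_posSemidef (x : Fin M → Fin N → ℝ) : (dataKernel x).PosSemidef := by
  have h := (posSemidef_self_mul_conjTranspose (Matrix.of x)).smul
    (by positivity : (0 : ℝ) ≤ (N : ℝ)⁻¹)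
  convert h using 1
  ext μ ν
  simp [dataKernel, mul_apply, div_eq_inv_mul]

/-- The weights that belong to the dual variables `d`. -/
noncomputable def dualWeights (x : Fin M → Fin N → ℝ) (d : Fin M → ℝ) : Fin N → ℝ :=
  fun i => (∑ μ, d μ * x μ i) / √(N : ℝ)

lemma preactivation_dualWeights (x : Fin M → Fin N → ℝ) (d : Fin M → ℝ) (B : ℝ) (ν : Fin M) :
    preactivation (dualWeights x d, B) (x ν) = (dataKernel x *ᵥ d) ν + B := by
  have hN : √(N : ℝ) * √(N : ℝ) = N := Real.mul_self_sqrt (by positivity)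
  simp only [preactivation, dualWeights, mulVec, dotProduct, dataKernel, of_apply]
  congr 1
  simp only [div_mul_eq_mul_div, Finset.sum_mul, ← Finset.sum_div, div_div, hN]
  rw [Finset.sum_comm]
  exact congrArg (· / (N : ℝ)) (Finset.sum_congr rfl fun μ _ => Finset.sum_congr rfl fun i _ => by ring)

/-- The sum of the weights in terms of the dual variables. -/
lemma sum_dualWeights (x : Fin M → Fin N → ℝ) (d : Fin M → ℝ) :
    (∑ i, dualWeights x d i) = (∑ μ, d μ * ∑ i, x μ i) / √(N : ℝ) := by
  simp only [dualWeights, ← Finset.sum_div, Finset.mul_sum]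
  rw [Finset.sum_comm]

lemma sum_sq_dualWeights (x : Fin M → Fin N → ℝ) (d : Fin M → ℝ) :
    (∑ i, dualWeights x d i ^ 2) = d ⬝ᵥ dataKernel x *ᵥ d := by
  have h : ∀ ν, (dataKernel x *ᵥ d) ν = (∑ i, dualWeights x d i * x ν i) / √(N : ℝ) := fun ν => by
    have := preactivation_dualWeights x d 0 ν
    rw [add_zero] at this
    rw [← this, preactivation, add_zero]
  simp only [dotProduct, h, ← mul_div_assoc, ← Finset.sum_div, Finset.mul_sum]
  rw [Finset.sum_comm, Finset.sum_div]
  refine Finset.sum_congr rfl fun i _ => ?_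
  rw [sq]
  conv_lhs => enter [2]; rw [dualWeights]
  rw [← mul_div_assoc, Finset.mul_sum]
  exact congrArg (· / √(N : ℝ)) (Finset.sum_congr rfl fun μ _ => by ring)

/-- The exact second-order expansion of the loss at a stationary point. -/
lemma trainLoss_eq_add {lam : ℝ} {x : Fin M → Fin N → ℝ} {y d : Fin M → ℝ} {B : ℝ}
    (hd : ∀ μ, 2 * lam * d μ + ((dataKernel x *ᵥ d) μ + B) = 2 * y μ - 1) (hsum : ∑ μ, d μ = 0)
    (q : (Fin N → ℝ) × ℝ) :
    trainLoss lam x y q = trainLoss lam x y (dualWeights x d, B) +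
      (1 / 4 * ∑ μ, (preactivation q (x μ) - preactivation (dualWeights x d, B) (x μ)) ^ 2 +
        lam / 2 * ∑ i, (q.1 i - dualWeights x d i) ^ 2) := by
  set p : (Fin N → ℝ) × ℝ := (dualWeights x d, B) with hp
  have hy : ∀ μ, y μ - activation (preactivation p (x μ)) = lam * d μ := fun μ => by
    have := hd μ
    rw [← preactivation_dualWeights, ← hp] at this
    rw [activation]
    linarith
  have hy' : ∀ μ, y μ - activation (preactivation q (x μ)) = lam * d μ -
      (preactivation q (x μ) - preactivation p (x μ)) / 2 := fun μ => by
    rw [← hy, activation, activation]; ring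
  have horth : ∑ μ, d μ * (preactivation q (x μ) - preactivation p (x μ)) =
      ∑ i, dualWeights x d i * (q.1 i - dualWeights x d i) := by
    have e1 : ∀ μ, d μ * (preactivation q (x μ) - preactivation p (x μ)) =
        (∑ i, (q.1 i - dualWeights x d i) * (d μ * x μ i)) / √(N : ℝ) + d μ * (q.2 - B) := fun μ => by
      have e2 : ∑ i, (q.1 i - dualWeights x d i) * (d μ * x μ i) =
          d μ * (∑ i, q.1 i * x μ i - ∑ i, dualWeights x d i * x μ i) := by
        rw [← Finset.sum_sub_distrib, Finset.mul_sum]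
        exact Finset.sum_congr rfl fun i _ => by ring
      rw [e2]
      simp only [preactivation, hp]
      ring
    rw [Finset.sum_congr rfl fun μ _ => e1 μ, Finset.sum_add_distrib, ← Finset.sum_mul, hsum,
      zero_mul, add_zero, ← Finset.sum_div, Finset.sum_comm, Finset.sum_div]
    refine Finset.sum_congr rfl fun i _ => ?_
    rw [← Finset.mul_sum, dualWeights]
    ring
  have hA : ∑ μ, (y μ - activation (preactivation q (x μ))) ^ 2 =
      ∑ μ, (y μ - activation (preactivation p (x μ))) ^ 2 -
      lam * ∑ μ, d μ * (preactivation q (x μ) - preactivation p (x μ)) +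
      1 / 4 * ∑ μ, (preactivation q (x μ) - preactivation p (x μ)) ^ 2 := by
    rw [Finset.mul_sum, Finset.mul_sum, ← Finset.sum_sub_distrib, ← Finset.sum_add_distrib]
    refine Finset.sum_congr rfl fun μ _ => ?_
    rw [hy', hy]; ring
  have hC : ∑ i, q.1 i ^ 2 = ∑ i, dualWeights x d i ^ 2 +
      2 * ∑ i, dualWeights x d i * (q.1 i - dualWeights x d i) +
      ∑ i, (q.1 i - dualWeights x d i) ^ 2 := by
    rw [Finset.mul_sum, ← Finset.sum_add_distrib, ← Finset.sum_add_distrib]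
    exact Finset.sum_congr rfl fun i _ => by ring
  rw [trainLoss, trainLoss, hA, hC, horth]
  ring

lemma minimizer_eq_of_stationary {lam : ℝ} (hlam : 0 < lam) (hM : 0 < M) {x : Fin M → Fin N → ℝ}
    {y d : Fin M → ℝ} {B : ℝ}
    (hd : ∀ μ, 2 * lam * d μ + ((dataKernel x *ᵥ d) μ + B) = 2 * y μ - 1) (hsum : ∑ μ, d μ = 0) :
    minimizer lam x y = (dualWeights x d, B) := by
  have hgap := trainLoss_eq_add hd hsum
  have hmin : ∀ q, trainLoss lam x y (dualWeights x d, B) ≤ trainLoss lam x y q := fun q => by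
    rw [hgap q]
    exact le_add_of_nonneg_right (by positivity)
  have hspec : ∀ q, trainLoss lam x y (minimizer lam x y) ≤ trainLoss lam x y q :=
    Classical.epsilon_spec (p := fun p => ∀ q, trainLoss lam x y p ≤ trainLoss lam x y q) ⟨_, hmin⟩
  have hle := hspec (dualWeights x d, B)
  set q := minimizer lam x y
  rw [hgap q] at hle
  have hA : 0 ≤ ∑ μ, (preactivation q (x μ) - preactivation (dualWeights x d, B) (x μ)) ^ 2 :=
    Finset.sum_nonneg fun _ _ => sq_nonneg _
  have hC : 0 ≤ ∑ i, (q.1 i - dualWeights x d i) ^ 2 := Finset.sum_nonneg fun _ _ => sq_nonneg _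
  have hC0 : ∑ i, (q.1 i - dualWeights x d i) ^ 2 = 0 := by
    refine le_antisymm ?_ hC
    by_contra hlt
    have : 0 < lam / 2 * ∑ i, (q.1 i - dualWeights x d i) ^ 2 :=
      mul_pos (by positivity) (not_le.1 hlt)
    linarith
  have hA0 : ∑ μ, (preactivation q (x μ) - preactivation (dualWeights x d, B) (x μ)) ^ 2 = 0 := by
    rw [hC0] at hle
    linarith
  have hw : q.1 = dualWeights x d := funext fun i => by
    have := (Finset.sum_eq_zero_iff_of_nonneg fun _ _ => sq_nonneg _).1 hC0 i (Finset.mem_univ _)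
    exact sub_eq_zero.1 (pow_eq_zero_iff (two_ne_zero)|>.1 this)
  refine Prod.ext hw ?_
  have := (Finset.sum_eq_zero_iff_of_nonneg fun _ _ => sq_nonneg _).1 hA0 ⟨0, hM⟩ (Finset.mem_univ _)
  have := pow_eq_zero_iff (two_ne_zero)|>.1 this
  simp only [preactivation, hw] at this
  linarith

lemma resolvent_mulVec_eq {m : Type*} [Fintype m] [DecidableEq m] {K : Matrix m m ℝ}
    (hK : K.PosSemidef) {z : ℝ} (hz : 0 < z) (u : m → ℝ) :
    K *ᵥ (resolvent K z *ᵥ u) + z • (resolvent K z *ᵥ u) = u := by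
  have h : (K + z • 1) * resolvent K z = 1 := mul_nonsing_inv _ (isUnit_det_add_smul_one hK hz)
  have := congrArg (· *ᵥ u) h
  simpa [add_mul, add_mulVec, smul_mulVec] using this

lemma kernel_mulVec_ridgeDual {m : Type*} [Fintype m] [DecidableEq m] {K : Matrix m m ℝ}
    (hK : K.PosSemidef) {z : ℝ} (hz : 0 < z) (o h : m → ℝ) (i : m) :
    z * ridgeDual K z o h i + ((K *ᵥ ridgeDual K z o h) i + ridgeBias K z o h * o i) = h i := by
  have := congrFun (resolvent_mulVec_eq hK hz (h - ridgeBias K z o h • o)) i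
  simp only [Pi.add_apply, Pi.smul_apply, Pi.sub_apply, smul_eq_mul] at this
  rw [ridgeDual]
  linarith

lemma dotProduct_ridgeDual {m : Type*} [Fintype m] [DecidableEq m] {K : Matrix m m ℝ}
    (hK : K.PosSemidef) {z : ℝ} (hz : 0 < z) {o : m → ℝ} (ho : o ≠ 0) (h : m → ℝ) :
    o ⬝ᵥ ridgeDual K z o h = 0 := by
  have hpos : 0 < o ⬝ᵥ resolvent K z *ᵥ o := by
    have := (posDef_add_smul_one hK hz).inv.dotProduct_mulVec_pos ho
    rwa [star_trivial] at this
  rw [ridgeDual, mulVec_sub, mulVec_smul, dotProduct_sub, dotProduct_smul, smul_eq_mul, ridgeBias,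
    div_mul_cancel₀ _ hpos.ne', sub_self]

/-- The minimizer of the loss is given by kernel ridge regression. -/
lemma minimizer_eq {lam : ℝ} (hlam : 0 < lam) (hM : 0 < M) (x : Fin M → Fin N → ℝ)
    (y : Fin M → ℝ) :
    minimizer lam x y =
      (dualWeights x (ridgeDual (dataKernel x) (2 * lam) 1 (fun μ => 2 * y μ - 1)),
        ridgeBias (dataKernel x) (2 * lam) 1 (fun μ => 2 * y μ - 1)) := by
  have hz : 0 < 2 * lam := by positivity
  have hK := dataKernel_posSemidef x
  have : Nonempty (Fin M) := ⟨⟨0, hM⟩⟩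
  refine minimizer_eq_of_stationary hlam hM (fun μ => ?_) ?_
  · have := kernel_mulVec_ridgeDual hK hz 1 (fun μ => 2 * y μ - 1) μ
    simpa using this
  · have := dotProduct_ridgeDual hK hz (o := 1) one_ne_zero (fun μ => 2 * y μ - 1)
    rwa [one_dotProduct] at this

lemma preactivation_minimizer {lam : ℝ} (hlam : 0 < lam) (hM : 0 < M) (x : Fin M → Fin N → ℝ)
    (y : Fin M → ℝ) (b : ℝ) :
    (fun μ => 2 * activation (b * preactivation (minimizer lam x y) (x μ)) - 1) =
      distilledTarget (dataKernel x) (2 * lam) b 1 (fun μ => 2 * y μ - 1) := by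
  funext μ
  rw [minimizer_eq hlam hM, preactivation_dualWeights, activation, distilledTarget]
  have := kernel_mulVec_ridgeDual (dataKernel_posSemidef x) (by positivity : 0 < 2 * lam) 1
    (fun μ => 2 * y μ - 1) μ
  simp only [Pi.one_apply, mul_one, Pi.smul_apply, Pi.sub_apply, smul_eq_mul] at this ⊢
  linear_combination b * this

end Minimizer

section GaussTail

lemma gaussTail_eq_sub (x : ℝ) : gaussTail x = 1 - (gaussianReal 0 1).real (Set.Iic x) := by
  rw [gaussTail, measureReal_def, gaussianReal_apply_eq_integral _ one_ne_zero,
    ENNReal.toReal_ofReal (by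
      exact setIntegral_nonneg measurableSet_Iic fun t _ => gaussianPDFReal_nonneg _ _ _)]
  congr 1
  refine setIntegral_congr_fun measurableSet_Iic fun t _ => ?_
  simp [gaussianPDFReal, div_eq_mul_inv, mul_comm]

lemma gaussTail_eq (x : ℝ) : gaussTail x = (gaussianReal 0 1).real (Set.Ioi x) := by
  rw [gaussTail_eq_sub, ← Set.compl_Iic, probReal_compl_eq_one_sub measurableSet_Iic]

lemma gaussTail_eq_Iic_neg (x : ℝ) : gaussTail x = (gaussianReal 0 1).real (Set.Iic (-x)) := by
  have h := gaussianReal_map_neg (μ := 0) (v := 1)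
  rw [neg_zero] at h
  have e : (gaussianReal 0 1).real (Set.Iic (-x)) = (gaussianReal 0 1).real (Set.Ici x) := by
    conv_lhs => rw [← h]
    rw [map_measureReal_apply (by fun_prop) measurableSet_Iic]
    congr 1
    ext t
    simp
  have := nullSingletonClass_gaussianReal (μ := 0) (v := 1) one_ne_zero
  rw [e, gaussTail_eq, measureReal_congr Ioi_ae_eq_Ici]

lemma gaussTail_zero : gaussTail 0 = 1 / 2 := by
  have h1 := gaussTail_eq_sub 0
  have h2 := gaussTail_eq_Iic_neg 0
  rw [neg_zero] at h2
  linarith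

lemma gaussTail_nonneg (x : ℝ) : 0 ≤ gaussTail x := by
  rw [gaussTail_eq]; positivity

lemma gaussTail_le_one (x : ℝ) : gaussTail x ≤ 1 := by
  rw [gaussTail_eq]; exact measureReal_le_one

lemma antitone_gaussTail : Antitone gaussTail := fun x y h => by
  rw [gaussTail_eq, gaussTail_eq]
  exact measureReal_mono (Set.Ioi_subset_Ioi h)

lemma continuous_gaussTail : Continuous gaussTail := by
  have hi : Integrable (fun t : ℝ => Real.exp (-t ^ 2 / 2) / √(2 * Real.pi)) := by
    refine (integrable_gaussianPDFReal 0 1).congr (Eventually.of_forall fun t => ?_)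
    simp [gaussianPDFReal, div_eq_mul_inv, mul_comm]
  have e : gaussTail = fun x => gaussTail 0 -
      ∫ t in (0 : ℝ)..x, Real.exp (-t ^ 2 / 2) / √(2 * Real.pi) := by
    funext x
    rw [← intervalIntegral.integral_Iic_sub_Iic hi.integrableOn hi.integrableOn, gaussTail, gaussTail]
    ring
  rw [e]
  exact continuous_const.sub (intervalIntegral.continuous_primitive
    (fun a b => hi.intervalIntegrable) 0)

end GaussTail

section TestError

variable {Δ θ : ℝ}

/-- The error on a test point of a linear classifier with mean weight `m`, mean squared weight `Q`
and bias `B`. -/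
noncomputable def testError (Δ m Q B : ℝ) : ℝ :=
  1 / 2 * gaussTail ((m + B) / (√Δ * √Q)) + 1 / 2 * gaussTail ((m - B) / (√Δ * √Q))

lemma abs_testError_le (Δ m Q B : ℝ) : |testError Δ m Q B| ≤ 1 := by
  rw [testError, abs_le]
  constructor
  · linarith [gaussTail_nonneg ((m + B) / (√Δ * √Q)), gaussTail_nonneg ((m - B) / (√Δ * √Q))]
  · linarith [gaussTail_le_one ((m + B) / (√Δ * √Q)), gaussTail_le_one ((m - B) / (√Δ * √Q))]

lemma measurable_testError {X : Type*} [MeasurableSpace X] {m Q B : X → ℝ} (hm : Measurable m)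
    (hQ : Measurable Q) (hB : Measurable B) : Measurable fun x => testError Δ (m x) (Q x) (B x) := by
  have := continuous_gaussTail.measurable
  unfold testError
  fun_prop

lemma tendsto_testError {X : Type*} {F : Filter X} {m Q B : X → ℝ} {m₀ Q₀ : ℝ} (hΔ : 0 < Δ)
    (hQ₀ : 0 < Q₀) (hm : Tendsto m F (𝓝 m₀)) (hQ : Tendsto Q F (𝓝 Q₀)) (hB : Tendsto B F (𝓝 0)) :
    Tendsto (fun x => testError Δ (m x) (Q x) (B x)) F (𝓝 (gaussTail (m₀ / (√Δ * √Q₀)))) := by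
  have hD : Tendsto (fun x => √Δ * √(Q x)) F (𝓝 (√Δ * √Q₀)) := hQ.sqrt.const_mul _
  have hD0 : √Δ * √Q₀ ≠ 0 := by positivity
  have h1 := ((continuous_gaussTail.tendsto _).comp ((hm.add hB).div hD hD0)).const_mul (1 / 2)
  have h2 := ((continuous_gaussTail.tendsto _).comp ((hm.sub hB).div hD hD0)).const_mul (1 / 2)
  have h := h1.add h2
  rw [add_zero, sub_zero, ← add_mul, show (1 / 2 + 1 / 2 : ℝ) = 1 by norm_num, one_mul] at h
  exact h

lemma measurePreserving_dotProduct {n : ℕ} {e : Fin (n + 1) → ℝ} (he : e ⬝ᵥ e = 1) :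
    MeasurePreserving (fun z => e ⬝ᵥ z) (gaussVec (Fin (n + 1))) (gaussianReal 0 1) := by
  obtain ⟨O, hO, hOe⟩ := exists_orthogonal_mulVec_eq (u := e) (v := Pi.single 0 1) (by simp [he])
  have h := (measurePreserving_eval (fun _ : Fin (n + 1) => gaussianReal 0 1) 0).comp
    (measurePreserving_mulVec hO)
  convert h using 1
  funext z
  have hO' : Oᵀ * O = 1 := mul_eq_one_comm.1 hO
  have := dotProduct_mulVec_orthogonal hO' e z
  rw [hOe] at this
  simpa using this.symm

lemma measurePreserving_cell {n : ℕ} {e : Fin (n + 1) → ℝ} (he : e ⬝ᵥ e = 1) (h0 : 0 ≤ θ)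
    (h1 : θ ≤ 1 / 2) :
    MeasurePreserving (fun s : Sample (n + 1) => ((s.1, e ⬝ᵥ s.2) : Cell))
      (sampleLaw (1 / 2) θ (n + 1)) (cellLaw θ) := by
  have := isProbabilityMeasure_bernoulliLaw (q := 1 / 2) (by norm_num) (by norm_num)
  have := isProbabilityMeasure_bernoulliLaw (q := θ) h0 (by linarith)
  exact (MeasurePreserving.id _).prod (measurePreserving_dotProduct he)

lemma exists_unit_smul {n : ℕ} (w : Fin (n + 1) → ℝ) :
    ∃ e : Fin (n + 1) → ℝ, e ⬝ᵥ e = 1 ∧ w = √(∑ i, w i ^ 2) • e := by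
  by_cases hw : ∑ i, w i ^ 2 = 0
  · refine ⟨Pi.single 0 1, by simp, ?_⟩
    rw [hw, Real.sqrt_zero, zero_smul]
    funext i
    have := (Finset.sum_eq_zero_iff_of_nonneg fun _ _ => sq_nonneg _).1 hw i (Finset.mem_univ _)
    simpa using this
  · have h0 : 0 < ∑ i, w i ^ 2 := lt_of_le_of_ne (Finset.sum_nonneg fun _ _ => sq_nonneg _) (Ne.symm hw)
    have hs : √(∑ i, w i ^ 2) ≠ 0 := by positivity
    refine ⟨(√(∑ i, w i ^ 2))⁻¹ • w, ?_, by rw [smul_smul, mul_inv_cancel₀ hs, one_smul]⟩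
    have e : w ⬝ᵥ w = √(∑ i, w i ^ 2) * √(∑ i, w i ^ 2) := by
      rw [Real.mul_self_sqrt h0.le, dotProduct]
      simp [sq]
    rw [smul_dotProduct, dotProduct_smul, e]
    simp only [smul_eq_mul]
    field_simp

lemma integral_indicator_pos {a c : ℝ} (hc : 0 < c) :
    ∫ g, (if 0 < a + c * g then (1 : ℝ) else 0) ∂gaussianReal 0 1 = gaussTail (-a / c) := by
  have e : (fun g : ℝ => if 0 < a + c * g then (1 : ℝ) else 0) = (Set.Ioi (-a / c)).indicator 1 := by
    funext g
    rw [Set.indicator_apply]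
    refine if_congr ?_ rfl rfl
    rw [Set.mem_Ioi, div_lt_iff₀ hc]
    constructor <;> intro h <;> linarith
  rw [e, integral_indicator_one measurableSet_Ioi, gaussTail_eq]

lemma integral_indicator_nonpos {a c : ℝ} (hc : 0 < c) :
    ∫ g, (if 0 < a + c * g then (0 : ℝ) else 1) ∂gaussianReal 0 1 = gaussTail (a / c) := by
  have e : (fun g : ℝ => if 0 < a + c * g then (0 : ℝ) else 1) =
      (Set.Iic (-(a / c))).indicator 1 := by
    funext g
    rw [Set.indicator_apply, ← ite_not]
    refine if_congr ?_ rfl rfl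
    rw [Set.mem_Iic, ← neg_div, le_div_iff₀ hc, not_lt]
    constructor <;> intro h <;> linarith
  rw [e, integral_indicator_one measurableSet_Iic, gaussTail_eq_Iic_neg]

lemma integral_prediction_error (h0 : 0 ≤ θ) (h1 : θ ≤ 1 / 2) (hΔ : 0 < Δ) {n : ℕ}
    (p : (Fin (n + 1) → ℝ) × ℝ) :
    ∫ s : Sample (n + 1), (if prediction p (feature Δ s) ≠ trueLabel s then (1 : ℝ) else 0)
      ∂sampleLaw (1 / 2) θ (n + 1) =
    testError Δ ((∑ i, p.1 i) / ((n : ℝ) + 1)) ((∑ i, p.1 i ^ 2) / ((n : ℝ) + 1)) p.2 := by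
  have hN : (0 : ℝ) < (n : ℝ) + 1 := by positivity
  obtain ⟨e, he, hw⟩ := exists_unit_smul p.1
  set m := (∑ i, p.1 i) / ((n : ℝ) + 1) with hm
  set Q := (∑ i, p.1 i ^ 2) / ((n : ℝ) + 1) with hQ
  have hQ0 : 0 ≤ Q := by positivity
  set f : Cell → ℝ := fun c => if c.1.1 then
      (if 0 < (m + p.2) + √Δ * √Q * c.2 then 0 else 1)
    else (if 0 < (-m + p.2) + √Δ * √Q * c.2 then 1 else 0) with hf
  have hpre : ∀ s : Sample (n + 1), preactivation p (feature Δ s) =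
      ((2 * trueLabel s - 1) * m + p.2) + √Δ * √Q * (e ⬝ᵥ s.2) := fun s => by
    have e1 : √Q * (e ⬝ᵥ s.2) = (∑ i, p.1 i * s.2 i) / √((n : ℝ) + 1) := by
      have : ∑ i, p.1 i * s.2 i = √(∑ i, p.1 i ^ 2) * (e ⬝ᵥ s.2) := by
        rw [← smul_eq_mul, ← smul_dotProduct, ← hw, dotProduct]
      rw [this, hQ, Real.sqrt_div (by positivity)]
      ring
    have e2 : m = (∑ i, p.1 i * (1 / √((n : ℝ) + 1))) / √((n : ℝ) + 1) := by
      rw [← Finset.sum_mul, hm, mul_one_div, div_div, Real.mul_self_sqrt hN.le]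
    have e3 : ∑ i, p.1 i * feature Δ s i = (2 * trueLabel s - 1) *
        (∑ i, p.1 i * (1 / √((n : ℝ) + 1))) + √Δ * ∑ i, p.1 i * s.2 i := by
      rw [Finset.mul_sum, Finset.mul_sum, ← Finset.sum_add_distrib]
      refine Finset.sum_congr rfl fun i _ => ?_
      simp only [feature, meanVector, Nat.cast_add, Nat.cast_one]
      ring
    rw [preactivation, e3, mul_assoc √Δ, e1, e2, Nat.cast_add, Nat.cast_one]
    ring
  have hcongr : ∀ s : Sample (n + 1),
      (if prediction p (feature Δ s) ≠ trueLabel s then (1 : ℝ) else 0) = f (s.1, e ⬝ᵥ s.2) := by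
    intro s
    have hact : ∀ u : ℝ, 1 / 2 < activation u ↔ 0 < u := fun u => by
      rw [activation]; constructor <;> intro h <;> linarith
    rw [prediction, hpre]
    simp only [hact, hf, trueLabel]
    rcases s.1.1 with _ | _
    · norm_num
    · norm_num
      simp only [← not_lt, ite_not]
  have hfm : Measurable f := by
    rw [hf]
    refine Measurable.ite ?_ (Measurable.ite ?_ measurable_const measurable_const)
      (Measurable.ite ?_ measurable_const measurable_const)
    · exact (measurable_fst.comp measurable_fst) (MeasurableSet.of_discrete (s := {b | b = true}))
    · exact measurableSet_lt measurable_const (by fun_prop)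
    · exact measurableSet_lt measurable_const (by fun_prop)
  have := isProbabilityMeasure_cellLaw h0 h1
  have hfi : Integrable f (cellLaw θ) := by
    refine (integrable_const (1 : ℝ)).mono' hfm.aestronglyMeasurable (Eventually.of_forall fun c => ?_)
    simp only [hf]
    split_ifs <;> simp
  simp only [hcongr]
  have hmp := measurePreserving_cell he h0 h1
  rw [← integral_map hmp.measurable.aemeasurable (f := f) (by
    rw [hmp.map_eq]; exact hfm.aestronglyMeasurable), hmp.map_eq, integral_cellLaw h0 h1 hfi]
  simp only [hf, if_true, Bool.false_eq_true, if_false]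
  rw [testError]
  rcases hQ0.eq_or_lt with hq | hq
  · have hw0 : m = 0 := by
      have : ∑ i, p.1 i ^ 2 = 0 := by
        rw [eq_comm, hQ, div_eq_zero_iff] at hq
        exact hq.resolve_right hN.ne'
      rw [this, Real.sqrt_zero, zero_smul] at hw
      rw [hm, hw]
      simp
    rw [← hq, hw0]
    simp only [Real.sqrt_zero, mul_zero, zero_mul, add_zero, div_zero, gaussTail_zero, neg_zero,
      zero_add, integral_const, smul_eq_mul, probReal_univ, one_mul]
    split_ifs <;> ring
  · have hc : 0 < √Δ * √Q := by positivity
    rw [integral_indicator_pos hc, integral_indicator_nonpos hc]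
    have : -(-m + p.2) = m - p.2 := by ring
    rw [this]
    ring

end TestError

section Rotation

variable {Δ θ : ℝ} {n M : ℕ}

lemma measurePreserving_swap {m J : Type*} [Fintype m] [Fintype J] :
    MeasurePreserving (fun (G : m → J → ℝ) j μ => G μ j)
      (Measure.pi fun _ : m => gaussVec J) (gaussMat J m) := by
  have hm : Measurable (fun (G : m → J → ℝ) (j : J) (μ : m) => G μ j) := by fun_prop
  refine ⟨hm, (Measure.pi_eq_generateFrom (fun _ => generateFrom_pi) (fun _ => isPiSystem_pi)
    (fun _ => Measure.FiniteSpanningSetsIn.pi fun _ =>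
      (gaussianReal 0 1).toFiniteSpanningSetsIn) fun s hs => ?_).symm⟩
  choose t ht hst using hs
  obtain rfl : (fun j => Set.pi Set.univ (t j)) = s := funext hst
  have e : (fun (G : m → J → ℝ) (j : J) (μ : m) => G μ j) ⁻¹'
      (Set.univ.pi fun j => Set.univ.pi (t j)) = Set.univ.pi fun μ => Set.univ.pi fun j => t j μ := by
    ext G
    simp only [Set.mem_preimage, Set.mem_pi, Set.mem_univ, true_imp_iff]
    exact forall_comm
  rw [Measure.map_apply hm (MeasurableSet.univ_pi fun j => MeasurableSet.univ_pi fun μ =>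
    ht j μ (Set.mem_univ _)), e]
  simp_rw [Measure.pi_pi]
  exact Finset.prod_comm

/-- Rotates the noise by `O` and splits off its first coordinate. -/
noncomputable def rotate (O : Matrix (Fin (n + 1)) (Fin (n + 1)) ℝ) (D : Fin M → Sample (n + 1)) :
    Noise (n, M) :=
  (fun μ => ((D μ).1, (O *ᵥ (D μ).2) 0), fun j μ => (O *ᵥ (D μ).2) j.succ)

lemma measurePreserving_rotate (h0 : 0 ≤ θ) (h1 : θ ≤ 1 / 2)
    {O : Matrix (Fin (n + 1)) (Fin (n + 1)) ℝ} (hO : O * Oᵀ = 1) :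
    MeasurePreserving (rotate (M := M) O) (trainingLaw (1 / 2) θ (n + 1) M) (noiseLaw θ (n, M)) := by
  have := isProbabilityMeasure_bernoulliLaw (q := 1 / 2) (by norm_num) (by norm_num)
  have := isProbabilityMeasure_bernoulliLaw (q := θ) h0 (by linarith)
  have := isProbabilityMeasure_cellLaw h0 h1
  have hsplit : MeasurePreserving (fun s : Sample (n + 1) =>
      (((s.1, (O *ᵥ s.2) 0), fun j => (O *ᵥ s.2) j.succ) : Cell × (Fin n → ℝ)))
      (sampleLaw (1 / 2) θ (n + 1)) ((cellLaw θ).prod (gaussVec (Fin n))) := by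
    have e1 := (MeasurePreserving.id ((bernoulliLaw (1 / 2)).prod (bernoulliLaw θ))).prod
      ((measurePreserving_piFinSuccAbove (fun _ : Fin (n + 1) => gaussianReal 0 1) 0).comp
        (measurePreserving_mulVec hO))
    have e2 := (measurePreserving_prodAssoc ((bernoulliLaw (1 / 2)).prod (bernoulliLaw θ))
      (gaussianReal 0 1) (gaussVec (Fin n))).symm
    exact e2.comp e1
  have h2 := measurePreserving_pi (fun _ : Fin M => sampleLaw (1 / 2) θ (n + 1)) _ fun _ => hsplit
  have h3 := measurePreserving_arrowProdEquivProdArrow Cell (Fin n → ℝ) (Fin M)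
    (fun _ => cellLaw θ) (fun _ => gaussVec (Fin n))
  have h4 := (MeasurePreserving.id (Measure.pi fun _ : Fin M => cellLaw θ)).prod
    (measurePreserving_swap (m := Fin M) (J := Fin n))
  exact h4.comp (h3.comp h2)

lemma exists_rotation (n : ℕ) : ∃ O : Matrix (Fin (n + 1)) (Fin (n + 1)) ℝ, O * Oᵀ = 1 ∧
    O *ᵥ (fun _ => (√((n : ℝ) + 1))⁻¹) = Pi.single 0 1 := by
  refine exists_orthogonal_mulVec_eq ?_
  have : (0 : ℝ) < (n : ℝ) + 1 := by positivity
  simp only [dotProduct, Finset.sum_const, Finset.card_univ, Fintype.card_fin, nsmul_eq_mul,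
    Pi.single_apply]
  rw [← mul_inv, Real.mul_self_sqrt this.le]
  push_cast
  simp [this.ne']

variable {O : Matrix (Fin (n + 1)) (Fin (n + 1)) ℝ}

lemma classSign_eq (s : Sample n) : 2 * trueLabel s - 1 = classSign s.1 := by
  rw [trueLabel, classSign]; split_ifs <;> norm_num

lemma labelSign_eq (s : Sample n) : 2 * observedLabel s - 1 = labelSign s.1 := by
  rw [observedLabel, labelSign, ← classSign_eq]; split_ifs <;> ring

lemma mulVec_feature (hOv : O *ᵥ (fun _ => (√((n : ℝ) + 1))⁻¹) = Pi.single 0 1)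
    (s : Sample (n + 1)) :
    O *ᵥ feature Δ s = classSign s.1 • Pi.single 0 1 + √Δ • O *ᵥ s.2 := by
  have e : feature Δ s = classSign s.1 • (fun _ => (√((n : ℝ) + 1))⁻¹) + √Δ • s.2 := by
    funext i
    simp [feature, meanVector, classSign_eq]
  rw [e, mulVec_add, mulVec_smul, mulVec_smul, hOv]

lemma sum_feature (hO : O * Oᵀ = 1) (hOv : O *ᵥ (fun _ => (√((n : ℝ) + 1))⁻¹) = Pi.single 0 1)
    (D : Fin M → Sample (n + 1)) (μ : Fin M) :
    (∑ i, feature Δ (D μ) i) / √((n : ℝ) + 1) = signalCoord Δ ((rotate O D).1 μ) := by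
  have hO' : Oᵀ * O = 1 := mul_eq_one_comm.1 hO
  have h := dotProduct_mulVec_orthogonal hO' (fun _ => (√((n : ℝ) + 1))⁻¹) (feature Δ (D μ))
  rw [hOv, mulVec_feature hOv] at h
  simp only [single_one_dotProduct, Pi.add_apply, Pi.smul_apply, Pi.single_eq_same, smul_eq_mul,
    mul_one] at h
  rw [signalCoord, rotate, h, dotProduct, ← Finset.mul_sum, div_eq_inv_mul]

lemma dataKernel_feature (hΔ : 0 < Δ) (hO : O * Oᵀ = 1)
    (hOv : O *ᵥ (fun _ => (√((n : ℝ) + 1))⁻¹) = Pi.single 0 1) (D : Fin M → Sample (n + 1)) :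
    dataKernel (fun μ => feature Δ (D μ)) = kernel Δ ⟨(n, M), rotate O D⟩ := by
  have hO' : Oᵀ * O = 1 := mul_eq_one_comm.1 hO
  have hs : √((n : ℝ) + 1) * √((n : ℝ) + 1) = (n : ℝ) + 1 := Real.mul_self_sqrt (by positivity)
  ext μ ν
  have h := dotProduct_mulVec_orthogonal hO' (feature Δ (D μ)) (feature Δ (D ν))
  rw [mulVec_feature hOv, mulVec_feature hOv] at h
  simp only [dataKernel, of_apply]
  change (feature Δ (D μ) ⬝ᵥ feature Δ (D ν)) / _ = _
  rw [← h, dotProduct, Fin.sum_univ_succ]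
  simp only [kernel, noiseKernel, Matrix.add_apply, wishart_apply, vecMulVec_apply, cellVec,
    signalCoord, rotate, Pi.add_apply, Pi.smul_apply, Pi.single_eq_same, smul_eq_mul, mul_one]
  have e : ∀ j : Fin n, (classSign (D μ).1 * (Pi.single 0 1 : Fin (n + 1) → ℝ) j.succ +
      √Δ * (O *ᵥ (D μ).2) j.succ) * (classSign (D ν).1 * (Pi.single 0 1 : Fin (n + 1) → ℝ) j.succ +
      √Δ * (O *ᵥ (D ν).2) j.succ) = Δ * ((O *ᵥ (D μ).2) j.succ * (O *ᵥ (D ν).2) j.succ) := fun j => by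
    have : (Pi.single 0 1 : Fin (n + 1) → ℝ) j.succ = 0 := by simp
    rw [this]
    linear_combination ((O *ᵥ (D μ).2) j.succ * (O *ᵥ (D ν).2) j.succ) * Real.mul_self_sqrt hΔ.le
  rw [Finset.sum_congr rfl fun j _ => e j, ← Finset.mul_sum, div_mul_div_comm, hs]
  push_cast
  ring

end Rotation

section Estimator

variable {Δ θ : ℝ} {n M : ℕ} {O : Matrix (Fin (n + 1)) (Fin (n + 1)) ℝ}

lemma integral_prediction_error_dual (h0 : 0 ≤ θ) (h1 : θ ≤ 1 / 2) (hΔ : 0 < Δ) (hO : O * Oᵀ = 1)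
    (hOv : O *ᵥ (fun _ => (√((n : ℝ) + 1))⁻¹) = Pi.single 0 1) (D : Fin M → Sample (n + 1))
    (d : Fin M → ℝ) (B : ℝ) :
    ∫ s : Sample (n + 1), (if prediction (dualWeights (fun μ => feature Δ (D μ)) d, B) (feature Δ s)
      ≠ trueLabel s then (1 : ℝ) else 0) ∂sampleLaw (1 / 2) θ (n + 1) =
    testError Δ (signalVec Δ ⟨(n, M), rotate O D⟩ ⬝ᵥ (√((n : ℝ) + 1))⁻¹ • d)
      (((√((n : ℝ) + 1))⁻¹ • d) ⬝ᵥ kernel Δ ⟨(n, M), rotate O D⟩ *ᵥ ((√((n : ℝ) + 1))⁻¹ • d)) B := by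
  have hs : √((n : ℝ) + 1) * √((n : ℝ) + 1) = (n : ℝ) + 1 := Real.mul_self_sqrt (by positivity)
  have hs0 : √((n : ℝ) + 1) ≠ 0 := by positivity
  rw [integral_prediction_error h0 h1 hΔ, sum_dualWeights, sum_sq_dualWeights,
    dataKernel_feature hΔ hO hOv]
  congr 1
  · rw [dotProduct, ← hs, Nat.cast_add, Nat.cast_one, Finset.sum_div, Finset.sum_div]
    refine Finset.sum_congr rfl fun μ _ => ?_
    simp only [cellVec]
    rw [← sum_feature hO hOv]
    simp only [Pi.smul_apply, smul_eq_mul]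
    rw [Real.sqrt_mul_self (by positivity)]
    field_simp
  · rw [mulVec_smul, smul_dotProduct, dotProduct_smul, smul_smul, ← mul_inv, hs, smul_eq_mul,
      div_eq_inv_mul]

lemma unitVec_rotate (D : Fin M → Sample (n + 1)) :
    unitVec ⟨(n, M), rotate O D⟩ = (√((n : ℝ) + 1))⁻¹ • (1 : Fin M → ℝ) := by
  funext μ
  simp [cellVec, unitCoord]

lemma labelVec_rotate (D : Fin M → Sample (n + 1)) :
    labelVec ⟨(n, M), rotate O D⟩ = (√((n : ℝ) + 1))⁻¹ • fun μ => 2 * observedLabel (D μ) - 1 := by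
  funext μ
  simp [cellVec, labelCoord, labelSign_eq, rotate, div_eq_inv_mul]

lemma integral_error_zero (h0 : 0 ≤ θ) (h1 : θ ≤ 1 / 2) (hΔ : 0 < Δ) (hO : O * Oᵀ = 1)
    (hOv : O *ᵥ (fun _ => (√((n : ℝ) + 1))⁻¹) = Pi.single 0 1) {lam beta : ℕ → ℝ}
    (hl : 0 < lam 0) (hM : 0 < M) (D : Fin M → Sample (n + 1)) :
    ∫ s : Sample (n + 1), (if prediction (estimator Δ lam beta D 0) (feature Δ s) ≠ trueLabel s
      then (1 : ℝ) else 0) ∂sampleLaw (1 / 2) θ (n + 1) =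
    (fun x => testError Δ (signalVec Δ x ⬝ᵥ dualZero Δ (2 * lam 0) x)
      (dualZero Δ (2 * lam 0) x ⬝ᵥ kernel Δ x *ᵥ dualZero Δ (2 * lam 0) x)
      (biasZero Δ (2 * lam 0) x)) ⟨(n, M), rotate O D⟩ := by
  have hs0 : (√((n : ℝ) + 1))⁻¹ ≠ 0 := by positivity
  have he : estimator Δ lam beta D 0 = _ := minimizer_eq hl hM _ _
  rw [he, integral_prediction_error_dual h0 h1 hΔ hO hOv]
  simp only [dualZero, biasZero, labelVec_rotate, unitVec_rotate]
  rw [ridgeDual_smul _ _ _ _ hs0, ridgeBias_smul _ _ _ _ hs0, dataKernel_feature hΔ hO hOv]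

lemma integral_error_one (h0 : 0 ≤ θ) (h1 : θ ≤ 1 / 2) (hΔ : 0 < Δ) (hO : O * Oᵀ = 1)
    (hOv : O *ᵥ (fun _ => (√((n : ℝ) + 1))⁻¹) = Pi.single 0 1) {lam beta : ℕ → ℝ}
    (hl : 0 < lam 0) (hl' : 0 < lam 1) (hM : 0 < M) (D : Fin M → Sample (n + 1)) :
    ∫ s : Sample (n + 1), (if prediction (estimator Δ lam beta D 1) (feature Δ s) ≠ trueLabel s
      then (1 : ℝ) else 0) ∂sampleLaw (1 / 2) θ (n + 1) =
    (fun x => testError Δ (signalVec Δ x ⬝ᵥ dualOne Δ (2 * lam 0) (2 * lam 1) (beta 1) x)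
      (dualOne Δ (2 * lam 0) (2 * lam 1) (beta 1) x ⬝ᵥ kernel Δ x *ᵥ
        dualOne Δ (2 * lam 0) (2 * lam 1) (beta 1) x)
      (biasOne Δ (2 * lam 0) (2 * lam 1) (beta 1) x)) ⟨(n, M), rotate O D⟩ := by
  have hs0 : (√((n : ℝ) + 1))⁻¹ ≠ 0 := by positivity
  have he : estimator Δ lam beta D 1 = _ := minimizer_eq hl' hM _ _
  rw [estimator, preactivation_minimizer hl hM] at he
  rw [he, integral_prediction_error_dual h0 h1 hΔ hO hOv]
  simp only [dualOne, biasOne, labelVec_rotate, unitVec_rotate]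
  rw [distilledTarget_smul _ _ _ _ _ hs0, ridgeDual_smul _ _ _ _ hs0, ridgeBias_smul _ _ _ _ hs0,
    dataKernel_feature hΔ hO hOv]

end Estimator

section Measurability

variable {X : Type*} [MeasurableSpace X] {m : Type*} [Fintype m] [DecidableEq m]
  {K : X → Matrix m m ℝ} {o h : X → m → ℝ}

lemma measurable_ridgeBias (z : ℝ) (hK : ∀ i j, Measurable fun x => K x i j)
    (ho : ∀ i, Measurable fun x => o x i) (hh : ∀ i, Measurable fun x => h x i) :
    Measurable fun x => ridgeBias (K x) z (o x) (h x) :=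
  (measurable_form (measurable_resolvent_apply hK) ho hh).div
    (measurable_form (measurable_resolvent_apply hK) ho ho)

lemma measurable_ridgeDual (z : ℝ) (hK : ∀ i j, Measurable fun x => K x i j)
    (ho : ∀ i, Measurable fun x => o x i) (hh : ∀ i, Measurable fun x => h x i) (i : m) :
    Measurable fun x => ridgeDual (K x) z (o x) (h x) i := by
  have hB := measurable_ridgeBias z hK ho hh
  have hR : ∀ i j, Measurable fun x => resolvent (K x) z i j := measurable_resolvent_apply hK
  simp only [ridgeDual, mulVec, dotProduct, Pi.sub_apply, Pi.smul_apply, smul_eq_mul]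
  fun_prop

lemma measurable_distilledTarget (z b : ℝ) (hK : ∀ i j, Measurable fun x => K x i j)
    (ho : ∀ i, Measurable fun x => o x i) (hh : ∀ i, Measurable fun x => h x i) (i : m) :
    Measurable fun x => distilledTarget (K x) z b (o x) (h x) i := by
  have hD := measurable_ridgeDual z hK ho hh i
  have hh' := hh i
  simp only [distilledTarget, Pi.sub_apply, Pi.smul_apply, smul_eq_mul]
  fun_prop

lemma measurable_cellVec {ψ : Cell → ℝ} (hψ : Measurable ψ) (p : ℕ × ℕ) (i : Fin p.2) :
    Measurable fun ω : Noise p => cellVec ψ ⟨p, ω⟩ i := by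
  simp only [cellVec]
  fun_prop

lemma measurable_kernel (Δ : ℝ) (p : ℕ × ℕ) (i j : Fin p.2) :
    Measurable fun ω : Noise p => kernel Δ ⟨p, ω⟩ i j := by
  have hs := measurable_cellVec (measurable_signalCoord Δ) p
  simp only [kernel, noiseKernel, Matrix.add_apply, wishart_apply, vecMulVec_apply]
  have hG : Measurable fun ω : Noise p => ∑ k : Fin p.1, ω.2 k i * ω.2 k j := by fun_prop
  exact (hG.const_mul (Δ / ((p.1 : ℝ) + 1))).add ((hs i).mul (hs j))

lemma measurable_testError_dual {Δ : ℝ} {p : ℕ × ℕ} {d : Noise p → Fin p.2 → ℝ} {B : Noise p → ℝ}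
    (hd : ∀ i, Measurable fun ω => d ω i) (hB : Measurable B) :
    Measurable fun ω : Noise p => testError Δ (signalVec Δ ⟨p, ω⟩ ⬝ᵥ d ω)
      (d ω ⬝ᵥ kernel Δ ⟨p, ω⟩ *ᵥ d ω) (B ω) := by
  have hs := measurable_cellVec (measurable_signalCoord Δ) p
  refine measurable_testError ?_ (measurable_form (measurable_kernel Δ p) hd hd) hB
  change Measurable fun ω => ∑ i : Fin p.2, cellVec (signalCoord Δ) ⟨p, ω⟩ i * d ω i
  fun_prop

end Measurability

section Asymptotics

variable {α Δ θ : ℝ}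

lemma hasAsymptoticError_of_tendsto (hα : 0 < α) (h0 : 0 ≤ θ) (h1 : θ ≤ 1 / 2) {lam beta : ℕ → ℝ}
    {t : ℕ} {e : ℝ} {F : (Σ p, Noise p) → ℝ} (hm : ∀ p, Measurable fun ω : Noise p => F ⟨p, ω⟩)
    (hF : ∀ x, |F x| ≤ 1) (hlim : Tendsto F (limitFilter α θ) (𝓝 e))
    (heq : ∀ (n M : ℕ) (O : Matrix (Fin (n + 1)) (Fin (n + 1)) ℝ), O * Oᵀ = 1 →
      O *ᵥ (fun _ => (√((n : ℝ) + 1))⁻¹) = Pi.single 0 1 → 0 < M → ∀ D : Fin M → Sample (n + 1),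
      ∫ s : Sample (n + 1), (if prediction (estimator Δ lam beta D t) (feature Δ s) ≠ trueLabel s
        then (1 : ℝ) else 0) ∂sampleLaw (1 / 2) θ (n + 1) = F ⟨(n, M), rotate O D⟩) :
    HasAsymptoticError (1 / 2) θ Δ α lam beta t e := by
  have := isProbabilityMeasure_noiseLaw h0 h1
  have hgen : ∀ n M : ℕ, 0 < M → genError (1 / 2) θ Δ lam beta t (n + 1) M =
      ∫ ω, F ⟨(n, M), ω⟩ ∂noiseLaw θ (n, M) := fun n M hM => by
    obtain ⟨O, hO, hOv⟩ := exists_rotation n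
    have hmp := measurePreserving_rotate (M := M) h0 h1 hO
    rw [genError, ← hmp.map_eq, integral_map hmp.measurable.aemeasurable
      (hm (n, M)).aestronglyMeasurable]
    exact integral_congr_ae (Eventually.of_forall fun D => heq n M O hO hOv hM D)
  have h_int : Tendsto (fun p => ∫ ω, F ⟨p, ω⟩ ∂noiseLaw θ p) (regime α) (𝓝 e) :=
    tendsto_integral_of_probFilter (X := fun p ω => F ⟨p, ω⟩)
      (Eventually.of_forall fun p => (hm p).aestronglyMeasurable) (fun p ω => hF ⟨p, ω⟩) hlim
  intro N M hN hMN
  have hN1 : ∀ᶠ k in atTop, 1 ≤ N k := hN.eventually_ge_atTop 1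
  have hM1 : ∀ᶠ k in atTop, 0 < M k := by
    filter_upwards [hMN.eventually (lt_mem_nhds hα)] with k hk
    refine Nat.pos_of_ne_zero fun h => ?_
    simp [h] at hk
  have hreg : Tendsto (fun k => (N k - 1, M k)) atTop (regime α) := by
    refine tendsto_regime ((tendsto_sub_atTop_nat 1).comp hN) (hMN.congr' ?_)
    filter_upwards [hN1] with k hk
    rw [Nat.cast_sub hk, Nat.cast_one, sub_add_cancel]
  refine (h_int.comp hreg).congr' ?_
  filter_upwards [hN1, hM1] with k hk hMk
  have h := hgen (N k - 1) (M k) hMk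
  rw [Nat.sub_add_cancel hk] at h
  exact h.symm

/-- The asymptotic error of stage `0`. -/
noncomputable def limitErrorZero (α Δ θ l : ℝ) : ℝ :=
  gaussTail (alignment α Δ θ (2 * l) / (√Δ * √(weightSq α Δ θ (2 * l))))

/-- The asymptotic error of stage `1`; it does not depend on the inverse temperature. -/
noncomputable def limitErrorOne (α Δ θ l₀ l₁ : ℝ) : ℝ :=
  gaussTail (distilledAlignment α Δ θ (2 * l₀) (2 * l₁) /
    (√Δ * √(distilledSq α Δ θ (2 * l₀) (2 * l₁))))

variable (hα : 0 < α) (hΔ : 0 < Δ) (h0 : 0 ≤ θ) (h1 : θ ≤ 1 / 2)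

include hα hΔ h0 h1

lemma hasAsymptoticError_zero (lam beta : ℕ → ℝ) (hl : 0 < lam 0) :
    HasAsymptoticError (1 / 2) θ Δ α lam beta 0 (limitErrorZero α Δ θ (lam 0)) := by
  have hz : 0 < 2 * lam 0 := by positivity
  have hd := tendsto_dualZero hα hΔ h0 h1 hz
  refine hasAsymptoticError_of_tendsto hα h0 h1 (fun p => ?_) (fun x => abs_testError_le _ _ _ _)
    (tendsto_testError hΔ (weightSq_pos hα hΔ hz h0 h1) hd.1 hd.2
      (tendsto_biasZero hα hΔ h0 h1 hz))
    (fun n M O hO hOv hM D => integral_error_zero h0 h1 hΔ hO hOv hl hM D)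
  have hu := measurable_cellVec measurable_unitCoord p
  have hh := measurable_cellVec measurable_labelCoord p
  exact measurable_testError_dual (measurable_ridgeDual _ (measurable_kernel Δ p) hu hh)
    (measurable_ridgeBias _ (measurable_kernel Δ p) hu hh)

lemma hasAsymptoticError_one (lam beta : ℕ → ℝ) (hl : 0 < lam 0) (hl' : 0 < lam 1)
    (hb : 0 < beta 1) :
    HasAsymptoticError (1 / 2) θ Δ α lam beta 1 (limitErrorOne α Δ θ (lam 0) (lam 1)) := by
  have hz : 0 < 2 * lam 0 := by positivity
  have hw : 0 < 2 * lam 1 := by positivity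
  have hQ := distilledSq_pos hα hΔ h0 h1 hz hw
  have hd := tendsto_dualOne hα hΔ h0 h1 hz hw (beta 1)
  have hlim := tendsto_testError hΔ (by positivity) hd.1 hd.2
    (tendsto_biasOne (b := beta 1) hα hΔ h0 h1 hz hw)
  have e : beta 1 * distilledAlignment α Δ θ (2 * lam 0) (2 * lam 1) /
      (√Δ * √(beta 1 ^ 2 * distilledSq α Δ θ (2 * lam 0) (2 * lam 1))) =
      distilledAlignment α Δ θ (2 * lam 0) (2 * lam 1) /
      (√Δ * √(distilledSq α Δ θ (2 * lam 0) (2 * lam 1))) := by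
    rw [Real.sqrt_mul (by positivity), Real.sqrt_sq hb.le, mul_left_comm,
      mul_div_mul_left _ _ hb.ne']
  rw [e] at hlim
  refine hasAsymptoticError_of_tendsto hα h0 h1 (fun p => ?_) (fun x => abs_testError_le _ _ _ _)
    hlim (fun n M O hO hOv hM D => integral_error_one h0 h1 hΔ hO hOv hl hl' hM D)
  have hu := measurable_cellVec measurable_unitCoord p
  have hh := measurable_distilledTarget (2 * lam 0) (beta 1) (measurable_kernel Δ p) hu
    (measurable_cellVec measurable_labelCoord p)
  exact measurable_testError_dual (measurable_ridgeDual _ (measurable_kernel Δ p) hu hh)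
    (measurable_ridgeBias _ (measurable_kernel Δ p) hu hh)

omit h0 h1 in
lemma tendsto_limitErrorZero :
    Tendsto (limitErrorZero α Δ θ) atTop (𝓝 (errorZero α Δ θ)) := by
  have h := (tendsto_alignment_ratio (θ := θ) hα hΔ).comp (tendsto_id.const_mul_atTop two_pos)
  rw [errorZero]
  exact (continuous_gaussTail.tendsto _).comp h

lemma errorZero_le {l : ℝ} (hl : 0 < l) : errorZero α Δ θ ≤ limitErrorZero α Δ θ l := by
  rw [errorZero, limitErrorZero]
  exact antitone_gaussTail (alignment_ratio_le hα hΔ (by positivity) h0 h1)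

lemma tendsto_limitErrorOne :
    Tendsto (fun l : ℝ × ℝ => limitErrorOne α Δ θ l.1 l.2) (atTop ×ˢ atTop)
      (𝓝 (errorOne α Δ θ)) := by
  have h2 : Tendsto (fun l : ℝ × ℝ => (2 * l.1, 2 * l.2)) (atTop ×ˢ atTop) (atTop ×ˢ atTop) :=
    (tendsto_id.const_mul_atTop two_pos).prodMap (tendsto_id.const_mul_atTop two_pos)
  have hT := thirdMoment_pos (θ := θ) hα hΔ
  have hA := (tendsto_distilledAlignment (θ := θ) hα hΔ).div
    ((tendsto_scaled_distilledSq hα hΔ h0 h1).sqrt.const_mul √Δ) (by positivity)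
  have hpos : ∀ᶠ l : ℝ × ℝ in atTop ×ˢ atTop, 0 < l.1 ∧ 0 < l.2 :=
    (eventually_gt_atTop 0).prod_mk (eventually_gt_atTop 0)
  have hR : Tendsto (fun l : ℝ × ℝ => distilledAlignment α Δ θ l.1 l.2 /
      (√Δ * √(distilledSq α Δ θ l.1 l.2))) (atTop ×ˢ atTop)
      (𝓝 (α * (Δ + α + Δ * α) * (1 - 2 * θ) / √(Δ * thirdMoment α Δ θ))) := by
    rw [Real.sqrt_mul hΔ.le]
    refine hA.congr' ?_
    filter_upwards [hpos] with l hl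
    have hl0 : 0 < l.1 * l.2 := mul_pos hl.1 hl.2
    simp only [Pi.div_apply]
    rw [Real.sqrt_mul (by positivity), Real.sqrt_sq hl0.le, mul_left_comm,
      mul_div_mul_left _ _ hl0.ne']
  have h := (continuous_gaussTail.tendsto _).comp (hR.comp h2)
  have e : gaussTail (α * (Δ + α + Δ * α) * (1 - 2 * θ) / √(Δ * thirdMoment α Δ θ)) =
      errorOne α Δ θ := by rw [thirdMoment, errorOne]
  rw [e] at h
  refine h.congr fun l => ?_
  simp only [Function.comp_apply, limitErrorOne]

end Asymptotics

end SelfDistillation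

theorem mainTheorem2 (α Δ θ : ℝ) (hα : 0 < α) (hΔ : 0 < Δ) (hθ₀ : 0 ≤ θ) (hθ₁ : θ ≤ 1 / 2) :
    ∃ (E₀ : ℝ → ℝ) (E₁ : ℝ → ℝ → ℝ → ℝ),
      -- the asymptotic errors at fixed hyperparameters
      (∀ lam beta : ℕ → ℝ, 0 < lam 0 →
        SelfDistillation.HasAsymptoticError (1 / 2) θ Δ α lam beta 0 (E₀ (lam 0))) ∧
      (∀ lam beta : ℕ → ℝ, 0 < lam 0 → 0 < lam 1 → 0 < beta 1 →
        SelfDistillation.HasAsymptoticError (1 / 2) θ Δ α lam beta 1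
          (E₁ (lam 0) (lam 1) (beta 1))) ∧
      -- their limits at infinite regularization
      Tendsto E₀ atTop (𝓝 (SelfDistillation.errorZero α Δ θ)) ∧
      (∀ b : ℝ, 0 < b →
        Tendsto (fun l : ℝ × ℝ => E₁ l.1 l.2 b) (atTop ×ˢ atTop)
          (𝓝 (SelfDistillation.errorOne α Δ θ))) ∧
      -- the optimal errors over all hyperparameters
      IsGLB {e | ∃ l : ℝ, 0 < l ∧ e = E₀ l} (SelfDistillation.errorZero α Δ θ) ∧
      ∃ Eopt : ℝ,
        IsGLB {e | ∃ l₀ l₁ b : ℝ, 0 < l₀ ∧ 0 < l₁ ∧ 0 < b ∧ e = E₁ l₀ l₁ b} Eopt ∧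
        Eopt ≤ SelfDistillation.errorOne α Δ θ := by
  have hlim₀ := SelfDistillation.tendsto_limitErrorZero (θ := θ) hα hΔ
  have hlim₁ := SelfDistillation.tendsto_limitErrorOne hα hΔ hθ₀ hθ₁
  refine ⟨SelfDistillation.limitErrorZero α Δ θ,
    fun l₀ l₁ _ => SelfDistillation.limitErrorOne α Δ θ l₀ l₁,
    SelfDistillation.hasAsymptoticError_zero hα hΔ hθ₀ hθ₁,
    SelfDistillation.hasAsymptoticError_one hα hΔ hθ₀ hθ₁, hlim₀, fun _ _ => hlim₁, ⟨?_, ?_⟩, ?_⟩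
  · rintro _ ⟨l, hl, rfl⟩
    exact SelfDistillation.errorZero_le hα hΔ hθ₀ hθ₁ hl
  · intro c hc
    refine ge_of_tendsto hlim₀ ?_
    filter_upwards [eventually_gt_atTop 0] with l hl
    exact hc ⟨l, hl, rfl⟩
  · set S := {e | ∃ l₀ l₁ b : ℝ, 0 < l₀ ∧ 0 < l₁ ∧ 0 < b ∧
      e = SelfDistillation.limitErrorOne α Δ θ l₀ l₁}
    have hglb : IsGLB S (sInf S) := by
      refine isGLB_csInf ⟨_, 1, 1, 1, one_pos, one_pos, one_pos, rfl⟩ ⟨0, ?_⟩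
      rintro _ ⟨l₀, l₁, b, -, -, -, rfl⟩
      exact SelfDistillation.gaussTail_nonneg _
    refine ⟨sInf S, hglb, ge_of_tendsto hlim₁ ?_⟩
    filter_upwards [(eventually_gt_atTop (0 : ℝ)).prod_mk (eventually_gt_atTop (0 : ℝ))] with l hl
    exact hglb.1 ⟨l.1, l.2, 1, hl.1, hl.2, one_pos, rfl⟩
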